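/- Let $M$ be a connected, simply connected smooth manifold, let $\mathfrak{k}$ be a finite-dimensional real Lie algebra, and let $\widetilde{K}$ be the connected, simply connected Lie group with Lie algebra $\mathfrak{k}$. Let $TM\times\mathfrak{k}\Rightarrow M$ be the trivial transitive Lie algebroid, with anchor $v+\xi\mapsto v$ and bracket \[ [X+\xi,\,Y+\eta]=[X,Y]+[\xi,\eta]+\mathcal{L}_X\eta-\mathcal{L}_Y\xi \] for vector fields $X,Y$ on $M$ and $\xi,\eta\in C^\infty(M,\mathfrak{k})$. Let $\operatorname{Gau}(TM\times\mathfrak{k})$ be its group of gauge transformations, i.e. of Lie algebroid automorphisms preserving the anchor. The group $\operatorname{Aut}(\mathfrak{k})$ of Lie algebra automorphisms acts on $\widetilde{K}$ by smooth group automorphisms, where $\Psi$ acts by the unique automorphism with differential $\Psi$ at the identity $e$; hence it acts on the group $C^\infty(M,\widetilde{K})$ by composition, and we may form the semi-direct product $C^\infty(M,\widetilde{K})\rtimes\operatorname{Aut}(\mathfrak{k})$. Let $\theta^R\in\Omega^1(\widetilde{K},\mathfrak{k})$ be the right-invariant Maurer-Cartan form. Sending $(f,\Psi)$ to the transformation \[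 v+\xi\;\mapsto\; v+\operatorname{Ad}_{f(m)}\Psi(\xi)-\iota_v f^*\theta^R,\qquad v\in T_mM,\ \xi\in\mathfrak{k}, \] defines a group homomorphism \[ C^\infty(M,\widetilde{K})\rtimes\operatorname{Aut}(\mathfrak{k})\to\operatorname{Gau}(TM\times\mathfrak{k}). \] This homomorphism is surjective. Its kernel consists of the pairs $(c^{-1},\operatorname{Ad}_c)$ with $c\in\widetilde{K}$, where $c^{-1}$ is regarded as a constant function. Equivalently, given a base point $m_0\in M$, every gauge transformation is given by a unique pair $(f,\Psi)$ with $f(m_0)=e$. -/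

import Mathlib

open scoped Manifold ContDiff

/-- A Lie ring with a compatible norm (used only to express smoothness of maps into it; no relation
between the norm and the bracket is required). -/
class NormedLieRing (k : Type*) extends NormedAddCommGroup k, LieRing k

/-- A real Lie algebra whose underlying vector space is normed. Every finite-dimensional real Lie
algebra is of this form, and the smooth structure does not depend on the norm. -/
class NormedLieAlgebra (k : Type*) [NormedLieRing k] extends NormedSpace ℝ k, LieAlgebra ℝ k

instance instLEInftyMinSmoothnessThree : ENat.LEInfty (minSmoothness ℝ 3) := by
  rw [minSmoothness_of_isRCLikeNormedField]
  infer_instance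

instance (priority := 100) instCompleteSpaceOfFiniteDimensionalReal (F : Type*)
    [NormedAddCommGroup F] [NormedSpace ℝ F] [FiniteDimensional ℝ F] : CompleteSpace F :=
  FiniteDimensional.complete ℝ F

noncomputable section

/-! ### The trivial transitive Lie algebroid `TM × k` and its gauge transformations -/

namespace TrivialAlgebroid

variable {E : Type*} [NormedAddCommGroup E] [NormedSpace ℝ E]
  {H : Type*} [TopologicalSpace H] (I : ModelWithCorners ℝ E H)
  {M : Type*} [TopologicalSpace M] [ChartedSpace H M] [IsManifold I ∞ M]
  {k : Type*} [NormedLieRing k] [NormedLieAlgebra k]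

/-- Smoothness of a section `X + ξ` of `TM × k`. -/
def IsSmoothSection (σ : Π m : M, TangentSpace I m × k) : Prop :=
  ContMDiff I (I.tangent.prod 𝓘(ℝ, k)) ∞
    (fun m : M => ((⟨m, (σ m).1⟩ : TangentBundle I M), (σ m).2))

/-- The Lie algebroid bracket `[X + ξ, Y + η] = [X, Y] + ([ξ, η] + L_X η - L_Y ξ)`. -/
def bracket (σ τ : Π m : M, TangentSpace I m × k) (m : M) : TangentSpace I m × k :=
  (VectorField.mlieBracket I (fun x => (σ x).1) (fun x => (τ x).1) m,
    ⁅(σ m).2, (τ m).2⁆ + mvfderiv I (fun x => (τ x).2) m (σ m).1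
      - mvfderiv I (fun x => (σ x).2) m (τ m).1)

/-- The map of total spaces given by a family of linear automorphisms of the fibres of `TM × k`. -/
def totalMap (Φ : Π m : M, (TangentSpace I m × k) ≃ₗ[ℝ] (TangentSpace I m × k))
    (p : TangentBundle I M × k) : TangentBundle I M × k :=
  (⟨p.1.1, (Φ p.1.1 (p.1.2, p.2)).1⟩, (Φ p.1.1 (p.1.2, p.2)).2)

/-- `Φ` is a Lie algebroid automorphism of `TM × k` preserving the anchor `v + ξ ↦ v`. (Preserving
the anchor forces the underlying map of `M` to be the identity, so a vector bundle automorphism is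
here a family of linear automorphisms of the fibres that is smooth together with its inverse.) -/
structure IsGauge (Φ : Π m : M, (TangentSpace I m × k) ≃ₗ[ℝ] (TangentSpace I m × k)) :
    Prop where
  smooth : ContMDiff (I.tangent.prod 𝓘(ℝ, k)) (I.tangent.prod 𝓘(ℝ, k)) ∞ (totalMap I Φ)
  smooth_inv : ContMDiff (I.tangent.prod 𝓘(ℝ, k)) (I.tangent.prod 𝓘(ℝ, k)) ∞ (totalMap I Φ⁻¹)
  anchor : ∀ (m : M) (x : TangentSpace I m × k), (Φ m x).1 = x.1
  map_bracket : ∀ σ τ : Π m : M, TangentSpace I m × k,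
    IsSmoothSection I σ → IsSmoothSection I τ → ∀ m : M,
      Φ m (bracket I σ τ m) = bracket I (fun x => Φ x (σ x)) (fun x => Φ x (τ x)) m

variable {I}

lemma IsSmoothSection.map {Φ : Π m : M, (TangentSpace I m × k) ≃ₗ[ℝ] (TangentSpace I m × k)}
    (hΦ : ContMDiff (I.tangent.prod 𝓘(ℝ, k)) (I.tangent.prod 𝓘(ℝ, k)) ∞ (totalMap I Φ))
    {σ : Π m : M, TangentSpace I m × k} (hσ : IsSmoothSection I σ) :
    IsSmoothSection I (fun m => Φ m (σ m)) :=
  hΦ.comp hσ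

variable (I M k) in
/-- The group `Gau(TM × k)` of gauge transformations. -/
def gaugeGroup : Subgroup (Π m : M, (TangentSpace I m × k) ≃ₗ[ℝ] (TangentSpace I m × k)) where
  carrier := {Φ | IsGauge I Φ}
  one_mem' :=
    { smooth := contMDiff_id
      smooth_inv := by rw [inv_one]; exact contMDiff_id
      anchor := fun _ _ => rfl
      map_bracket := fun _ _ _ _ _ => rfl }
  mul_mem' {Φ Ψ} hΦ hΨ :=
    { smooth := hΦ.smooth.comp hΨ.smooth
      smooth_inv := by rw [mul_inv_rev]; exact hΨ.smooth_inv.comp hΦ.smooth_inv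
      anchor := fun m x => (hΦ.anchor m (Ψ m x)).trans (hΨ.anchor m x)
      map_bracket := fun σ τ hσ hτ m =>
        (congrArg (Φ m) (hΨ.map_bracket σ τ hσ hτ m)).trans
          (hΦ.map_bracket _ _ (hσ.map hΨ.smooth) (hτ.map hΨ.smooth) m) }
  inv_mem' {Φ} hΦ :=
    { smooth := hΦ.smooth_inv
      smooth_inv := by rw [inv_inv]; exact hΦ.smooth
      anchor := fun m x => by
        have h := hΦ.anchor m ((Φ m).symm x)
        rw [LinearEquiv.apply_symm_apply] at h
        exact h.symm
      map_bracket := fun σ τ hσ hτ m => by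
        have h := hΦ.map_bracket _ _ (hσ.map hΦ.smooth_inv) (hτ.map hΦ.smooth_inv) m
        have e : ∀ ρ : Π m : M, TangentSpace I m × k,
            (fun x => Φ x (Φ⁻¹ x (ρ x))) = ρ := fun ρ =>
          funext fun x => LinearEquiv.apply_symm_apply (Φ x) (ρ x)
        rw [e σ, e τ] at h
        exact (LinearEquiv.symm_apply_eq (Φ m)).2 h.symm }

end TrivialAlgebroid

/-! ### Automorphisms of Lie algebras and of Lie groups -/

/-- The group `Aut(k)` of Lie algebra automorphisms. -/
def lieAut (k : Type*) [LieRing k] [LieAlgebra ℝ k] : Subgroup (k ≃ₗ[ℝ] k) where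
  carrier := {Ψ | ∀ x y : k, Ψ ⁅x, y⁆ = ⁅Ψ x, Ψ y⁆}
  one_mem' := fun _ _ => rfl
  mul_mem' {Φ Ψ} hΦ hΨ := fun x y => (congrArg Φ (hΨ x y)).trans (hΦ (Ψ x) (Ψ y))
  inv_mem' {Φ} hΦ := fun x y => by
    refine (LinearEquiv.symm_apply_eq Φ).2 ?_
    have h := hΦ (Φ.symm x) (Φ.symm y)
    rw [LinearEquiv.apply_symm_apply, LinearEquiv.apply_symm_apply] at h
    exact h.symm

namespace LieGroupAut

variable {F : Type*} [NormedAddCommGroup F] [NormedSpace ℝ F]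
  {HK : Type*} [TopologicalSpace HK] (J : ModelWithCorners ℝ F HK)
  (K : Type*) [TopologicalSpace K] [ChartedSpace HK K] [Group K]

/-- The group of smooth automorphisms of a Lie group. -/
def smoothAut : Subgroup (MulAut K) where
  carrier := {s | ContMDiff J J ∞ s ∧ ContMDiff J J ∞ s.symm}
  one_mem' := ⟨contMDiff_id, contMDiff_id⟩
  mul_mem' hs ht := ⟨hs.1.comp ht.1, ht.2.comp hs.2⟩
  inv_mem' hs := ⟨hs.2, hs.1⟩

variable {J K}

lemma mdiff (s : smoothAut J K) (x : K) : MDifferentiableAt J J s.1 x :=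
  (s.2.1 x).mdifferentiableAt (by simp)

/-- The differential at the identity of a smooth automorphism, as a linear map. -/
def dOne (s : smoothAut J K) : GroupLieAlgebra J K →ₗ[ℝ] GroupLieAlgebra J K where
  toFun v := (mfderiv J J s.1 (1 : K) v : F)
  map_add' := fun v w => map_add (mfderiv J J s.1 (1 : K)) v w
  map_smul' := fun c v => map_smul (mfderiv J J s.1 (1 : K)) c v

lemma dOne_one (v : GroupLieAlgebra J K) : dOne (1 : smoothAut J K) v = v := by
  change mfderiv J J (id : K → K) 1 v = v
  rw [mfderiv_id]; rfl

lemma mfderiv_at_map_one (s : smoothAut J K) {g : K → K} (v : F) :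
    (mfderiv J J g (s.1 1) v : F) = (mfderiv J J g (1 : K) v : F) := by
  have : ∀ x : K, x = 1 → (mfderiv J J g x v : F) = (mfderiv J J g (1 : K) v : F) := by
    rintro x rfl; rfl
  exact this _ (map_one s.1)

lemma dOne_mul (s t : smoothAut J K) (v : GroupLieAlgebra J K) :
    dOne (s * t) v = dOne s (dOne t v) := by
  change mfderiv J J (s.1 ∘ t.1) 1 v = _
  rw [mfderiv_comp (I' := J) _ (mdiff s _) (mdiff t _)]
  exact mfderiv_at_map_one t (g := s.1) (dOne t v)

lemma dOne_dOne_inv (s : smoothAut J K) (v : GroupLieAlgebra J K) :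
    dOne s (dOne s⁻¹ v) = v := by
  rw [← dOne_mul, mul_inv_cancel, dOne_one]

lemma dOne_inv_dOne (s : smoothAut J K) (v : GroupLieAlgebra J K) :
    dOne s⁻¹ (dOne s v) = v := by
  rw [← dOne_mul, inv_mul_cancel, dOne_one]

lemma mfderiv_inverse (s : smoothAut J K) (g : K) (v : F) :
    ((mfderiv J J s.1 g).inverse (mfderiv J J s.1 g v) : F) = v := by
  have a : (mfderiv J J (s⁻¹).1 (s.1 g)).comp (mfderiv J J s.1 g) = ContinuousLinearMap.id _ _ := by
    rw [← mfderiv_comp (I' := J) _ (mdiff s⁻¹ _) (mdiff s _)]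
    have : ((s⁻¹).1 : K → K) ∘ s.1 = id := funext fun x => s.1.symm_apply_apply x
    rw [this, mfderiv_id]
  have b : (mfderiv J J s.1 g).comp (mfderiv J J (s⁻¹).1 (s.1 g)) = ContinuousLinearMap.id _ _ := by
    have h : (s.1 : K → K) ∘ (s⁻¹).1 = id := funext fun x => s.1.apply_symm_apply x
    have h' := mfderiv_comp (I := J) (I' := J) (I'' := J) (s.1 g) (mdiff s _) (mdiff s⁻¹ (s.1 g))
    rw [h, mfderiv_id] at h'
    have h4 : ∀ x : K, x = g → (mfderiv J J s.1 x : F →L[ℝ] F) = mfderiv J J s.1 g := by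
      rintro x rfl; rfl
    ext w
    have h5 := congrArg (fun T : F →L[ℝ] F => T w) h'.symm
    have h6 := congrArg (fun T : F →L[ℝ] F => T (mfderiv J J (s⁻¹).1 (s.1 g) w))
      (h4 ((s⁻¹).1 (s.1 g)) (s.1.symm_apply_apply g))
    exact h6.symm.trans h5
  rw [ContinuousLinearMap.inverse_eq b a]
  exact congrArg (fun T : F →L[ℝ] F => T v) a

variable [LieGroup J ∞ K]

lemma contMDiff_left (g : K) : ContMDiff J J ∞ (fun x => g * x) := contMDiff_mul_left

lemma mdiff_left (g x : K) : MDifferentiableAt J J (fun x => g * x) x :=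
  (contMDiff_left (J := J) g x).mdifferentiableAt (by simp)

lemma mfderiv_mulInvariantVectorField (s : smoothAut J K) (v : GroupLieAlgebra J K) (g : K) :
    (mfderiv J J s.1 g (mulInvariantVectorField (I := J) v g) : F) =
      (mulInvariantVectorField (I := J) (dOne s v) (s.1 g) : F) := by
  have h1 : mfderiv J J (s.1 ∘ fun x => g * x) 1 v =
      mfderiv J J s.1 (g * 1) (mfderiv J J (fun x => g * x) 1 v) := by
    rw [mfderiv_comp (I' := J) _ (mdiff s _) (mdiff_left _ _)]; rfl
  have h2 : mfderiv J J ((fun x => s.1 g * x) ∘ s.1) 1 v =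
      mfderiv J J (fun x => s.1 g * x) (s.1 1) (mfderiv J J s.1 1 v) := by
    rw [mfderiv_comp (I' := J) _ (mdiff_left _ _) (mdiff s _)]; rfl
  have h3 : (s.1 ∘ fun x => g * x) = ((fun x => s.1 g * x) ∘ s.1) := by
    funext x; exact map_mul s.1 g x
  have h4 : ∀ x : K, x = g → ∀ w : F, (mfderiv J J s.1 x w : F) = (mfderiv J J s.1 g w : F) := by
    rintro x rfl w; rfl
  have h5 : (mfderiv J J (s.1 ∘ fun x => g * x) 1 v : F)
      = (mfderiv J J ((fun x => s.1 g * x) ∘ s.1) 1 v : F) := by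
    rw [h3]
  have h6 := (h4 (g * 1) (mul_one g) (mfderiv J J (fun x => g * x) 1 v)).symm
  exact h6.trans ((h1.symm.trans (h5.trans h2)).trans
    (mfderiv_at_map_one s (g := fun x => s.1 g * x) (mfderiv J J s.1 1 v)))

variable [FiniteDimensional ℝ F]

lemma dOne_lie (s : smoothAut J K) (v w : GroupLieAlgebra J K) :
    dOne s ⁅v, w⁆ = ⁅dOne s v, dOne s w⁆ := by
  have key : ∀ u : GroupLieAlgebra J K,
      VectorField.mpullback J J s.1 (mulInvariantVectorField (I := J) (dOne s u)) =
        mulInvariantVectorField u := by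
    intro u
    funext g
    have h := mfderiv_mulInvariantVectorField s u g
    change (mfderiv J J s.1 g).inverse _ = _
    exact (congrArg (mfderiv J J s.1 g).inverse h.symm).trans (mfderiv_inverse s g _)
  have hs : ContMDiffAt J J (minSmoothness ℝ 3) s.1 (1 : K) :=
    (s.2.1 1).of_le ENat.LEInfty.out
  have hb := VectorField.mpullback_mlieBracket (I := J) (I' := J) (f := s.1) (x₀ := (1 : K))
    (V := mulInvariantVectorField (I := J) (dOne s v))
    (W := mulInvariantVectorField (I := J) (dOne s w))
    (mdifferentiableAt_mulInvariantVectorField _) (mdifferentiableAt_mulInvariantVectorField _)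
    hs (minSmoothness_monotone (by norm_cast))
  rw [key v, key w] at hb
  have hc : ∀ x : K, x = 1 → (VectorField.mlieBracket J
      (mulInvariantVectorField (I := J) (dOne s v))
      (mulInvariantVectorField (I := J) (dOne s w)) x : F) =
        (⁅dOne s v, dOne s w⁆ : GroupLieAlgebra J K) := by
    rintro x rfl; rfl
  have hd : ((mfderiv J J s.1 1).inverse (⁅dOne s v, dOne s w⁆ : GroupLieAlgebra J K) : F) =
      (⁅v, w⁆ : GroupLieAlgebra J K) :=
    (congrArg (mfderiv J J s.1 1).inverse (hc _ (map_one s.1)).symm).trans hb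
  have he : ∀ y : GroupLieAlgebra J K, ((mfderiv J J s.1 1).inverse y : F) = dOne s⁻¹ y := by
    intro y
    have h := mfderiv_inverse s 1 (dOne s⁻¹ y)
    exact (congrArg (mfderiv J J s.1 1).inverse (dOne_dOne_inv s y).symm).trans h
  have hf : (⁅v, w⁆ : GroupLieAlgebra J K) = dOne s⁻¹ ⁅dOne s v, dOne s w⁆ :=
    hd.symm.trans (he _)
  rw [hf, dOne_dOne_inv]

variable {k : Type*} [LieRing k] [LieAlgebra ℝ k]

/-- The differential `Aut(K) → Aut(k)`, `s ↦ T_e s`, where `k` is identified with the Lie algebra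
of `K` by the isomorphism `e`. -/
def differential (e : GroupLieAlgebra J K ≃ₗ⁅ℝ⁆ k) : smoothAut J K →* lieAut k where
  toFun s :=
    ⟨{ toFun := fun x => e (dOne s (e.symm x))
       invFun := fun x => e (dOne s⁻¹ (e.symm x))
       map_add' := fun x y => by simp
       map_smul' := fun c x => by simp
       left_inv := fun x => by simp [dOne_inv_dOne]
       right_inv := fun x => by simp [dOne_dOne_inv] },
      fun x y => by
        change e (dOne s (e.symm ⁅x, y⁆)) = ⁅e (dOne s (e.symm x)), e (dOne s (e.symm y))⁆
        rw [LieEquiv.map_lie, dOne_lie, LieEquiv.map_lie]⟩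
  map_one' := by
    refine Subtype.ext (LinearEquiv.ext fun x => ?_)
    change e (dOne 1 (e.symm x)) = x
    rw [dOne_one, LieEquiv.apply_symm_apply]
  map_mul' s t := by
    refine Subtype.ext (LinearEquiv.ext fun x => ?_)
    change e (dOne (s * t) (e.symm x)) = e (dOne s (e.symm (e (dOne t (e.symm x)))))
    rw [dOne_mul, LieEquiv.symm_apply_apply]

variable (J) in
/-- Conjugation `x ↦ c x c⁻¹`, as a smooth automorphism. -/
def conj : K →* smoothAut J K where
  toFun c := ⟨MulAut.conj c,
    (contMDiff_mul_right (a := c⁻¹)).comp (contMDiff_mul_left (a := c)),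
    by
      have h : ContMDiff J J ∞ (fun x : K => c⁻¹ * x * c) :=
        (contMDiff_mul_right (a := c)).comp (contMDiff_mul_left (a := c⁻¹))
      refine h.congr fun x => ?_
      simp⟩
  map_one' := Subtype.ext (map_one MulAut.conj)
  map_mul' c d := Subtype.ext (map_mul MulAut.conj c d)

/-- The adjoint representation `Ad : K → Aut(k)`. -/
def Ad (e : GroupLieAlgebra J K ≃ₗ⁅ℝ⁆ k) : K →* lieAut k :=
  (differential e).comp (conj J)

/-- The right-invariant Maurer-Cartan form `θᴿ ∈ Ω¹(K, k)`: it maps `w ∈ T_g K` to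
`T(R_{g⁻¹}) w ∈ T_e K = k`. -/
def maurerCartanRight (e : GroupLieAlgebra J K ≃ₗ⁅ℝ⁆ k) (g : K) (w : TangentSpace J g) : k :=
  e (mfderiv J J (fun x : K => x * g⁻¹) g w : F)

variable {E : Type*} [NormedAddCommGroup E] [NormedSpace ℝ E]
  {H : Type*} [TopologicalSpace H] (I : ModelWithCorners ℝ E H)
  (M : Type*) [TopologicalSpace M] [ChartedSpace H M]

/-- Smooth automorphisms of `K` act on the group `C^∞(M, K)` by composition, `(s, f) ↦ s ∘ f`. -/
def postcomp : smoothAut J K →* MulAut C^∞⟮I, M; J, K⟯ where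
  toFun s :=
    { toFun := fun f => ⟨fun m => s.1 (f m), s.2.1.comp f.contMDiff⟩
      invFun := fun f => ⟨fun m => s.1.symm (f m), s.2.2.comp f.contMDiff⟩
      left_inv := fun f => ContMDiffMap.ext fun m => s.1.symm_apply_apply (f m)
      right_inv := fun f => ContMDiffMap.ext fun m => s.1.apply_symm_apply (f m)
      map_mul' := fun f g => ContMDiffMap.ext fun m => map_mul s.1 (f m) (g m) }
  map_one' := rfl
  map_mul' _ _ := rfl

end LieGroupAut

end

/-! ### Total differential equations `Df(x) = G(x, f(x))` -/

section TotalDifferential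

open Set Metric Filter Topology
open scoped NNReal

variable {E : Type*} [NormedAddCommGroup E] [NormedSpace ℝ E]
  {F : Type*} [NormedAddCommGroup F] [NormedSpace ℝ F]

/-! A bundle automorphism of `TM × k` preserving the anchor has the form `v + ξ ↦ v + A_m ξ +
β_m(v)`. Testing bracket preservation on two vector fields gives `dβ + ½[β, β] = 0`. On a simply
connected manifold such a flat form is `h^*θᴸ` for some `h : M → K` with `h m₀ = 1`
(`exists_leftLogDeriv_eq`). With `f = h⁻¹` one has `h^*θᴸ = -f^*θᴿ`, so the transformation attached
to `(f, 1)` agrees with the given one on tangent vectors. The quotient of the two fixes `TM`.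
Bracketing with vector fields makes its `k`-part constant in `m`, and bracketing constant sections
makes that part a Lie algebra automorphism `Ψ` (`IsGauge.exists_lieAut`). Hence the given
transformation comes from `(f, Ψ)`. In the kernel `β = 0`, so `f` is constant and `Ad_f Ψ = 1`.
Normalizing `f m₀ = 1` leaves only the trivial element of the kernel.

Primitives of flat forms are built locally and then glued. In charts, `h^*θᴸ = β` is a total
differential equation `Df(x) = G(x, f(x))`, and its integrability condition is flatness combined
with the structure equation of left-invariant fields. The equation is solved along rays, and
Gronwall's inequality shows that the result has the prescribed derivative. Two primitives differ by
a locally constant left factor (`mul_inv_eventually_eq`), so the local primitives form a covering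
space of `M`, which has a global section because `M` is simply connected.

The same theorem on `K`, applied to `Ψ ∘ θᴸ`, integrates `Ψ` to an automorphism of `K`; uniqueness
of primitives gives multiplicativity and inverses (`differential_surjective`).

Conversely, that a pair `(f, Ψ)` preserves brackets rests on the Maurer–Cartan equation
`isFlatOn_leftLogDeriv` and on the derivative of `Ad`. The latter is a mixed curvature component of
the Maurer–Cartan equation for `(t, x) ↦ γ(t) h(x)` (`adjointCLM_inv_deriv`). -/

lemma norm_le_mul_gronwallBound_one {e e' : ℝ → F} {K ε : ℝ} (hK : 0 ≤ K) (hε : 0 ≤ ε)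
    (he : ∀ t ∈ Icc (0 : ℝ) 1, HasDerivWithinAt e (e' t) (Icc 0 1) t) (h0 : e 0 = 0)
    (bound : ∀ t ∈ Icc (0 : ℝ) 1, ‖e' t‖ ≤ K * ‖e t‖ + ε) :
    ∀ t ∈ Icc (0 : ℝ) 1, ‖e t‖ ≤ ε * gronwallBound 0 K 1 1 := by
  intro t ht
  have h1 := norm_le_gronwallBound_of_norm_deriv_right_le (f := e) (f' := e') (δ := 0) (K := K)
    (ε := ε) (a := 0) (b := 1) (fun t ht => (he t ht).continuousWithinAt)
    (fun t ht => ((he t ⟨ht.1, ht.2.le⟩).mono_of_mem_nhdsWithin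
      (Icc_mem_nhdsGE_of_mem ht)))
    (by simp [h0]) (fun t ht => bound t ⟨ht.1, ht.2.le⟩) t ht
  have h2 : gronwallBound 0 K ε (t - 0) ≤ gronwallBound 0 K ε 1 :=
    gronwallBound_mono le_rfl hε hK (by linarith [ht.2])
  -- Zero initial value makes the Gronwall bound linear in `ε`; this is what later carries a source
  -- of order `‖h‖ ^ 2` over to the solution.
  have h3 : gronwallBound 0 K ε 1 = ε * gronwallBound 0 K 1 1 := by
    by_cases hK0 : K = 0
    · simp [hK0, gronwallBound_K0]
    · simp only [gronwallBound_of_K_ne_0 hK0]; ring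
  linarith

lemma gronwallBound_zero_one_nonneg {K : ℝ} (hK : 0 ≤ K) : 0 ≤ gronwallBound 0 K 1 1 := by
  have := gronwallBound_mono (le_refl (0 : ℝ)) (zero_le_one (α := ℝ)) hK (zero_le_one (α := ℝ))
  rwa [gronwallBound_x0] at this

/-- Solution of a differential equation along a time interval `[0, 1]` that remains in the ball in
which the vector field is controlled. -/
lemma IsPicardLindelof.exists_solution_mem_closedBall [CompleteSpace F] {f : ℝ → F → F}
    {t₀ : Icc (0 : ℝ) 1} {y₀ : F} {a L K : ℝ≥0} (hf : IsPicardLindelof f t₀ y₀ a 0 L K) :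
    ∃ α : ℝ → F, α t₀ = y₀ ∧ (∀ t, α t ∈ closedBall y₀ a) ∧
      ∀ t ∈ Icc (0 : ℝ) 1, HasDerivWithinAt α (f t (α t)) (Icc 0 1) t := by
  have hx : y₀ ∈ closedBall y₀ ((0 : ℝ≥0) : ℝ) := mem_closedBall_self le_rfl
  -- Working with the Picard fixed point itself retains the confinement to the ball; its extension
  -- `compProj` is constant outside the time interval, hence confined for all `t`.
  obtain ⟨α, hα⟩ := ODE.FunSpace.exists_isFixedPt_next hf hx
  refine ⟨α.compProj, by rw [ODE.FunSpace.compProj_val, ← hα, ODE.FunSpace.next_apply₀],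
    fun t => α.compProj_mem_closedBall hf.mul_max_le, fun t ht ↦ ?_⟩
  apply ODE.hasDerivWithinAt_picard_Icc t₀.2 hf.continuousOn_uncurry
    α.continuous_compProj.continuousOn (fun _ ht' ↦ α.compProj_mem_closedBall hf.mul_max_le)
    y₀ ht |>.congr_of_mem _ ht
  intro t' ht'
  nth_rw 1 [← hα]
  rw [ODE.FunSpace.compProj_of_mem ht', ODE.FunSpace.next_apply]

/-- Quantitative form of the local Frobenius theorem, under uniform bounds on a ball. -/
lemma exists_hasFDerivAt_of_symmetric_of_bounds [CompleteSpace F] {G : E × F → E →L[ℝ] F}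
    {G' : E × F → E × F →L[ℝ] E →L[ℝ] F} {x₀ : E} {y₀ : F} {r C : ℝ} (hr : 0 < r) (hC : 0 ≤ C)
    (hG : ∀ p ∈ closedBall (x₀, y₀) r, HasFDerivAt G (G' p) p)
    (hGC : ∀ p ∈ closedBall (x₀, y₀) r, ‖G p‖ ≤ C)
    (hGC' : ∀ p ∈ closedBall (x₀, y₀) r, ‖G' p‖ ≤ C)
    (hGL : ∀ p ∈ closedBall (x₀, y₀) r, ∀ q ∈ closedBall (x₀, y₀) r, ‖G' p - G' q‖ ≤ C * ‖p - q‖)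
    (hsymm : ∀ p ∈ closedBall (x₀, y₀) r, ∀ v w, G' p (v, G p v) w = G' p (w, G p w) v) :
    ∃ f : E → F, f x₀ = y₀ ∧
      ∀ᶠ x in 𝓝 x₀, f x ∈ closedBall y₀ r ∧ HasFDerivAt f (G (x, f x)) x := by
  have hball : ∀ {x y}, x ∈ closedBall x₀ r → y ∈ closedBall y₀ r →
      (x, y) ∈ closedBall (x₀, y₀) r := fun hx hy => by
    rw [← closedBall_prod_same]; exact ⟨hx, hy⟩
  have hconv : Convex ℝ (closedBall (x₀, y₀) r) := convex_closedBall _ _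
  have hGlip : ∀ p ∈ closedBall (x₀, y₀) r, ∀ q ∈ closedBall (x₀, y₀) r,
      ‖G p - G q‖ ≤ C * ‖p - q‖ := fun p hp q hq =>
    hconv.norm_image_sub_le_of_norm_hasFDerivWithin_le
      (fun x hx => (hG x hx).hasFDerivWithinAt) hGC' hq hp
  -- Along a ray of length at most `ρ` the speed is at most `C * ρ ≤ r`, so the solution stays in
  -- the ball up to time 1.
  obtain ⟨ρ, hρ, hρr, hCρ⟩ : ∃ ρ : ℝ, 0 < ρ ∧ ρ ≤ r ∧ C * ρ ≤ r := by
    refine ⟨min r (r / (C + 1)), by positivity, min_le_left _ _, ?_⟩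
    calc C * min r (r / (C + 1)) ≤ C * (r / (C + 1)) := by gcongr; exact min_le_right _ _
      _ ≤ r := by rw [mul_div_assoc', div_le_iff₀ (by positivity)]; nlinarith
  have hray : ∀ u : E, ‖u‖ ≤ ρ → ∀ t ∈ Icc (0 : ℝ) 1, x₀ + t • u ∈ closedBall x₀ r := by
    intro u hu t ht
    rw [mem_closedBall, dist_eq_norm, add_sub_cancel_left, norm_smul, Real.norm_of_nonneg ht.1]
    nlinarith [ht.1, ht.2, norm_nonneg u]
  -- The function `g u` solves the equation restricted to the ray `x₀ + t • u`; the final solution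
  -- is `x₀ + u ↦ g u 1`. For long `u` nothing is claimed.
  have hsol : ∀ u : E, ∃ g : ℝ → F, ‖u‖ ≤ ρ → g 0 = y₀ ∧ (∀ t, g t ∈ closedBall y₀ r) ∧
      ∀ t ∈ Icc (0 : ℝ) 1, HasDerivWithinAt g (G (x₀ + t • u, g t) u) (Icc 0 1) t := by
    intro u
    by_cases hu : ‖u‖ ≤ ρ
    swap
    · exact ⟨0, fun h => absurd h hu⟩
    have hPL : IsPicardLindelof (fun t y => G (x₀ + t • u, y) u)
        (⟨0, by simp⟩ : Icc (0 : ℝ) 1) y₀ ⟨r, hr.le⟩ 0 ⟨C * ρ, by positivity⟩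
        ⟨C * ρ, by positivity⟩ := by
      constructor
      · intro t ht
        refine LipschitzOnWith.of_dist_le_mul fun y hy y' hy' => ?_
        rw [dist_eq_norm, dist_eq_norm, ← _root_.sub_apply]
        have h1 := hGlip _ (hball (hray u hu t ht) hy) _ (hball (hray u hu t ht) hy')
        have h2 : ‖((x₀ + t • u, y) : E × F) - (x₀ + t • u, y')‖ = ‖y - y'‖ := by
          simp [Prod.norm_def]
        rw [h2] at h1
        calc _ ≤ ‖G (x₀ + t • u, y) - G (x₀ + t • u, y')‖ * ‖u‖ := ContinuousLinearMap.le_opNorm _ _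
          _ ≤ (C * ‖y - y'‖) * ρ := by gcongr
          _ = C * ρ * ‖y - y'‖ := by ring
      · intro y hy t ht
        have h1 : ContinuousAt G (x₀ + t • u, y) := (hG _ (hball (hray u hu t ht) hy)).continuousAt
        have h2 : ContinuousAt (fun t : ℝ => G (x₀ + t • u, y)) t :=
          ContinuousAt.comp (f := fun t : ℝ => (x₀ + t • u, y)) h1 (by fun_prop)
        exact (h2.clm_apply continuousAt_const).continuousWithinAt
      · intro t ht y hy
        calc _ ≤ ‖G (x₀ + t • u, y)‖ * ‖u‖ := ContinuousLinearMap.le_opNorm _ _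
          _ ≤ C * ρ := by gcongr; exact hGC _ (hball (hray u hu t ht) hy)
      · have h1 : max ((1 : ℝ) - 0) (0 - 0) = 1 := by norm_num
        change C * ρ * max ((1 : ℝ) - 0) (0 - 0) ≤ r - 0
        rw [h1]; linarith
    obtain ⟨g, h0, hmem, hd⟩ := hPL.exists_solution_mem_closedBall
    exact ⟨g, fun _ => ⟨h0, hmem, hd⟩⟩
  choose g hg using hsol
  set Γ : ℝ := gronwallBound 0 (C * ρ) 1 1 with hΓ
  have hΓ0 : 0 ≤ Γ := gronwallBound_zero_one_nonneg (by positivity)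
  -- Lipschitz dependence on the ray
  have hlip : ∀ u w : E, ‖u‖ ≤ ρ → ‖w‖ ≤ ρ → ∀ t ∈ Icc (0 : ℝ) 1,
      ‖g w t - g u t‖ ≤ (C + C * ρ) * ‖w - u‖ * Γ := by
    intro u w hu hw
    obtain ⟨hu0, humem, hud⟩ := hg u hu
    obtain ⟨hw0, hwmem, hwd⟩ := hg w hw
    refine norm_le_mul_gronwallBound_one (K := C * ρ) (by positivity) (by positivity)
      (fun t ht => (hwd t ht).sub (hud t ht)) (by simp [hu0, hw0]) fun t ht => ?_
    have hp := hball (hray u hu t ht) (humem t)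
    have hq := hball (hray w hw t ht) (hwmem t)
    have h1 : G (x₀ + t • w, g w t) w - G (x₀ + t • u, g u t) u =
        G (x₀ + t • w, g w t) (w - u) + (G (x₀ + t • w, g w t) - G (x₀ + t • u, g u t)) u := by
      simp [map_sub]
    have h2 : ‖((x₀ + t • w, g w t) : E × F) - (x₀ + t • u, g u t)‖ ≤
        ‖w - u‖ + ‖g w t - g u t‖ := by
      have h3 : ((x₀ + t • w, g w t) : E × F) - (x₀ + t • u, g u t) =
          (t • (w - u), g w t - g u t) := by
        ext <;> simp [smul_sub]
      rw [h3, Prod.norm_def]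
      refine max_le ?_ (by simp)
      rw [norm_smul, Real.norm_of_nonneg ht.1]
      nlinarith [ht.1, ht.2, norm_nonneg (w - u), norm_nonneg (g w t - g u t)]
    calc ‖G (x₀ + t • w, g w t) w - G (x₀ + t • u, g u t) u‖
        ≤ ‖G (x₀ + t • w, g w t) (w - u)‖ +
          ‖(G (x₀ + t • w, g w t) - G (x₀ + t • u, g u t)) u‖ := by rw [h1]; exact norm_add_le _ _
      _ ≤ C * ‖w - u‖ + (C * (‖w - u‖ + ‖g w t - g u t‖)) * ρ := by
          gcongr
          · exact (ContinuousLinearMap.le_opNorm _ _).trans (by gcongr; exact hGC _ hq)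
          · refine (ContinuousLinearMap.le_opNorm _ _).trans ?_
            gcongr
            exact (hGlip _ hq _ hp).trans (by gcongr)
      _ = C * ρ * ‖g w t - g u t‖ + (C + C * ρ) * ‖w - u‖ := by ring
  set A : ℝ := 1 + (C + C * ρ) * Γ with hA
  have hA0 : 0 ≤ A := by positivity
  -- second order estimate
  have hquad : ∀ u h : E, ‖u‖ ≤ ρ → ‖u + h‖ ≤ ρ →
      ‖g (u + h) 1 - g u 1 - G (x₀ + u, g u 1) h‖ ≤ (C * A ^ 2 * ρ + C * A) * ‖h‖ ^ 2 * Γ := by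
    intro u h hu hw
    obtain ⟨hu0, humem, hud⟩ := hg u hu
    obtain ⟨hw0, hwmem, hwd⟩ := hg (u + h) hw
    set p : ℝ → E × F := fun t => (x₀ + t • u, g u t) with hp_def
    set q : ℝ → E × F := fun t => (x₀ + t • (u + h), g (u + h) t) with hq_def
    have hp : ∀ t ∈ Icc (0 : ℝ) 1, p t ∈ closedBall (x₀, y₀) r := fun t ht =>
      hball (hray u hu t ht) (humem t)
    have hq : ∀ t ∈ Icc (0 : ℝ) 1, q t ∈ closedBall (x₀, y₀) r := fun t ht =>
      hball (hray _ hw t ht) (hwmem t)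
    have hpd : ∀ t ∈ Icc (0 : ℝ) 1, HasDerivWithinAt p (u, G (p t) u) (Icc 0 1) t := by
      intro t ht
      refine HasDerivWithinAt.prodMk ?_ (hud t ht)
      simpa using (((hasDerivAt_id t).smul_const u).const_add x₀).hasDerivWithinAt
    have hGp : ∀ t ∈ Icc (0 : ℝ) 1, HasDerivWithinAt (fun t => t • G (p t) h)
        (t • G' (p t) (u, G (p t) u) h + G (p t) h) (Icc 0 1) t := by
      intro t ht
      have h1 : HasDerivWithinAt (fun t => G (p t)) (G' (p t) (u, G (p t) u)) (Icc 0 1) t :=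
        (hG _ (hp t ht)).comp_hasDerivWithinAt t (hpd t ht)
      have h2 : HasDerivWithinAt (fun t => G (p t) h) (G' (p t) (u, G (p t) u) h) (Icc 0 1) t := by
        simpa using h1.clm_apply (hasDerivWithinAt_const t _ h)
      have h3 := (hasDerivWithinAt_id t (Icc 0 1)).smul h2
      rw [one_smul] at h3
      exact h3
    have hqp : ∀ t ∈ Icc (0 : ℝ) 1, ‖q t - p t‖ ≤ A * ‖h‖ := by
      intro t ht
      have h3 : q t - p t = (t • h, g (u + h) t - g u t) := by
        ext <;> simp [hp_def, hq_def]
      rw [h3, Prod.norm_def]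
      have h4 := hlip u (u + h) hu hw t ht
      rw [add_sub_cancel_left] at h4
      refine max_le ?_ ?_
      · rw [norm_smul, Real.norm_of_nonneg ht.1]
        calc t * ‖h‖ ≤ 1 * ‖h‖ := by gcongr; exact ht.2
          _ ≤ A * ‖h‖ := by gcongr; rw [hA]; linarith [show 0 ≤ (C + C * ρ) * Γ by positivity]
      · refine h4.trans ?_
        rw [hA]; nlinarith [norm_nonneg h]
    -- The expected first variation of `g u t` in direction `h` is `t • G (p t) h`, since the end
    -- point moves by `t • h`. The deviation from it satisfies a linear differential inequality with
    -- source of order `‖h‖ ^ 2`.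
    have key := norm_le_mul_gronwallBound_one
      (e := fun t => g (u + h) t - g u t - t • G (p t) h) (K := C * ρ)
      (ε := (C * A ^ 2 * ρ + C * A) * ‖h‖ ^ 2) (by positivity) (by positivity)
      (fun t ht => ((hwd t ht).sub (hud t ht)).sub (hGp t ht)) (by simp [hu0, hw0])
      (fun t ht => ?_) 1 (by simp)
    · simpa [hp_def] using key
    set δ : F := g (u + h) t - g u t - t • G (p t) h with hδ
    have hΔ : q t - p t = t • (h, G (p t) h) + (0, δ) := by
      ext <;> simp [hp_def, hq_def, hδ]
    have hR : ‖G (q t) - G (p t) - G' (p t) (q t - p t)‖ ≤ C * ‖q t - p t‖ * ‖q t - p t‖ := by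
      refine (convex_segment (𝕜 := ℝ) (p t) (q t)).norm_image_sub_le_of_norm_hasFDerivWithin_le'
        (f' := G') (fun z hz => (hG z (hconv.segment_subset (hp t ht) (hq t ht) hz)).hasFDerivWithinAt)
        (fun z hz => ?_) (left_mem_segment _ _ _) (right_mem_segment _ _ _)
      refine (hGL z (hconv.segment_subset (hp t ht) (hq t ht) hz) _ (hp t ht)).trans ?_
      gcongr
      exact norm_sub_le_of_mem_segment hz
    -- Integrability exchanges `u` and `h` in the derivative of the candidate variation. The
    -- first-order terms then cancel, leaving a Taylor remainder, a term quadratic in `h`, and a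
    -- term linear in `δ`.
    have hsplit : G (q t) (u + h) - G (p t) u - (t • G' (p t) (u, G (p t) u) h + G (p t) h) =
        (G (q t) - G (p t) - G' (p t) (q t - p t)) (u + h) + G' (p t) (q t - p t) h +
          G' (p t) (0, δ) u := by
      rw [hsymm _ (hp t ht) u h]
      have h5 : G' (p t) (q t - p t) u = t • G' (p t) (h, G (p t) h) u + G' (p t) (0, δ) u := by
        rw [hΔ, map_add, map_smul]; rfl
      simp only [_root_.sub_apply, map_add, h5]
      abel
    change ‖G (q t) (u + h) - G (p t) u - (t • G' (p t) (u, G (p t) u) h + G (p t) h)‖ ≤ _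
    rw [hsplit]
    have hδn : ‖((0, δ) : E × F)‖ = ‖δ‖ := by simp [Prod.norm_def]
    have e1 : ‖(G (q t) - G (p t) - G' (p t) (q t - p t)) (u + h)‖ ≤
        (C * (A * ‖h‖) * (A * ‖h‖)) * ρ := by
      refine (ContinuousLinearMap.le_opNorm _ _).trans ?_
      have := hqp t ht
      gcongr
      exact hR.trans (by gcongr)
    have e2 : ‖G' (p t) (q t - p t) h‖ ≤ (C * (A * ‖h‖)) * ‖h‖ := by
      refine (ContinuousLinearMap.le_opNorm _ _).trans ?_
      gcongr
      refine (ContinuousLinearMap.le_opNorm _ _).trans ?_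
      have := hqp t ht
      have := hGC' _ (hp t ht)
      gcongr
    have e3 : ‖G' (p t) (0, δ) u‖ ≤ (C * ‖δ‖) * ρ := by
      refine (ContinuousLinearMap.le_opNorm _ _).trans ?_
      gcongr
      refine (ContinuousLinearMap.le_opNorm _ _).trans ?_
      rw [hδn]
      have := hGC' _ (hp t ht)
      gcongr
    calc _ ≤ (C * (A * ‖h‖) * (A * ‖h‖)) * ρ + (C * (A * ‖h‖)) * ‖h‖ + (C * ‖δ‖) * ρ :=
          norm_add₃_le.trans (by gcongr)
      _ = C * ρ * ‖δ‖ + (C * A ^ 2 * ρ + C * A) * ‖h‖ ^ 2 := by ring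
  refine ⟨fun x => g (x - x₀) 1, ?_, ?_⟩
  -- Along the constant ray the velocity vanishes, so Gronwall with `K = ε = 0` gives `g 0 1 = y₀`.
  · have h0 : ‖(0 : E)‖ ≤ ρ := by simpa using hρ.le
    obtain ⟨h1, -, h3⟩ := hg 0 h0
    have := norm_le_mul_gronwallBound_one (e := fun t => g 0 t - y₀) (K := 0) (ε := 0) le_rfl le_rfl
      (fun t ht => (h3 t ht).sub_const y₀) (by simp [h1]) (by simp) 1 (by simp)
    simpa [sub_eq_zero] using this
  · filter_upwards [ball_mem_nhds x₀ hρ] with x hx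
    have hu : ‖x - x₀‖ < ρ := by rwa [mem_ball, dist_eq_norm] at hx
    refine ⟨(hg _ hu.le).2.1 1, ?_⟩
    rw [hasFDerivAt_iff_isLittleO_nhds_zero]
    have hO : (fun h : E => g (x + h - x₀) 1 - g (x - x₀) 1 - G (x, g (x - x₀) 1) h)
        =O[𝓝 0] fun h => ‖h‖ ^ 2 := by
      refine Asymptotics.IsBigO.of_bound ((C * A ^ 2 * ρ + C * A) * Γ) ?_
      have hev : ∀ᶠ h : E in 𝓝 0, ‖x - x₀ + h‖ < ρ := by
        have hc : ContinuousAt (fun h : E => ‖x - x₀ + h‖) 0 := by fun_prop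
        exact hc.eventually_lt continuousAt_const (by simpa using hu)
      filter_upwards [hev] with h hh
      have := hquad (x - x₀) h hu.le hh.le
      rw [show x + h - x₀ = x - x₀ + h by abel, norm_pow, norm_norm]
      rw [add_sub_cancel] at this
      linarith
    refine hO.trans_isLittleO ?_
    simpa using (Asymptotics.isLittleO_norm_pow_id (E' := E) one_lt_two)

/-- **Local Frobenius theorem** for total differential equations. -/
theorem exists_contDiffOn_hasFDerivAt_of_symmetric [CompleteSpace F] {G : E × F → E →L[ℝ] F}
    {W : Set (E × F)} (hW : IsOpen W) (hG : ContDiffOn ℝ ∞ G W) {x₀ : E} {y₀ : F}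
    (h₀ : (x₀, y₀) ∈ W)
    (hsymm : ∀ p ∈ W, ∀ v w, fderiv ℝ G p (v, G p v) w = fderiv ℝ G p (w, G p w) v) :
    ∃ (f : E → F) (U : Set E), IsOpen U ∧ x₀ ∈ U ∧ f x₀ = y₀ ∧ ContDiffOn ℝ ∞ f U ∧
      ∀ x ∈ U, (x, f x) ∈ W ∧ HasFDerivAt f (G (x, f x)) x := by
  have hGat : ∀ p ∈ W, ContDiffAt ℝ ∞ G p := fun p hp => hG.contDiffAt (hW.mem_nhds hp)
  have hG' : ContDiffAt ℝ 1 (fderiv ℝ G) (x₀, y₀) :=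
    (hGat _ h₀).fderiv_right (m := 1) (by norm_cast)
  obtain ⟨K, s, hs, hK⟩ := hG'.exists_lipschitzOnWith
  have e1 : ∀ᶠ p in 𝓝 (x₀, y₀), ‖G p‖ < ‖G (x₀, y₀)‖ + 1 :=
    (hGat _ h₀).continuousAt.norm.eventually_lt continuousAt_const (by simp)
  have e2 : ∀ᶠ p in 𝓝 (x₀, y₀), ‖fderiv ℝ G p‖ ≤ ‖fderiv ℝ G (x₀, y₀)‖ + K := by
    filter_upwards [hs, closedBall_mem_nhds (x₀, y₀) one_pos] with p hp hp1
    have h1 := hK.dist_le_mul p hp _ (mem_of_mem_nhds hs)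
    rw [dist_eq_norm] at h1
    have h2 : (K : ℝ) * dist p (x₀, y₀) ≤ K * 1 := by gcongr; exact hp1
    have h3 := norm_sub_norm_le (fderiv ℝ G p) (fderiv ℝ G (x₀, y₀))
    linarith
  obtain ⟨r, hr, hball⟩ := nhds_basis_closedBall.mem_iff.1
    (inter_mem (inter_mem (hW.mem_nhds h₀) hs) (inter_mem e1 e2))
  set C : ℝ := max (K : ℝ) (max (‖G (x₀, y₀)‖ + 1) (‖fderiv ℝ G (x₀, y₀)‖ + K)) with hC
  have hKC : (K : ℝ) ≤ C := le_max_left _ _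
  obtain ⟨f, hf0, hf⟩ := exists_hasFDerivAt_of_symmetric_of_bounds (G := G) (G' := fderiv ℝ G)
    (C := C) hr (K.2.trans hKC)
    (fun p hp => ((hGat p (hball hp).1.1).differentiableAt (by simp)).hasFDerivAt)
    (fun p hp => (hball hp).2.1.le.trans ((le_max_left _ _).trans (le_max_right _ _)))
    (fun p hp => (hball hp).2.2.trans ((le_max_right _ _).trans (le_max_right _ _)))
    (fun p hp q hq => by
      have := hK.dist_le_mul p (hball hp).1.2 q (hball hq).1.2
      rw [dist_eq_norm, dist_eq_norm] at this
      exact this.trans (by gcongr))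
    (fun p hp => hsymm p (hball hp).1.1)
  have hev : ∀ᶠ x in 𝓝 x₀, (x, f x) ∈ W ∧ HasFDerivAt f (G (x, f x)) x := by
    filter_upwards [hf, closedBall_mem_nhds x₀ hr] with x hx hx'
    refine ⟨(hball ?_).1.1, hx.2⟩
    rw [← closedBall_prod_same]; exact ⟨hx', hx.1⟩
  obtain ⟨U, hU, hUo, hxU⟩ := _root_.eventually_nhds_iff.1 hev
  refine ⟨f, U, hUo, hxU, hf0, ?_, hU⟩
  -- Bootstrapping: if `f` is `C^n`, then so is its derivative `G (x, f x)`, hence `f` is `C^(n+1)`.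
  refine contDiffOn_infty.2 fun n => ?_
  induction n with
  | zero =>
    exact contDiffOn_zero.2 fun x hx => (hU x hx).2.continuousAt.continuousWithinAt
  | succ n ih =>
    have : ((n + 1 : ℕ) : WithTop ℕ∞) = (n : WithTop ℕ∞) + 1 := by push_cast; rfl
    rw [this, contDiffOn_succ_iff_fderiv_of_isOpen hUo]
    refine ⟨fun x hx => (hU x hx).2.differentiableAt.differentiableWithinAt, by simp, ?_⟩
    have hc : ContDiffOn ℝ n (fun x => G (x, f x)) U :=
      (hG.of_le (by exact_mod_cast le_top)).comp (contDiffOn_id.prodMk ih) fun x hx => (hU x hx).1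
    exact hc.congr fun x hx => (hU x hx).2.fderiv

end TotalDifferential

noncomputable section

open Set Filter Topology

/-! ### Derivatives of maps between manifolds, as maps between the model spaces -/

section TangentDerivative

variable (E : Type*) [NormedAddCommGroup E] [NormedSpace ℝ E]
  (F : Type*) [NormedAddCommGroup F] [NormedSpace ℝ F]
  {F' : Type*} [NormedAddCommGroup F'] [NormedSpace ℝ F']
  {M : Type*} [TopologicalSpace M] [ChartedSpace E M]
  {N : Type*} [TopologicalSpace N] [ChartedSpace F N]
  {P : Type*} [TopologicalSpace P] [ChartedSpace F' P]

/-- The derivative of a map between manifolds without boundary, as a map of the model spaces. -/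
def tderiv (f : M → N) (x : M) : E →L[ℝ] F := mfderiv 𝓘(ℝ, E) 𝓘(ℝ, F) f x

variable {E F}

lemma tderiv_comp {g : N → P} {f : M → N} {x : M}
    (hg : MDifferentiableAt 𝓘(ℝ, F) 𝓘(ℝ, F') g (f x))
    (hf : MDifferentiableAt 𝓘(ℝ, E) 𝓘(ℝ, F) f x) :
    tderiv E F' (g ∘ f) x = (tderiv F F' g (f x)).comp (tderiv E F f x) :=
  mfderiv_comp x hg hf

lemma tderiv_comp_of_eq {g : N → P} {f : M → N} {x : M} {y : N}
    (hg : MDifferentiableAt 𝓘(ℝ, F) 𝓘(ℝ, F') g y)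
    (hf : MDifferentiableAt 𝓘(ℝ, E) 𝓘(ℝ, F) f x) (hy : f x = y) :
    tderiv E F' (g ∘ f) x = (tderiv F F' g y).comp (tderiv E F f x) := by
  subst hy; exact tderiv_comp hg hf

lemma tderiv_id (x : M) : tderiv E E (id : M → M) x = ContinuousLinearMap.id ℝ E :=
  mfderiv_id

lemma tderiv_const (c : N) (x : M) : tderiv E F (fun _ : M => c) x = 0 :=
  mfderiv_const

lemma tderiv_congr {f g : M → N} {x : M} (h : f =ᶠ[𝓝 x] g) : tderiv E F f x = tderiv E F g x :=
  h.mfderiv_eq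

lemma tderiv_eq_fderiv (f : E → F) (x : E) : tderiv E F f x = fderiv ℝ f x :=
  mfderiv_eq_fderiv

section Chart

variable [IsManifold 𝓘(ℝ, E) ∞ M] {c x : M} {y : E}

lemma contMDiffAt_chartAt (hx : x ∈ (chartAt E c).source) :
    ContMDiffAt 𝓘(ℝ, E) 𝓘(ℝ, E) ∞ (chartAt E c) x :=
  contMDiffOn_chart.contMDiffAt ((chartAt E c).open_source.mem_nhds hx)

lemma contMDiffAt_chartAt_symm (hy : y ∈ (chartAt E c).target) :
    ContMDiffAt 𝓘(ℝ, E) 𝓘(ℝ, E) ∞ (chartAt E c).symm y :=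
  contMDiffOn_chart_symm.contMDiffAt ((chartAt E c).open_target.mem_nhds hy)

lemma mdifferentiableAt_chartAt (hx : x ∈ (chartAt E c).source) :
    MDifferentiableAt 𝓘(ℝ, E) 𝓘(ℝ, E) (chartAt E c) x :=
  (contMDiffAt_chartAt hx).mdifferentiableAt (by simp)

lemma mdifferentiableAt_chartAt_symm (hy : y ∈ (chartAt E c).target) :
    MDifferentiableAt 𝓘(ℝ, E) 𝓘(ℝ, E) (chartAt E c).symm y :=
  (contMDiffAt_chartAt_symm hy).mdifferentiableAt (by simp)

lemma tderiv_chartAt_comp_symm (hy : y ∈ (chartAt E c).target) :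
    (tderiv E E (chartAt E c) ((chartAt E c).symm y)).comp (tderiv E E (chartAt E c).symm y) =
      ContinuousLinearMap.id ℝ E := by
  rw [← tderiv_comp (mdifferentiableAt_chartAt ((chartAt E c).map_target hy))
    (mdifferentiableAt_chartAt_symm hy), ← tderiv_id (M := E) y]
  refine tderiv_congr ?_
  filter_upwards [(chartAt E c).open_target.mem_nhds hy] with z hz
  exact (chartAt E c).right_inv hz

lemma tderiv_chartAt_symm_comp (hx : x ∈ (chartAt E c).source) :
    (tderiv E E (chartAt E c).symm (chartAt E c x)).comp (tderiv E E (chartAt E c) x) =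
      ContinuousLinearMap.id ℝ E := by
  rw [← tderiv_comp (mdifferentiableAt_chartAt_symm ((chartAt E c).map_source hx))
    (mdifferentiableAt_chartAt hx), ← tderiv_id x]
  refine tderiv_congr ?_
  filter_upwards [(chartAt E c).open_source.mem_nhds hx] with z hz
  exact (chartAt E c).left_inv hz

lemma tderiv_chartAt_symm_comp' (hy : y ∈ (chartAt E c).target) :
    (tderiv E E (chartAt E c).symm y).comp (tderiv E E (chartAt E c) ((chartAt E c).symm y)) =
      ContinuousLinearMap.id ℝ E := by
  have h := tderiv_chartAt_symm_comp ((chartAt E c).map_target hy)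
  rwa [(chartAt E c).right_inv hy] at h

end Chart

end TangentDerivative

/-! ### The left-invariant Maurer–Cartan form -/

section LieGroup

variable {F : Type*} [NormedAddCommGroup F] [NormedSpace ℝ F]
  {K : Type*} [TopologicalSpace K] [ChartedSpace F K] [Group K] [LieGroup 𝓘(ℝ, F) ∞ K]
  {E : Type*} [NormedAddCommGroup E] [NormedSpace ℝ E]
  {M : Type*} [TopologicalSpace M] [ChartedSpace E M]
  {E' : Type*} [NormedAddCommGroup E'] [NormedSpace ℝ E']
  {M' : Type*} [TopologicalSpace M'] [ChartedSpace E' M']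

lemma mdifferentiableAt_mul_left' (g x : K) :
    MDifferentiableAt 𝓘(ℝ, F) 𝓘(ℝ, F) (fun y => g * y) x :=
  (contMDiff_mul_left (n := ∞) (a := g) x).mdifferentiableAt (by simp)

lemma mdifferentiableAt_mul_right' (g x : K) :
    MDifferentiableAt 𝓘(ℝ, F) 𝓘(ℝ, F) (fun y => y * g) x :=
  (contMDiff_mul_right (n := ∞) (a := g) x).mdifferentiableAt (by simp)

lemma mdifferentiableAt_conj (g x : K) :
    MDifferentiableAt 𝓘(ℝ, F) 𝓘(ℝ, F) (fun y => g * y * g⁻¹) x :=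
  (((contMDiff_mul_right (n := ∞) (a := g⁻¹)).comp
    (contMDiff_mul_left (n := ∞) (a := g))) x).mdifferentiableAt (by simp)

lemma tderiv_mul {a b : M → K} {x : M} (ha : MDifferentiableAt 𝓘(ℝ, E) 𝓘(ℝ, F) a x)
    (hb : MDifferentiableAt 𝓘(ℝ, E) 𝓘(ℝ, F) b x) :
    tderiv E F (fun y => a y * b y) x =
      (tderiv F F (fun y => y * b x) (a x)).comp (tderiv E F a x) +
        (tderiv F F (fun y => a x * y) (b x)).comp (tderiv E F b x) := by
  have hm : MDifferentiableAt (𝓘(ℝ, F).prod 𝓘(ℝ, F)) 𝓘(ℝ, F) (fun p : K × K => p.1 * p.2)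
      (a x, b x) := (contMDiff_mul 𝓘(ℝ, F) ∞ (a x, b x)).mdifferentiableAt (by simp)
  have h1 := mfderiv_comp (I := 𝓘(ℝ, E)) (I' := 𝓘(ℝ, F).prod 𝓘(ℝ, F)) (I'' := 𝓘(ℝ, F))
    (f := fun y => (a y, b y)) (g := fun p : K × K => p.1 * p.2) x hm (ha.prodMk hb)
  ext v
  have h2 := congrArg (fun T : E →L[ℝ] F => T v) h1
  refine h2.trans ?_
  have h3 : mfderiv 𝓘(ℝ, E) (𝓘(ℝ, F).prod 𝓘(ℝ, F)) (fun y => (a y, b y)) x =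
    (mfderiv 𝓘(ℝ, E) 𝓘(ℝ, F) a x).prod (mfderiv 𝓘(ℝ, E) 𝓘(ℝ, F) b x) := ha.mfderiv_prod hb
  have h4 := mfderiv_prod_eq_add_apply (v := ((tderiv E F a x v, tderiv E F b x v) : F × F)) hm
  refine Eq.trans ?_ h4
  exact congrArg (fun T : E →L[ℝ] F × F =>
    (mfderiv (𝓘(ℝ, F).prod 𝓘(ℝ, F)) 𝓘(ℝ, F) (fun p : K × K => p.1 * p.2) (a x, b x) :
      F × F →L[ℝ] F) (T v)) h3

lemma MDifferentiableAt.inv_group {h : M → K} {x : M}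
    (hh : MDifferentiableAt 𝓘(ℝ, E) 𝓘(ℝ, F) h x) :
    MDifferentiableAt 𝓘(ℝ, E) 𝓘(ℝ, F) (fun y => (h y)⁻¹) x :=
  MDifferentiableAt.comp (I' := 𝓘(ℝ, F)) (g := fun g : K => g⁻¹) x
    ((contMDiff_inv 𝓘(ℝ, F) ∞ (h x)).mdifferentiableAt (by simp)) hh

variable [FiniteDimensional ℝ F]
  {k : Type*} [NormedLieRing k] [NormedLieAlgebra k]
  (e : GroupLieAlgebra 𝓘(ℝ, F) K ≃ₗ⁅ℝ⁆ k)

/-- The identification of the model space of a Lie group with its Lie algebra. -/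
def modelEquiv : F ≃L[ℝ] k :=
  LinearEquiv.toContinuousLinearEquiv (show F ≃ₗ[ℝ] k from e.toLinearEquiv)

/-- The left-invariant Maurer–Cartan form `θᴸ`. -/
def maurerCartanLeft (g : K) : F →L[ℝ] k :=
  (modelEquiv e : F →L[ℝ] k).comp (tderiv F F (fun x => g⁻¹ * x) g)

/-- The values at `g` of the left-invariant vector fields. -/
def leftFrame (g : K) : k →L[ℝ] F :=
  (tderiv F F (fun x => g * x) (1 : K)).comp ((modelEquiv e).symm : k →L[ℝ] F)

lemma maurerCartanLeft_comp_leftFrame (g : K) :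
    (maurerCartanLeft e g).comp (leftFrame e g) = ContinuousLinearMap.id ℝ k := by
  have h : (tderiv F F (fun x => g⁻¹ * x) g).comp (tderiv F F (fun x => g * x) (1 : K)) =
      ContinuousLinearMap.id ℝ F := by
    rw [← tderiv_comp_of_eq (mdifferentiableAt_mul_left' _ _) (mdifferentiableAt_mul_left' _ _)
      (mul_one g), ← tderiv_id (1 : K)]
    congr 1; funext x; simp
  ext p
  have h' := congrArg (fun T : F →L[ℝ] F => modelEquiv e (T ((modelEquiv e).symm p))) h
  exact h'.trans (by simp)

lemma leftFrame_comp_maurerCartanLeft (g : K) :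
    (leftFrame e g).comp (maurerCartanLeft e g) = ContinuousLinearMap.id ℝ F := by
  have h : (tderiv F F (fun x => g * x) (1 : K)).comp (tderiv F F (fun x => g⁻¹ * x) g) =
      ContinuousLinearMap.id ℝ F := by
    rw [← tderiv_comp_of_eq (mdifferentiableAt_mul_left' _ _) (mdifferentiableAt_mul_left' _ _)
      (inv_mul_cancel g), ← tderiv_id g]
    congr 1; funext x; simp
  ext p
  have h' := congrArg (fun T : F →L[ℝ] F => T p) h
  refine Eq.trans ?_ h'
  simp [leftFrame, maurerCartanLeft]

/-- The adjoint representation, by continuous linear maps. -/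
def adjointCLM (g : K) : k →L[ℝ] k :=
  ((modelEquiv e : F →L[ℝ] k).comp (tderiv F F (fun x => g * x * g⁻¹) (1 : K))).comp
    ((modelEquiv e).symm : k →L[ℝ] F)

lemma Ad_apply (g : K) (p : k) : (LieGroupAut.Ad e g).1 p = adjointCLM e g p := rfl

lemma adjointCLM_one : adjointCLM e 1 = ContinuousLinearMap.id ℝ k := by
  ext p
  rw [← Ad_apply, map_one]; rfl

lemma adjointCLM_mul_apply (g h : K) (p : k) :
    adjointCLM e (g * h) p = adjointCLM e g (adjointCLM e h p) := by
  simp only [← Ad_apply, map_mul]; rfl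

lemma adjointCLM_inv_apply_self (g : K) (p : k) :
    adjointCLM e g⁻¹ (adjointCLM e g p) = p := by
  rw [← adjointCLM_mul_apply, inv_mul_cancel, adjointCLM_one]; rfl

/-- The left logarithmic derivative `h^*θᴸ` of a map into a Lie group. -/
def leftLogDeriv (h : M → K) (x : M) : E →L[ℝ] k :=
  (maurerCartanLeft e (h x)).comp (tderiv E F h x)

lemma leftFrame_leftLogDeriv (h : M → K) (x : M) (v : E) :
    leftFrame e (h x) (leftLogDeriv e h x v) = tderiv E F h x v :=
  congrArg (fun T : F →L[ℝ] F => T (tderiv E F h x v)) (leftFrame_comp_maurerCartanLeft e (h x))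

lemma leftLogDeriv_eq_of_tderiv {h : M → K} {x : M} {b : E →L[ℝ] k}
    (hb : tderiv E F h x = (leftFrame e (h x)).comp b) : leftLogDeriv e h x = b := by
  rw [leftLogDeriv, hb, ← ContinuousLinearMap.comp_assoc, maurerCartanLeft_comp_leftFrame,
    ContinuousLinearMap.id_comp]

lemma leftLogDeriv_const (c : K) (x : M) : leftLogDeriv e (fun _ : M => c) x = (0 : E →L[ℝ] k) := by
  rw [leftLogDeriv, tderiv_const, ContinuousLinearMap.comp_zero]

lemma leftLogDeriv_congr {g h : M → K} {x : M} (H : g =ᶠ[𝓝 x] h) :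
    (leftLogDeriv e g x : E →L[ℝ] k) = leftLogDeriv e h x := by
  rw [leftLogDeriv, leftLogDeriv, tderiv_congr H, H.eq_of_nhds]

lemma leftLogDeriv_comp {h : M → K} {g : M' → M} {x : M'}
    (hh : MDifferentiableAt 𝓘(ℝ, E) 𝓘(ℝ, F) h (g x))
    (hg : MDifferentiableAt 𝓘(ℝ, E') 𝓘(ℝ, E) g x) :
    (leftLogDeriv e (h ∘ g) x : E' →L[ℝ] k) = (leftLogDeriv e h (g x)).comp (tderiv E' E g x) := by
  rw [leftLogDeriv, tderiv_comp hh hg, ← ContinuousLinearMap.comp_assoc]; rfl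

/-- On the variation of `a`, right translation by `b` followed by left translation by `(ab)⁻¹` is
left translation by `a⁻¹` followed by conjugation by `b⁻¹`. On the variation of `b`, the factor `a`
cancels. -/
lemma leftLogDeriv_mul {a b : M → K} {x : M} (ha : MDifferentiableAt 𝓘(ℝ, E) 𝓘(ℝ, F) a x)
    (hb : MDifferentiableAt 𝓘(ℝ, E) 𝓘(ℝ, F) b x) :
    (leftLogDeriv e (fun y => a y * b y) x : E →L[ℝ] k) =
      (adjointCLM e (b x)⁻¹).comp (leftLogDeriv e a x) + leftLogDeriv e b x := by
  have h1 : (tderiv F F (fun y => (a x * b x)⁻¹ * y) (a x * b x)).comp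
      (tderiv F F (fun y => y * b x) (a x)) =
      (tderiv F F (fun y => (b x)⁻¹ * y * (b x)⁻¹⁻¹) (1 : K)).comp
        (tderiv F F (fun y => (a x)⁻¹ * y) (a x)) := by
    rw [← tderiv_comp (mdifferentiableAt_mul_left' _ _) (mdifferentiableAt_mul_right' _ _),
      ← tderiv_comp_of_eq (mdifferentiableAt_conj _ _) (mdifferentiableAt_mul_left' _ _)
        (inv_mul_cancel _)]
    congr 1; funext y; simp [mul_assoc]
  have h2 : (tderiv F F (fun y => (a x * b x)⁻¹ * y) (a x * b x)).comp
      (tderiv F F (fun y => a x * y) (b x)) = tderiv F F (fun y => (b x)⁻¹ * y) (b x) := by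
    rw [← tderiv_comp (mdifferentiableAt_mul_left' _ _) (mdifferentiableAt_mul_left' _ _)]
    congr 1; funext y; simp [mul_assoc]
  ext v
  have h1' := congrArg (fun T : F →L[ℝ] F => modelEquiv e (T (tderiv E F a x v))) h1
  have h2' := congrArg (fun T : F →L[ℝ] F => modelEquiv e (T (tderiv E F b x v))) h2
  simp only [ContinuousLinearMap.comp_apply] at h1' h2'
  simp only [leftLogDeriv, maurerCartanLeft, tderiv_mul ha hb, ContinuousLinearMap.comp_apply,
    ContinuousLinearMap.comp_add, _root_.add_apply, adjointCLM, ContinuousLinearEquiv.coe_coe,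
    ContinuousLinearEquiv.symm_apply_apply, h1', h2']

lemma leftLogDeriv_const_mul {b : M → K} {x : M} (c : K)
    (hb : MDifferentiableAt 𝓘(ℝ, E) 𝓘(ℝ, F) b x) :
    (leftLogDeriv e (fun y => c * b y) x : E →L[ℝ] k) = leftLogDeriv e b x := by
  rw [leftLogDeriv_mul e mdifferentiableAt_const hb, leftLogDeriv_const, ContinuousLinearMap.comp_zero,
    zero_add]

/-- Differentiate `h h⁻¹ = 1`. -/
lemma leftLogDeriv_inv {h : M → K} {x : M} (hh : MDifferentiableAt 𝓘(ℝ, E) 𝓘(ℝ, F) h x) :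
    (leftLogDeriv e (fun y => (h y)⁻¹) x : E →L[ℝ] k) =
      -(adjointCLM e (h x)).comp (leftLogDeriv e h x) := by
  have h1 := leftLogDeriv_mul e hh hh.inv_group
  simp only [mul_inv_cancel, inv_inv] at h1
  rw [leftLogDeriv_const] at h1
  exact (neg_eq_of_add_eq_zero_right h1.symm).symm

/-- Right translation by `g⁻¹` is left translation by `g⁻¹` followed by conjugation by `g`. -/
lemma maurerCartanRight_eq (g : K) (w : F) :
    LieGroupAut.maurerCartanRight e g w = adjointCLM e g (maurerCartanLeft e g w) := by
  have h1 : tderiv F F (fun y => y * g⁻¹) g =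
      (tderiv F F (fun y => g * y * g⁻¹) (1 : K)).comp (tderiv F F (fun y => g⁻¹ * y) g) := by
    rw [← tderiv_comp_of_eq (mdifferentiableAt_conj _ _) (mdifferentiableAt_mul_left' _ _)
      (inv_mul_cancel _)]
    congr 1; funext y; simp
  have h2 := congrArg (fun T : F →L[ℝ] F => modelEquiv e (T w)) h1
  refine h2.trans ?_
  simp [adjointCLM, maurerCartanLeft]

/-- Replaces the right-invariant form along `f` by the left-invariant one along `f⁻¹`, the only form
used in the rest of the proof. -/
lemma maurerCartanRight_mfderiv {f : M → K} {x : M}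
    (hf : MDifferentiableAt 𝓘(ℝ, E) 𝓘(ℝ, F) f x) (v : E) :
    LieGroupAut.maurerCartanRight e (f x) (mfderiv 𝓘(ℝ, E) 𝓘(ℝ, F) f x v) =
      -leftLogDeriv e (fun y => (f y)⁻¹) x v := by
  rw [leftLogDeriv_inv e hf, _root_.neg_apply, neg_neg]
  exact maurerCartanRight_eq e (f x) (tderiv E F f x v)

end LieGroup

/-! ### Vector fields in a chart -/

section ChartField

variable {E : Type*} [NormedAddCommGroup E] [NormedSpace ℝ E]
  {M : Type*} [TopologicalSpace M] [ChartedSpace E M] [IsManifold 𝓘(ℝ, E) ∞ M]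

/-- The expression of a vector field in the chart centred at `c`. -/
def chartField (c : M) (V : Π x : M, TangentSpace 𝓘(ℝ, E) x) (y : E) : E :=
  tderiv E E (chartAt E c) ((chartAt E c).symm y) (V ((chartAt E c).symm y))

lemma mpullback_chartAt_symm {c : M} (V : Π x : M, TangentSpace 𝓘(ℝ, E) x) {y : E}
    (hy : y ∈ (chartAt E c).target) :
    VectorField.mpullback 𝓘(ℝ, E) 𝓘(ℝ, E) (chartAt E c).symm V y = chartField c V y := by
  have h : (tderiv E E (chartAt E c).symm y).inverse =
      tderiv E E (chartAt E c) ((chartAt E c).symm y) :=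
    ContinuousLinearMap.inverse_eq (tderiv_chartAt_symm_comp' hy) (tderiv_chartAt_comp_symm hy)
  exact congrArg (fun T : E →L[ℝ] E => T (V ((chartAt E c).symm y))) h

/-- Naturality of the Lie bracket under pullback by the inverse chart. Chart expression and pullback
agree near `y`, which suffices because the bracket depends only on germs. -/
lemma lieBracket_chartField [FiniteDimensional ℝ E] {c : M} {V W : Π x : M, TangentSpace 𝓘(ℝ, E) x} {y : E}
    (hy : y ∈ (chartAt E c).target)
    (hV : MDifferentiableAt 𝓘(ℝ, E) 𝓘(ℝ, E).tangent
      (fun x => (⟨x, V x⟩ : TangentBundle 𝓘(ℝ, E) M)) ((chartAt E c).symm y))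
    (hW : MDifferentiableAt 𝓘(ℝ, E) 𝓘(ℝ, E).tangent
      (fun x => (⟨x, W x⟩ : TangentBundle 𝓘(ℝ, E) M)) ((chartAt E c).symm y)) :
    VectorField.lieBracket ℝ (chartField c V) (chartField c W) y =
      chartField c (VectorField.mlieBracket 𝓘(ℝ, E) V W) y := by
  have h := VectorField.mpullback_mlieBracket (I := 𝓘(ℝ, E)) (I' := 𝓘(ℝ, E))
    (f := (chartAt E c).symm) (x₀ := y) (n := ∞) hV hW (contMDiffAt_chartAt_symm hy)
    (by rw [minSmoothness_of_isRCLikeNormedField]; norm_cast)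
  rw [mpullback_chartAt_symm _ hy] at h
  have hev : ∀ Z : Π x : M, TangentSpace 𝓘(ℝ, E) x,
      chartField c Z =ᶠ[𝓝 y] VectorField.mpullback 𝓘(ℝ, E) 𝓘(ℝ, E) (chartAt E c).symm Z := by
    intro Z
    filter_upwards [(chartAt E c).open_target.mem_nhds hy] with z hz
    exact (mpullback_chartAt_symm Z hz).symm
  have h2 : VectorField.mlieBracket 𝓘(ℝ, E)
      (VectorField.mpullback 𝓘(ℝ, E) 𝓘(ℝ, E) (chartAt E c).symm V)
      (VectorField.mpullback 𝓘(ℝ, E) 𝓘(ℝ, E) (chartAt E c).symm W) y =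
      VectorField.lieBracket ℝ (VectorField.mpullback 𝓘(ℝ, E) 𝓘(ℝ, E) (chartAt E c).symm V : E → E)
        (VectorField.mpullback 𝓘(ℝ, E) 𝓘(ℝ, E) (chartAt E c).symm W : E → E) y := by
    rw [← VectorField.mlieBracketWithin_univ, VectorField.mlieBracketWithin_eq_lieBracketWithin]
    exact congrFun VectorField.lieBracketWithin_univ y
  exact ((hev V).lieBracket_vectorField_eq (hev W)).trans (h.trans h2).symm

end ChartField

/-! ### Left-invariant vector fields in charts. -/

section LieGroup

variable {F : Type*} [NormedAddCommGroup F] [NormedSpace ℝ F] [FiniteDimensional ℝ F]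
  {K : Type*} [TopologicalSpace K] [ChartedSpace F K] [Group K] [LieGroup 𝓘(ℝ, F) ∞ K]
  {k : Type*} [NormedLieRing k] [NormedLieAlgebra k]
  (e : GroupLieAlgebra 𝓘(ℝ, F) K ≃ₗ⁅ℝ⁆ k)

/-- The left-invariant vector fields of a Lie group in the chart centred at `c`. -/
def chartFrame (c : K) (y : F) : k →L[ℝ] F :=
  (tderiv F F (chartAt F c) ((chartAt F c).symm y)).comp (leftFrame e ((chartAt F c).symm y))

lemma chartFrame_apply (c : K) (p : k) :
    (fun y => chartFrame e c y p) =
      chartField c (mulInvariantVectorField (I := 𝓘(ℝ, F)) (G := K) (e.symm p)) := rfl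

/-- The frame is the partial derivative in the second factor, at the unit, of the multiplication
read in charts, composed with fixed linear maps. Its smoothness is therefore that of multiplication.
-/
lemma contDiffOn_chartFrame (c : K) : ContDiffOn ℝ ∞ (chartFrame e c) (chartAt F c).target := by
  intro y hy
  refine ContDiffAt.contDiffWithinAt ?_
  set z₁ : F := chartAt F (1 : K) 1 with hz₁
  have hz₁t : z₁ ∈ (chartAt F (1 : K)).target := mem_chart_target F 1
  have hz₁s : (chartAt F (1 : K)).symm z₁ = 1 := (chartAt F (1 : K)).left_inv (mem_chart_source F 1)
  set Q : F × F → F := fun p => chartAt F c ((chartAt F c).symm p.1 * (chartAt F (1 : K)).symm p.2)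
    with hQ
  have hQs : ∀ y ∈ (chartAt F c).target, ContDiffAt ℝ ∞ Q (y, z₁) := by
    intro y hy
    have h1 : ContMDiffAt 𝓘(ℝ, F × F) 𝓘(ℝ, F) ∞ (fun p : F × F => (chartAt F c).symm p.1) (y, z₁) :=
      (contMDiffAt_chartAt_symm hy).comp (y, z₁)
        (contDiff_fst.contMDiff (y, z₁))
    have h2 : ContMDiffAt 𝓘(ℝ, F × F) 𝓘(ℝ, F) ∞ (fun p : F × F => (chartAt F (1 : K)).symm p.2)
        (y, z₁) :=
      (contMDiffAt_chartAt_symm hz₁t).comp (y, z₁) (contDiff_snd.contMDiff (y, z₁))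
    have h3 : ContMDiffAt 𝓘(ℝ, F × F) 𝓘(ℝ, F) ∞ Q (y, z₁) := by
      refine ContMDiffAt.comp (I' := 𝓘(ℝ, F)) (y, z₁) (contMDiffAt_chartAt ?_) (h1.mul h2)
      simp only [hz₁s, mul_one]
      exact (chartAt F c).map_target hy
    exact h3.contDiffAt
  have hfr : ∀ y ∈ (chartAt F c).target, chartFrame e c y =
      (((fderiv ℝ Q (y, z₁)).comp (ContinuousLinearMap.inr ℝ F F)).comp
        (tderiv F F (chartAt F (1 : K)) 1)).comp ((modelEquiv e).symm : k →L[ℝ] F) := by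
    intro y hy
    have hgs := (chartAt F c).map_target hy
    have h1 : (tderiv F F (chartAt F c) ((chartAt F c).symm y)).comp
        (tderiv F F (fun x => (chartAt F c).symm y * x) (1 : K)) =
        (fderiv ℝ (fun z => Q (y, z)) z₁).comp (tderiv F F (chartAt F (1 : K)) 1) := by
      rw [← tderiv_comp_of_eq (mdifferentiableAt_chartAt hgs) (mdifferentiableAt_mul_left' _ _)
        (mul_one _), ← tderiv_eq_fderiv, ← tderiv_comp]
      · refine tderiv_congr ?_
        filter_upwards [(chartAt F (1 : K)).open_source.mem_nhds (mem_chart_source F 1)] with x hx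
        simp only [Function.comp_apply, hQ, (chartAt F (1 : K)).left_inv hx]
      · refine DifferentiableAt.mdifferentiableAt ?_
        exact ((hQs y hy).differentiableAt (by simp)).comp (f := fun z => (y, z)) z₁ (by fun_prop)
      · exact mdifferentiableAt_chartAt (mem_chart_source F 1)
    have h2 : fderiv ℝ (fun z => Q (y, z)) z₁ =
        (fderiv ℝ Q (y, z₁)).comp (ContinuousLinearMap.inr ℝ F F) :=
      HasFDerivAt.fderiv (((hQs y hy).differentiableAt (by simp)).hasFDerivAt.comp z₁
        (hasFDerivAt_prodMk_right y z₁))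
    rw [← h2, ← h1]; rfl
  have hd : ContDiffAt ℝ ∞ (fun y => fderiv ℝ Q (y, z₁)) y :=
    ((hQs y hy).fderiv_right (m := ∞) (by simp)).comp (f := fun y => (y, z₁)) y
      (by fun_prop)
  refine ContDiffAt.congr_of_eventuallyEq (f := fun y =>
    (((fderiv ℝ Q (y, z₁)).comp (ContinuousLinearMap.inr ℝ F F)).comp
        (tderiv F F (chartAt F (1 : K)) 1)).comp ((modelEquiv e).symm : k →L[ℝ] F)) ?_ ?_
  · exact ((hd.clm_comp contDiffAt_const).clm_comp contDiffAt_const).clm_comp contDiffAt_const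
  · filter_upwards [(chartAt F c).open_target.mem_nhds hy] with z hz using hfr z hz

lemma contDiffAt_chartFrame {c : K} {y : F} (hy : y ∈ (chartAt F c).target) :
    ContDiffAt ℝ ∞ (chartFrame e c) y :=
  (contDiffOn_chartFrame e c).contDiffAt ((chartAt F c).open_target.mem_nhds hy)

/-- The structure equation of the left-invariant vector fields. -/
lemma fderiv_chartFrame_sub {c : K} {y : F} (hy : y ∈ (chartAt F c).target) (p q : k) :
    fderiv ℝ (chartFrame e c) y (chartFrame e c y p) q -
      fderiv ℝ (chartFrame e c) y (chartFrame e c y q) p = chartFrame e c y ⁅p, q⁆ := by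
  have hd : ∀ r : k, fderiv ℝ (fun y => chartFrame e c y r) y =
      (fderiv ℝ (chartFrame e c) y).flip r := by
    intro r
    have h1 := ((contDiffAt_chartFrame e hy).differentiableAt (by simp)).hasFDerivAt.clm_apply
      (hasFDerivAt_const r y)
    rw [h1.fderiv]; ext v; simp
  have hb := lieBracket_chartField (c := c) hy
    (mdifferentiableAt_mulInvariantVectorField (I := 𝓘(ℝ, F)) (G := K) (e.symm p))
    (mdifferentiableAt_mulInvariantVectorField (I := 𝓘(ℝ, F)) (G := K) (e.symm q))
  -- The bracket of left-invariant fields is again left-invariant, determined by its value at 1.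
  rw [← mulInvariantVector_mlieBracket] at hb
  have hpq : VectorField.mlieBracket 𝓘(ℝ, F)
      (mulInvariantVectorField (I := 𝓘(ℝ, F)) (G := K) (e.symm p))
      (mulInvariantVectorField (e.symm q)) 1 = e.symm ⁅p, q⁆ := by
    rw [LieEquiv.map_lie]; rfl
  rw [hpq, ← chartFrame_apply, ← chartFrame_apply, ← chartFrame_apply] at hb
  rw [VectorField.lieBracket, hd, hd] at hb
  exact hb

lemma chartFrame_comp_maurerCartanLeft (c g : K) (hg : g ∈ (chartAt F c).source) :
    (chartFrame e c (chartAt F c g)).comp (maurerCartanLeft e g) =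
      tderiv F F (chartAt F c) g := by
  rw [chartFrame, (chartAt F c).left_inv hg, ContinuousLinearMap.comp_assoc,
    leftFrame_comp_maurerCartanLeft, ContinuousLinearMap.comp_id]

/-- The inverse of `chartFrame`. -/
lemma maurerCartanLeft_comp_chartFrame {c : K} {y : F} (hy : y ∈ (chartAt F c).target) :
    ((maurerCartanLeft e ((chartAt F c).symm y)).comp (tderiv F F (chartAt F c).symm y)).comp
      (chartFrame e c y) = ContinuousLinearMap.id ℝ k := by
  rw [chartFrame, ContinuousLinearMap.comp_assoc,
    ← ContinuousLinearMap.comp_assoc (tderiv F F (chartAt F c).symm y),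
    tderiv_chartAt_symm_comp' hy, ContinuousLinearMap.id_comp, maurerCartanLeft_comp_leftFrame]

lemma chartFrame_comp_maurerCartanLeft_comp {c : K} {y : F} (hy : y ∈ (chartAt F c).target) :
    (chartFrame e c y).comp
      ((maurerCartanLeft e ((chartAt F c).symm y)).comp (tderiv F F (chartAt F c).symm y)) =
      ContinuousLinearMap.id ℝ F := by
  rw [chartFrame, ContinuousLinearMap.comp_assoc,
    ← ContinuousLinearMap.comp_assoc (leftFrame e _), leftFrame_comp_maurerCartanLeft, ContinuousLinearMap.id_comp,
    tderiv_chartAt_comp_symm hy]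

lemma chartFrame_injective {c : K} {y : F} (hy : y ∈ (chartAt F c).target) :
    Function.Injective (chartFrame e c y) := fun p q h => by
  have := congrArg ((maurerCartanLeft e ((chartAt F c).symm y)).comp
    (tderiv F F (chartAt F c).symm y)) h
  have h2 := maurerCartanLeft_comp_chartFrame e hy
  exact (congrArg (fun T : k →L[ℝ] k => T p) h2).symm.trans
    (this.trans (congrArg (fun T : k →L[ℝ] k => T q) h2))

/-! ### Flat one-forms on open subsets of a vector space -/

variable {E : Type*} [NormedAddCommGroup E] [NormedSpace ℝ E]

/-- A smooth `k`-valued one-form `β` with `dβ + ½[β, β] = 0` on `U`. -/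
structure IsFlatOn (β : E → E →L[ℝ] k) (U : Set E) : Prop where
  contDiffOn : ContDiffOn ℝ ∞ β U
  curvature : ∀ x ∈ U, ∀ v w, fderiv ℝ β x v w - fderiv ℝ β x w v + ⁅β x v, β x w⁆ = 0

/-- The **Maurer–Cartan equation**. -/
theorem isFlatOn_leftLogDeriv {H : E → K} {U : Set E} (hU : IsOpen U)
    (hH : ContMDiffOn 𝓘(ℝ, E) 𝓘(ℝ, F) ∞ H U) :
    IsFlatOn (leftLogDeriv e H : E → E →L[ℝ] k) U := by
  have key : ∀ x₀ ∈ U, ContDiffAt ℝ ∞ (leftLogDeriv e H : E → E →L[ℝ] k) x₀ ∧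
      ∀ v w, fderiv ℝ (leftLogDeriv e H : E → E →L[ℝ] k) x₀ v w -
        fderiv ℝ (leftLogDeriv e H : E → E →L[ℝ] k) x₀ w v +
          ⁅(leftLogDeriv e H x₀ : E →L[ℝ] k) v, (leftLogDeriv e H x₀ : E →L[ℝ] k) w⁆ = 0 := by
    intro x₀ hx₀
    set β : E → E →L[ℝ] k := leftLogDeriv e H with hβ
    set κ := chartAt F (H x₀) with hκ
    have hHat : ∀ x ∈ U, ContMDiffAt 𝓘(ℝ, E) 𝓘(ℝ, F) ∞ H x := fun x hx =>
      hH.contMDiffAt (hU.mem_nhds hx)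
    have hV : ∀ᶠ x in 𝓝 x₀, x ∈ U ∧ H x ∈ κ.source :=
      (hU.eventually_mem hx₀).and ((hHat x₀ hx₀).continuousAt.eventually_mem
        (κ.open_source.mem_nhds (mem_chart_source F (H x₀))))
    have hĤ : ∀ x, x ∈ U ∧ H x ∈ κ.source → ContDiffAt ℝ ∞ (κ ∘ H) x := fun x hx =>
      ((contMDiffAt_chartAt hx.2).comp x (hHat x hx.1)).contDiffAt
    have hx₀' := hV.self_of_nhds
    -- The form `β` is the differential of `H` in coordinates, expressed in the left-invariant
    -- frame. Inverting the frame gives smoothness of `β`; differentiating this relation gives the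
    -- curvature identity.
    have heq : ∀ x, x ∈ U ∧ H x ∈ κ.source →
        (chartFrame e (H x₀) (κ (H x))).comp (β x) = fderiv ℝ (κ ∘ H) x := by
      intro x hx
      rw [hβ, leftLogDeriv, ← ContinuousLinearMap.comp_assoc,
        chartFrame_comp_maurerCartanLeft e _ _ hx.2, ← tderiv_eq_fderiv, tderiv_comp
        (mdifferentiableAt_chartAt hx.2) ((hHat x hx.1).mdifferentiableAt (by simp))]
    have hframe : ContDiffAt ℝ ∞ (fun x => chartFrame e (H x₀) (κ (H x))) x₀ :=
      ContDiffAt.comp (g := chartFrame e (H x₀)) (f := κ ∘ H) x₀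
        (contDiffAt_chartFrame e (κ.map_source hx₀'.2)) (hĤ x₀ hx₀')
    have hinv : ∀ x, x ∈ U ∧ H x ∈ κ.source →
        β x = (chartFrame e (H x₀) (κ (H x))).inverse.comp (fderiv ℝ (κ ∘ H) x) := by
      intro x hx
      rw [← heq x hx, ← ContinuousLinearMap.comp_assoc, ContinuousLinearMap.inverse_eq
        (chartFrame_comp_maurerCartanLeft_comp e (κ.map_source hx.2))
        (maurerCartanLeft_comp_chartFrame e (κ.map_source hx.2)),
        maurerCartanLeft_comp_chartFrame e (κ.map_source hx.2), ContinuousLinearMap.id_comp]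
    have hk : CompleteSpace k := by
      have : FiniteDimensional ℝ k := LinearEquiv.finiteDimensional (modelEquiv e).toLinearEquiv
      exact FiniteDimensional.complete ℝ k
    have hdĤ : ContDiffAt ℝ ∞ (fderiv ℝ (κ ∘ H)) x₀ := (hĤ x₀ hx₀').fderiv_right (by simp)
    have hsmooth : ContDiffAt ℝ ∞ β x₀ := by
      have hI : (chartFrame e (H x₀) (κ (H x₀))).IsInvertible :=
        ⟨ContinuousLinearEquiv.equivOfInverse' _ _
          (chartFrame_comp_maurerCartanLeft_comp e (κ.map_source hx₀'.2))
          (maurerCartanLeft_comp_chartFrame e (κ.map_source hx₀'.2)), rfl⟩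
      refine ContDiffAt.congr_of_eventuallyEq (f := fun x =>
        (chartFrame e (H x₀) (κ (H x))).inverse.comp (fderiv ℝ (κ ∘ H) x)) ?_ (hV.mono hinv)
      exact (hI.contDiffAt_map_inverse.comp x₀ hframe).clm_comp hdĤ
    refine ⟨hsmooth, fun v w => ?_⟩
    have hβd := (hsmooth.differentiableAt (by simp)).hasFDerivAt
    have hfd := ((contDiffAt_chartFrame e (κ.map_source hx₀'.2)).differentiableAt
      (by simp)).hasFDerivAt.comp x₀ ((hĤ x₀ hx₀').differentiableAt (by simp)).hasFDerivAt
    have h1 := (hfd.clm_comp hβd).congr_of_eventuallyEq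
      (f₁ := fderiv ℝ (κ ∘ H)) (hV.mono fun x hx => (heq x hx).symm)
    have hsym : IsSymmSndFDerivAt ℝ (κ ∘ H) x₀ :=
      (hĤ x₀ hx₀').isSymmSndFDerivAt (by rw [minSmoothness_of_isRCLikeNormedField]; norm_cast)
    have h2 : ∀ v w, fderiv ℝ (fderiv ℝ (κ ∘ H)) x₀ v w =
        chartFrame e (H x₀) (κ (H x₀)) (fderiv ℝ β x₀ v w) +
          fderiv ℝ (chartFrame e (H x₀)) (κ (H x₀))
            (chartFrame e (H x₀) (κ (H x₀)) (β x₀ v)) (β x₀ w) := by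
      intro v w
      rw [h1.fderiv, ← heq x₀ hx₀']
      simp
    -- Antisymmetrizing kills the second derivatives of `κ ∘ H`. The derivatives of the frame
    -- contribute `⁅β v, β w⁆` by the structure equation, and injectivity of the frame removes it.
    have h3 := hsym v w
    rw [h2, h2] at h3
    refine chartFrame_injective e (κ.map_source hx₀'.2) ?_
    rw [map_add, map_sub, ← fderiv_chartFrame_sub e (κ.map_source hx₀'.2), map_zero]
    rw [← sub_eq_zero] at h3
    rw [← h3]; abel
  exact ⟨fun x hx => (key x hx).1.contDiffWithinAt, fun x hx => (key x hx).2⟩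

end LieGroup

/-! ### Maps with vanishing derivative -/

section LocallyConstant

variable {E : Type*} [NormedAddCommGroup E] [NormedSpace ℝ E]
  {F : Type*} [NormedAddCommGroup F] [NormedSpace ℝ F]
  {M : Type*} [TopologicalSpace M] [ChartedSpace E M] [IsManifold 𝓘(ℝ, E) ∞ M]
  {N : Type*} [TopologicalSpace N] [ChartedSpace F N] [IsManifold 𝓘(ℝ, F) ∞ N]

lemma eventually_eq_of_tderiv_eq_zero {f : M → N} {U : Set M} (hU : IsOpen U)
    (hf : ∀ x ∈ U, MDifferentiableAt 𝓘(ℝ, E) 𝓘(ℝ, F) f x) (h0 : ∀ x ∈ U, tderiv E F f x = 0)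
    {x : M} (hx : x ∈ U) : ∀ᶠ y in 𝓝 x, f y = f x := by
  set φ := chartAt E x with hφ
  set κ := chartAt F (f x) with hκ
  have hxs : x ∈ φ.source := mem_chart_source E x
  have hV : ∀ᶠ y in 𝓝 x, y ∈ U ∧ f y ∈ κ.source :=
    (hU.eventually_mem hx).and ((hf x hx).continuousAt.eventually_mem
      (κ.open_source.mem_nhds (mem_chart_source F (f x))))
  have hV' : ∀ᶠ z in 𝓝 (φ x), z ∈ φ.target ∧ φ.symm z ∈ U ∧ f (φ.symm z) ∈ κ.source := by
    refine (φ.open_target.eventually_mem (φ.map_source hxs)).and ?_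
    have hc : Tendsto φ.symm (𝓝 (φ x)) (𝓝 x) := by
      have := φ.continuousAt_symm (φ.map_source hxs)
      rwa [ContinuousAt, φ.left_inv hxs] at this
    exact hc.eventually hV
  obtain ⟨r, hr, hball⟩ := Metric.eventually_nhds_iff_ball.1 hV'
  have hd : ∀ z ∈ Metric.ball (φ x) r, HasFDerivAt (fun z => κ (f (φ.symm z))) (0 : E →L[ℝ] F) z := by
    intro z hz
    obtain ⟨hz1, hz2, hz3⟩ := hball z hz
    have d1 : MDifferentiableAt 𝓘(ℝ, E) 𝓘(ℝ, F) (f ∘ φ.symm) z :=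
      (hf _ hz2).comp z (mdifferentiableAt_chartAt_symm hz1)
    have d2 : MDifferentiableAt 𝓘(ℝ, E) 𝓘(ℝ, F) (κ ∘ f ∘ φ.symm) z :=
      MDifferentiableAt.comp z (mdifferentiableAt_chartAt hz3) d1
    have h1 : tderiv E F (κ ∘ f ∘ φ.symm) z = 0 := by
      rw [tderiv_comp (f := f ∘ φ.symm) (mdifferentiableAt_chartAt hz3) d1,
        tderiv_comp (hf _ hz2) (mdifferentiableAt_chartAt_symm hz1), h0 _ hz2]
      simp
    rw [tderiv_eq_fderiv] at h1
    rw [← h1]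
    exact (mdifferentiableAt_iff_differentiableAt.1 d2).hasFDerivAt
  have hconst : ∀ z ∈ Metric.ball (φ x) r, κ (f (φ.symm z)) = κ (f (φ.symm (φ x))) := by
    intro z hz
    refine (convex_ball (φ x) r).is_const_of_fderivWithin_eq_zero (𝕜 := ℝ)
      (fun z hz => (hd z hz).differentiableAt.differentiableWithinAt) (fun z hz => ?_) hz
      (Metric.mem_ball_self hr)
    rw [fderivWithin_of_isOpen Metric.isOpen_ball hz, (hd z hz).fderiv]
  filter_upwards [φ.open_source.mem_nhds hxs,
    (φ.continuousAt hxs).eventually (Metric.ball_mem_nhds _ hr)] with y hys hyb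
  have h1 := hconst _ hyb
  rw [φ.left_inv hys, φ.left_inv hxs] at h1
  have h2 := (hball _ hyb).2.2
  rw [φ.left_inv hys] at h2
  exact κ.injOn h2 (mem_chart_source F (f x)) h1

lemma eq_of_tderiv_eq_zero [PreconnectedSpace M] {f : M → N}
    (hf : ∀ x, MDifferentiableAt 𝓘(ℝ, E) 𝓘(ℝ, F) f x) (h0 : ∀ x, tderiv E F f x = 0) (x y : M) :
    f x = f y := by
  have : IsLocallyConstant f := (IsLocallyConstant.iff_eventually_eq f).2 fun x =>
    eventually_eq_of_tderiv_eq_zero isOpen_univ (fun x _ => hf x) (fun x _ => h0 x) (mem_univ x)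
  exact this.apply_eq_of_preconnectedSpace x y

end LocallyConstant

/-! ### Flat one-forms on manifolds and their developing maps -/

section FlatForm

variable {F : Type*} [NormedAddCommGroup F] [NormedSpace ℝ F] [FiniteDimensional ℝ F]
  {K : Type*} [TopologicalSpace K] [ChartedSpace F K] [Group K] [LieGroup 𝓘(ℝ, F) ∞ K]
  {k : Type*} [NormedLieRing k] [NormedLieAlgebra k]
  {E : Type*} [NormedAddCommGroup E] [NormedSpace ℝ E]
  {M : Type*} [TopologicalSpace M] [ChartedSpace E M]

/-- The expression of a one-form in the chart centred at `c`. -/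
def chartForm (c : M) (β : M → E →L[ℝ] k) (y : E) : E →L[ℝ] k :=
  (β ((chartAt E c).symm y)).comp (tderiv E E (chartAt E c).symm y)

/-- A `k`-valued one-form that is smooth and flat in all charts. -/
def IsFlatForm (β : M → E →L[ℝ] k) : Prop :=
  ∀ c : M, IsFlatOn (chartForm c β) (chartAt E c).target

lemma IsFlatOn.congr {β β' : E → E →L[ℝ] k} {U : Set E} (h : IsFlatOn β U) (hU : IsOpen U)
    (H : EqOn β' β U) : IsFlatOn β' U where
  contDiffOn := h.contDiffOn.congr H
  curvature x hx v w := by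
    rw [(H.eventuallyEq_of_mem (hU.mem_nhds hx)).fderiv_eq, H hx]
    exact h.curvature x hx v w

variable [IsManifold 𝓘(ℝ, E) ∞ M] (e : GroupLieAlgebra 𝓘(ℝ, F) K ≃ₗ⁅ℝ⁆ k)

/-- By the chain rule the chart expression is the logarithmic derivative of `h` read in the chart,
so the Maurer–Cartan equation on a vector space applies. -/
lemma isFlatForm_leftLogDeriv {h : M → K} (hh : ContMDiff 𝓘(ℝ, E) 𝓘(ℝ, F) ∞ h) :
    IsFlatForm (leftLogDeriv e h : M → E →L[ℝ] k) := by
  intro c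
  refine (isFlatOn_leftLogDeriv e (H := h ∘ (chartAt E c).symm) (chartAt E c).open_target
    (fun y hy => ((hh _).comp y (contMDiffAt_chartAt_symm hy)).contMDiffWithinAt)).congr
    (chartAt E c).open_target fun y hy => ?_
  exact (leftLogDeriv_comp e ((hh _).mdifferentiableAt (by simp))
    (mdifferentiableAt_chartAt_symm hy)).symm

/-- In charts the condition `h^*θᴸ = β` reads `Df(x) = fr(f(x)) ∘ b(x)`. The antisymmetric part of
its integrability condition is the frame applied to the curvature of `b`, because the structure
equation turns derivatives of the frame into brackets. -/
lemma exists_local_leftLogDeriv_eq {β : M → E →L[ℝ] k} (hβ : IsFlatForm β) (m : M) :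
    ∃ (U : Set M) (h : M → K), IsOpen U ∧ m ∈ U ∧ h m = 1 ∧
      (∀ x ∈ U, ContMDiffAt 𝓘(ℝ, E) 𝓘(ℝ, F) ∞ h x) ∧ ∀ x ∈ U, leftLogDeriv e h x = β x := by
  set φ := chartAt E m with hφ
  set κ := chartAt F (1 : K) with hκ
  set b := chartForm m β with hb
  set fr := chartFrame e (1 : K) with hfr
  have hms : m ∈ φ.source := mem_chart_source E m
  have h1s : (1 : K) ∈ κ.source := mem_chart_source F 1
  have hbs : ∀ x ∈ φ.target, ContDiffAt ℝ ∞ b x := fun x hx =>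
    (hβ m).contDiffOn.contDiffAt (φ.open_target.mem_nhds hx)
  have hfs : ∀ y ∈ κ.target, ContDiffAt ℝ ∞ fr y := fun y hy => contDiffAt_chartFrame e hy
  have hG : ContDiffOn ℝ ∞ (fun p : E × F => (fr p.2).comp (b p.1)) (φ.target ×ˢ κ.target) := by
    rintro ⟨x, y⟩ ⟨hx, hy⟩
    refine ContDiffAt.contDiffWithinAt (ContDiffAt.clm_comp ?_ ?_)
    · exact ContDiffAt.comp (g := fr) (f := Prod.snd) (x, y) (hfs y hy) contDiffAt_snd
    · exact ContDiffAt.comp (g := b) (f := Prod.fst) (x, y) (hbs x hx) contDiffAt_fst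
  obtain ⟨f, U, hU, hmU, hf0, hfsm, hfU⟩ := exists_contDiffOn_hasFDerivAt_of_symmetric
    (φ.open_target.prod κ.open_target) hG (x₀ := φ m) (y₀ := κ 1)
    ⟨φ.map_source hms, κ.map_source h1s⟩ (by
      rintro ⟨x, y⟩ ⟨hx, hy⟩ v w
      have d1 : HasFDerivAt (fun p : E × F => fr p.2)
          ((fderiv ℝ fr y).comp (ContinuousLinearMap.snd ℝ E F)) (x, y) :=
        HasFDerivAt.comp (g := fr) (f := Prod.snd) (x, y)
          ((hfs y hy).differentiableAt (by simp)).hasFDerivAt hasFDerivAt_snd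
      have d2 : HasFDerivAt (fun p : E × F => b p.1)
          ((fderiv ℝ b x).comp (ContinuousLinearMap.fst ℝ E F)) (x, y) :=
        HasFDerivAt.comp (g := b) (f := Prod.fst) (x, y)
          ((hbs x hx).differentiableAt (by simp)).hasFDerivAt hasFDerivAt_fst
      have hd : ∀ (v w : E) (u : F), fderiv ℝ (fun p : E × F => (fr p.2).comp (b p.1)) (x, y) (v, u) w =
          fr y (fderiv ℝ b x v w) + fderiv ℝ fr y u (b x w) := by
        intro v w u
        rw [(d1.clm_comp d2).fderiv]
        simp
      rw [hd, hd]
      have h1 := fderiv_chartFrame_sub e hy (b x v) (b x w)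
      have h2 := congrArg (fr y) ((hβ m).curvature x hx v w)
      rw [map_add, map_sub, map_zero, ← h1] at h2
      rw [← sub_eq_zero, ← h2]
      simp only [ContinuousLinearMap.comp_apply]
      abel)
  have hUo : IsOpen (φ.source ∩ φ ⁻¹' U) := φ.isOpen_inter_preimage hU
  have hfat : ∀ x ∈ U, ContDiffAt ℝ ∞ f x := fun x hx => hfsm.contDiffAt (hU.mem_nhds hx)
  refine ⟨φ.source ∩ φ ⁻¹' U, fun x => κ.symm (f (φ x)), hUo, ⟨hms, hmU⟩, ?_, ?_, ?_⟩
  · simp only [hf0, κ.left_inv h1s]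
  · rintro x ⟨hxs, hxU⟩
    exact ContMDiffAt.comp x (contMDiffAt_chartAt_symm (hfU _ hxU).1.2)
      (ContMDiffAt.comp x (hfat _ hxU).contMDiffAt (contMDiffAt_chartAt hxs))
  · rintro x ⟨hxs, hxU⟩
    refine leftLogDeriv_eq_of_tderiv e ?_
    obtain ⟨⟨-, hyt⟩, hfd⟩ := hfU _ hxU
    have d1 : MDifferentiableAt 𝓘(ℝ, E) 𝓘(ℝ, F) (f ∘ φ) x :=
      MDifferentiableAt.comp x hfd.differentiableAt.mdifferentiableAt (mdifferentiableAt_chartAt hxs)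
    have h1 : tderiv E F (κ.symm ∘ f ∘ φ) x = (tderiv F F κ.symm (f (φ x))).comp
        ((fderiv ℝ f (φ x)).comp (tderiv E E φ x)) := by
      rw [tderiv_comp (f := f ∘ φ) (mdifferentiableAt_chartAt_symm hyt) d1, tderiv_comp
        hfd.differentiableAt.mdifferentiableAt (mdifferentiableAt_chartAt hxs), tderiv_eq_fderiv]
      rfl
    refine h1.trans ?_
    rw [hfd.fderiv]
    ext v
    -- `h2` undoes the chart of `M` and `h3` the chart of `K`, which turns the equation for `f` back
    -- into one for `h`.
    have h2 := congrArg (fun T : E →L[ℝ] E => T v) (tderiv_chartAt_symm_comp hxs)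
    have h3 := congrArg (fun T : F →L[ℝ] F => T (leftFrame e (κ.symm (f (φ x))) (β x v)))
      (tderiv_chartAt_symm_comp' hyt)
    refine Eq.trans ?_ h3
    have h4 : b (φ x) (tderiv E E φ x v) = β x v := by
      rw [hb, chartForm, φ.left_inv hxs]
      exact congrArg (β x) h2
    simp only [ContinuousLinearMap.comp_apply]
    rw [h4]; rfl

/-- The logarithmic derivative of `g h⁻¹` is `Ad_h` applied to the difference of those of `g` and
`h`, hence zero. This serves both uniqueness of primitives and the gluing of local ones. -/
lemma mul_inv_eventually_eq {g h : M → K} {U : Set M} (hU : IsOpen U)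
    (hg : ∀ x ∈ U, MDifferentiableAt 𝓘(ℝ, E) 𝓘(ℝ, F) g x)
    (hh : ∀ x ∈ U, MDifferentiableAt 𝓘(ℝ, E) 𝓘(ℝ, F) h x)
    (hgh : ∀ x ∈ U, (leftLogDeriv e g x : E →L[ℝ] k) = leftLogDeriv e h x) {x : M} (hx : x ∈ U) :
    ∀ᶠ y in 𝓝 x, g y * (h y)⁻¹ = g x * (h x)⁻¹ := by
  have hm : ∀ x ∈ U, MDifferentiableAt 𝓘(ℝ, E) 𝓘(ℝ, F) (fun y => g y * (h y)⁻¹) x := by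
    intro x hx
    have h1 := (hh x hx).inv_group
    exact MDifferentiableAt.comp (I' := 𝓘(ℝ, F).prod 𝓘(ℝ, F)) (g := fun p : K × K => p.1 * p.2) x
      ((contMDiff_mul 𝓘(ℝ, F) ∞ _).mdifferentiableAt (by simp)) ((hg x hx).prodMk h1)
  refine eventually_eq_of_tderiv_eq_zero hU hm (fun x hx => ?_) hx
  have h1 : (leftLogDeriv e (fun y => g y * (h y)⁻¹) x : E →L[ℝ] k) = 0 := by
    rw [leftLogDeriv_mul e (hg x hx) (hh x hx).inv_group, leftLogDeriv_inv e (hh x hx), hgh x hx,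
      inv_inv, add_neg_cancel]
  ext v
  rw [← leftFrame_leftLogDeriv e, h1]
  simp

/-- Two maps into a Lie group with equal logarithmic derivatives that agree at a point agree. -/
lemma eq_of_leftLogDeriv_eq [PreconnectedSpace M] {g h : M → K}
    (hg : ContMDiff 𝓘(ℝ, E) 𝓘(ℝ, F) ∞ g) (hh : ContMDiff 𝓘(ℝ, E) 𝓘(ℝ, F) ∞ h)
    (hgh : ∀ x, (leftLogDeriv e g x : E →L[ℝ] k) = leftLogDeriv e h x) {m : M} (hm : g m = h m) :
    g = h := by
  have : IsLocallyConstant (fun y => g y * (h y)⁻¹) := (IsLocallyConstant.iff_eventually_eq _).2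
    fun x => mul_inv_eventually_eq e isOpen_univ (fun x _ => (hg x).mdifferentiableAt (by simp))
      (fun x _ => (hh x).mdifferentiableAt (by simp)) (fun x _ => hgh x) (mem_univ x)
  funext x
  have h1 := this.apply_eq_of_preconnectedSpace x m
  simp only [hm, mul_inv_cancel] at h1
  exact mul_inv_eq_one.1 h1

/-- A copy of a type, to be endowed with the discrete topology. -/
@[ext]
structure DiscreteCopy (X : Type*) where
  /-- The underlying element. -/
  val : X

instance (X : Type*) : TopologicalSpace (DiscreteCopy X) := ⊥

instance (X : Type*) : DiscreteTopology (DiscreteCopy X) := ⟨rfl⟩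

/-- The flat bundle with discrete fibre whose local sections are the local primitives of a flat
form. -/
def developingBundle {U : M → Set M} {ψ : M → M → K} (hU : ∀ i, IsOpen (U i))
    (hmem : ∀ i, i ∈ U i)
    (hψ : ∀ i j, ∀ x ∈ U i ∩ U j, ∀ᶠ y in 𝓝 x, ψ i y * (ψ j y)⁻¹ = ψ i x * (ψ j x)⁻¹) :
    FiberBundleCore M M (DiscreteCopy K) where
  baseSet := U
  isOpen_baseSet := hU
  indexAt := id
  mem_baseSet_at := hmem
  -- The coordinate `c` in index `i` stands for the primitive `c ψ_i`, which near `x` equals `(c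
  -- ψ_i(x) ψ_j(x)⁻¹) ψ_j`.
  coordChange i j x c := ⟨c.val * (ψ i x * (ψ j x)⁻¹)⟩
  coordChange_self i x _ c := by ext; simp
  continuousOn_coordChange i j := by
    rintro ⟨x, c⟩ ⟨hx, -⟩
    refine ContinuousAt.continuousWithinAt ?_
    have h1 : ∀ᶠ p : M × DiscreteCopy K in 𝓝 (x, c), p.2 = c :=
      continuous_snd.continuousAt.eventually (p := (· = c)) (by simp [nhds_discrete])
    have h2 : ∀ᶠ p : M × DiscreteCopy K in 𝓝 (x, c),
        ψ i p.1 * (ψ j p.1)⁻¹ = ψ i x * (ψ j x)⁻¹ :=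
      continuous_fst.continuousAt.eventually
        (p := fun y => ψ i y * (ψ j y)⁻¹ = ψ i x * (ψ j x)⁻¹) (hψ i j x hx)
    refine (continuousAt_const (y := (⟨c.val * (ψ i x * (ψ j x)⁻¹)⟩ : DiscreteCopy K))).congr ?_
    filter_upwards [h1, h2] with p hp1 hp2
    rw [hp1, hp2]
  coordChange_comp i j l x _ c := by
    ext
    change c.val * (ψ i x * (ψ j x)⁻¹) * (ψ j x * (ψ l x)⁻¹) = c.val * (ψ i x * (ψ l x)⁻¹)
    group

/-- A flat form on a simply connected manifold is the logarithmic derivative of a map to the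
group. -/
theorem exists_leftLogDeriv_eq [SimplyConnectedSpace M] {β : M → E →L[ℝ] k} (hβ : IsFlatForm β)
    (m₀ : M) :
    ∃ h : M → K, ContMDiff 𝓘(ℝ, E) 𝓘(ℝ, F) ∞ h ∧ h m₀ = 1 ∧ ∀ x, leftLogDeriv e h x = β x := by
  choose U ψ hU hmem hone hsm hlog using exists_local_leftLogDeriv_eq e hβ
  have hψ : ∀ i j, ∀ x ∈ U i ∩ U j, ∀ᶠ y in 𝓝 x, ψ i y * (ψ j y)⁻¹ = ψ i x * (ψ j x)⁻¹ :=
    fun i j x hx => mul_inv_eventually_eq e ((hU i).inter (hU j))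
      (fun y hy => (hsm i y hy.1).mdifferentiableAt (by simp))
      (fun y hy => (hsm j y hy.2).mdifferentiableAt (by simp))
      (fun y hy => (hlog i y hy.1).trans (hlog j y hy.2).symm) hx
  let Z := developingBundle hU hmem hψ
  have hcov : IsCoveringMap (Bundle.TotalSpace.proj : Z.TotalSpace → M) :=
    FiberBundle.isCoveringMap (F := DiscreteCopy K) (E := Z.Fiber)
  have : LocallyPathConnectedSpace M := ChartedSpace.locallyPathConnectedSpace E M
  -- Simple connectedness enters here: the identity of `M` lifts through the covering, and the lift
  -- is a global section, namely a coherent choice of local primitives.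
  obtain ⟨s, ⟨hs0, hs⟩, -⟩ := hcov.existsUnique_continuousMap_lifts (ContinuousMap.id M) m₀
    (⟨m₀, (⟨1⟩ : DiscreteCopy K)⟩ : Z.TotalSpace) rfl
  have hproj : ∀ x, (s x).proj = x := fun x => congrFun hs x
  -- Since `indexAt` is the identity, the fibre coordinate of `s x` refers to the local primitive
  -- centred at `x` itself.
  let h : M → K := fun x => DiscreteCopy.val (s x).2 * ψ (s x).proj x
  have hloc : ∀ x, ∃ d : K, ∀ᶠ y in 𝓝 x, h y = d * ψ x y := by
    intro x
    have hc : ContinuousAt (fun y => Z.localTriv x (s y)) x := by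
      refine ContinuousAt.comp ((Z.localTriv x).continuousOn.continuousAt
        ((Z.localTriv x).open_source.mem_nhds ?_)) s.continuous.continuousAt
      rw [(Z.localTriv x).mem_source]
      change (s x).proj ∈ U x
      rw [hproj]
      exact hmem x
    -- A continuous map to the discrete fibre is locally constant, so near `x` the section is a
    -- single primitive `d * ψ x`.
    have hc2 : ∀ᶠ y in 𝓝 x, (Z.localTriv x (s y)).2 = (Z.localTriv x (s x)).2 :=
      (continuous_snd.continuousAt.comp hc).eventually (p := (· = (Z.localTriv x (s x)).2))
        (by rw [nhds_discrete]; exact rfl)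
    refine ⟨(Z.localTriv x (s x)).2.val, ?_⟩
    filter_upwards [hc2] with y hy
    have h1 : (Z.localTriv x (s y)).2.val =
        DiscreteCopy.val (s y).2 * (ψ (s y).proj (s y).proj * (ψ x (s y).proj)⁻¹) := rfl
    rw [← hy, h1, hproj y]
    simp only [h, hproj y]
    group
  refine ⟨h, fun x => ?_, ?_, fun x => ?_⟩
  · obtain ⟨d, hd⟩ := hloc x
    exact (contMDiffAt_const.mul (hsm x x (hmem x))).congr_of_eventuallyEq hd
  · change DiscreteCopy.val (s m₀).2 * ψ (s m₀).proj m₀ = 1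
    rw [hs0]
    exact (one_mul _).trans (hone m₀)
  · obtain ⟨d, hd⟩ := hloc x
    rw [leftLogDeriv_congr e hd, leftLogDeriv_const_mul e d
      ((hsm x x (hmem x)).mdifferentiableAt (by simp)), hlog x x (hmem x)]

end FlatForm

/-! ### Integration of automorphisms of the Lie algebra -/

section Integration

variable {F : Type*} [NormedAddCommGroup F] [NormedSpace ℝ F] [FiniteDimensional ℝ F]
  {K : Type*} [TopologicalSpace K] [ChartedSpace F K] [Group K] [LieGroup 𝓘(ℝ, F) ∞ K]
  {k : Type*} [NormedLieRing k] [NormedLieAlgebra k]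
  {E : Type*} [NormedAddCommGroup E] [NormedSpace ℝ E]
  {M : Type*} [TopologicalSpace M] [ChartedSpace E M]
  (e : GroupLieAlgebra 𝓘(ℝ, F) K ≃ₗ⁅ℝ⁆ k)

lemma leftLogDeriv_id (g : K) : leftLogDeriv e (fun x : K => x) g = maurerCartanLeft e g := by
  have h := tderiv_id (E := F) g
  rw [leftLogDeriv]
  exact (congrArg (maurerCartanLeft e g).comp h).trans (ContinuousLinearMap.comp_id _)

lemma maurerCartanLeft_one : maurerCartanLeft e (1 : K) = (modelEquiv e : F →L[ℝ] k) := by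
  have h : tderiv F F (fun x : K => 1⁻¹ * x) 1 = ContinuousLinearMap.id ℝ F := by
    rw [← tderiv_id (1 : K)]; congr 1; funext x; simp
  rw [maurerCartanLeft, h, ContinuousLinearMap.comp_id]

lemma leftFrame_one : leftFrame e (1 : K) = ((modelEquiv e).symm : k →L[ℝ] F) := by
  have h : tderiv F F (fun x : K => 1 * x) 1 = ContinuousLinearMap.id ℝ F := by
    rw [← tderiv_id (1 : K)]; congr 1; funext x; simp
  rw [leftFrame, h, ContinuousLinearMap.id_comp]

/-- An automorphism of a finite-dimensional Lie algebra as a continuous linear map. -/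
def lieAutCLM [FiniteDimensional ℝ k] (Ψ : lieAut k) : k →L[ℝ] k :=
  LinearMap.toContinuousLinearMap (Ψ.1 : k →ₗ[ℝ] k)

lemma lieAutCLM_apply [FiniteDimensional ℝ k] (Ψ : lieAut k) (x : k) : (lieAutCLM Ψ) x = Ψ.1 x := rfl

/-- The curvature is built from derivatives and the bracket; a constant linear map commutes with the
former and an automorphism with the latter. -/
lemma IsFlatForm.comp_lieAut [FiniteDimensional ℝ k] {β : M → E →L[ℝ] k} (hβ : IsFlatForm β)
    (Ψ : lieAut k) : IsFlatForm (fun x => (lieAutCLM Ψ).comp (β x)) := by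
  intro c
  have hd : ∀ y ∈ (chartAt E c).target,
      HasFDerivAt (chartForm c fun x => (lieAutCLM Ψ).comp (β x))
        ((ContinuousLinearMap.compL ℝ E k k (lieAutCLM Ψ)).comp (fderiv ℝ (chartForm c β) y)) y := by
    intro y hy
    exact (ContinuousLinearMap.compL ℝ E k k (lieAutCLM Ψ)).hasFDerivAt.comp y
      (((hβ c).contDiffOn.contDiffAt ((chartAt E c).open_target.mem_nhds hy)).differentiableAt
        (by simp)).hasFDerivAt
  refine ⟨contDiffOn_const.clm_comp (hβ c).contDiffOn, fun y hy v w => ?_⟩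
  rw [(hd y hy).fderiv]
  have h := congrArg Ψ.1 ((hβ c).curvature y hy v w)
  rw [map_zero, map_add, map_sub, Ψ.2] at h
  exact h

/-- An automorphism maps left-invariant fields to left-invariant fields, according to its
differential at the unit. -/
lemma leftLogDeriv_smoothAut [FiniteDimensional ℝ k] (s : LieGroupAut.smoothAut 𝓘(ℝ, F) K)
    (g : K) :
    leftLogDeriv e s.1 g =
      (lieAutCLM (LieGroupAut.differential e s)).comp (maurerCartanLeft e g) := by
  refine leftLogDeriv_eq_of_tderiv e ?_
  have h : (tderiv F F s.1 g).comp (leftFrame e g) =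
      (leftFrame e (s.1 g)).comp (lieAutCLM (LieGroupAut.differential e s)) := by
    ext p
    refine (LieGroupAut.mfderiv_mulInvariantVectorField s (e.symm p) g).trans ?_
    have h2 : e.symm ((LieGroupAut.differential e s).1 p) = LieGroupAut.dOne s (e.symm p) :=
      e.symm_apply_apply _
    rw [← h2]; rfl
  rw [← ContinuousLinearMap.comp_assoc, ← h, ContinuousLinearMap.comp_assoc,
    leftFrame_comp_maurerCartanLeft, ContinuousLinearMap.comp_id]

/-- Automorphisms with the same differential have the same logarithmic derivative, and both send 1
to 1. -/
lemma differential_injective [FiniteDimensional ℝ k] [PreconnectedSpace K] :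
    Function.Injective (LieGroupAut.differential (J := 𝓘(ℝ, F)) (K := K) e) := by
  intro s t hst
  have h : (s.1 : K → K) = t.1 := by
    refine eq_of_leftLogDeriv_eq e s.2.1 t.2.1 (fun g => ?_) (m := 1) (by simp)
    rw [leftLogDeriv_smoothAut, leftLogDeriv_smoothAut, hst]
  exact Subtype.ext (MulEquiv.ext fun x => congrFun h x)

lemma leftLogDeriv_comp_of_lieAut [FiniteDimensional ℝ k] {s : K → K} {f : M → K} {x : M}
    (hs : MDifferentiableAt 𝓘(ℝ, F) 𝓘(ℝ, F) s (f x)) {Ψ : lieAut k}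
    (hsΨ : leftLogDeriv e s (f x) = (lieAutCLM Ψ).comp (maurerCartanLeft e (f x)))
    (hf : MDifferentiableAt 𝓘(ℝ, E) 𝓘(ℝ, F) f x) :
    (leftLogDeriv e (s ∘ f) x : E →L[ℝ] k) = (lieAutCLM Ψ).comp (leftLogDeriv e f x) := by
  rw [leftLogDeriv_comp e hs hf, hsΨ]; rfl

/-- The integral of `Ψ` is the primitive `S Ψ` of the flat form `Ψ ∘ θᴸ` with `S Ψ 1 = 1`. The maps
`x ↦ S(gx)` and `x ↦ S(g) S(x)` have equal logarithmic derivatives by left invariance and agree at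
1, so `S` is multiplicative. The same argument makes `S Ψ⁻¹` its smooth inverse. -/
lemma differential_surjective [FiniteDimensional ℝ k] [SimplyConnectedSpace K] :
    Function.Surjective (LieGroupAut.differential (J := 𝓘(ℝ, F)) (K := K) e) := by
  have hflat : IsFlatForm (fun g : K => maurerCartanLeft e g) := by
    have := isFlatForm_leftLogDeriv e (contMDiff_id (I := 𝓘(ℝ, F)) (M := K) (n := ∞))
    have h2 : (leftLogDeriv e (id : K → K) : K → F →L[ℝ] k) = fun g => maurerCartanLeft e g :=
      funext fun g => leftLogDeriv_id e g
    rwa [h2] at this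
  have hex := fun Ψ : lieAut k => exists_leftLogDeriv_eq e (hflat.comp_lieAut Ψ) (1 : K)
  choose S hS hS1 hSl using hex
  have hSd : ∀ Ψ g, MDifferentiableAt 𝓘(ℝ, F) 𝓘(ℝ, F) (S Ψ) g := fun Ψ g =>
    (hS Ψ g).mdifferentiableAt (by simp)
  have hmul : ∀ Ψ g x, S Ψ (g * x) = S Ψ g * S Ψ x := by
    intro Ψ g
    have hL : ContMDiff 𝓘(ℝ, F) 𝓘(ℝ, F) ∞ (fun x : K => g * x) := contMDiff_mul_left
    refine congrFun (eq_of_leftLogDeriv_eq e (g := fun x => S Ψ (g * x))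
      (h := fun x => S Ψ g * S Ψ x) ((hS Ψ).comp hL) (contMDiff_const.mul (hS Ψ)) (fun x => ?_)
      (m := 1) (by simp [hS1]))
    rw [leftLogDeriv_const_mul e _ (hSd Ψ x), hSl]
    refine (leftLogDeriv_comp_of_lieAut e (f := fun x => g * x) (hSd Ψ _) (hSl Ψ _)
      (mdifferentiableAt_mul_left' g x)).trans ?_
    rw [leftLogDeriv_const_mul e (b := fun x => x) g mdifferentiableAt_id, leftLogDeriv_id]
  have hinv : ∀ Ψ Ψ' : lieAut k, Ψ * Ψ' = 1 → ∀ x, S Ψ (S Ψ' x) = x := by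
    intro Ψ Ψ' h
    refine congrFun (eq_of_leftLogDeriv_eq e (g := fun x => S Ψ (S Ψ' x)) (h := fun x => x)
      ((hS Ψ).comp (hS Ψ')) contMDiff_id (fun x => ?_) (m := 1) (by simp [hS1]))
    refine (leftLogDeriv_comp_of_lieAut e (hSd Ψ _) (hSl Ψ _) (hSd Ψ' x)).trans ?_
    rw [hSl, leftLogDeriv_id]
    ext w
    exact congrArg (fun T : lieAut k => T.1 (maurerCartanLeft e x w)) h
  intro Ψ
  refine ⟨⟨{ toFun := S Ψ
             invFun := S Ψ⁻¹
             left_inv := hinv _ _ (inv_mul_cancel Ψ)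
             right_inv := hinv _ _ (mul_inv_cancel Ψ)
             map_mul' := hmul Ψ }, hS Ψ, hS Ψ⁻¹⟩, ?_⟩
  refine Subtype.ext (LinearEquiv.ext fun x => ?_)
  -- At the unit the defining equation of `S Ψ` says that its differential is `Ψ`.
  have h1 := leftFrame_leftLogDeriv e (S Ψ) (1 : K) ((modelEquiv e).symm x)
  rw [hSl, hS1, leftFrame_one, maurerCartanLeft_one] at h1
  change modelEquiv e (tderiv F F (S Ψ) 1 ((modelEquiv e).symm x)) = Ψ.1 x
  rw [← h1]
  simp [lieAutCLM_apply]

/-- The action of `Aut(k)` on the simply connected group integrating `k`. -/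
theorem existsUnique_integration [FiniteDimensional ℝ k] [SimplyConnectedSpace K] :
    ∃! lam : lieAut k →* LieGroupAut.smoothAut 𝓘(ℝ, F) K,
      ∀ Ψ, LieGroupAut.differential e (lam Ψ) = Ψ := by
  let D := MulEquiv.ofBijective (LieGroupAut.differential (J := 𝓘(ℝ, F)) (K := K) e)
    ⟨differential_injective e, differential_surjective e⟩
  refine ⟨D.symm.toMonoidHom, fun Ψ => D.apply_symm_apply Ψ, fun lam hlam => ?_⟩
  refine MonoidHom.ext fun Ψ => differential_injective e ?_
  rw [hlam]
  exact (D.apply_symm_apply Ψ).symm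

/-! ### The derivative of the adjoint representation -/

/-- A straight line in the chart at 1 suffices: only the velocity at time 0 matters, so no
one-parameter subgroup is needed. The line may leave the chart, hence the open set `T`. -/
lemma exists_curve_leftLogDeriv (η : k) :
    ∃ (γ : ℝ → K) (T : Set ℝ), IsOpen T ∧ 0 ∈ T ∧ ContMDiffOn 𝓘(ℝ, ℝ) 𝓘(ℝ, F) ∞ γ T ∧
      (leftLogDeriv e γ 0 : ℝ →L[ℝ] k) 1 = η := by
  set κ := chartAt F (1 : K) with hκ
  set w : F := tderiv F F κ 1 ((modelEquiv e).symm η) with hw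
  have h1s : (1 : K) ∈ κ.source := mem_chart_source F 1
  set ℓ : ℝ → F := fun t => κ 1 + t • w with hℓ
  have hℓs : ContDiff ℝ ∞ ℓ := by fun_prop
  have hℓ0 : ℓ 0 = κ 1 := by simp [hℓ]
  have h0 : (0 : ℝ) ∈ ℓ ⁻¹' κ.target := by
    rw [mem_preimage, hℓ0]; exact κ.map_source h1s
  refine ⟨κ.symm ∘ ℓ, ℓ ⁻¹' κ.target, κ.open_target.preimage hℓs.continuous, h0, ?_, ?_⟩
  · intro t ht
    exact ((contMDiffAt_chartAt_symm ht).comp t (hℓs.contMDiff t)).contMDiffWithinAt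
  · have hd : HasFDerivAt ℓ (ContinuousLinearMap.toSpanSingleton ℝ w) 0 := by
      have : HasDerivAt ℓ w 0 := by
        have h := ((hasDerivAt_id (0 : ℝ)).smul_const w).const_add (κ 1)
        rwa [one_smul] at h
      exact this.hasFDerivAt
    have h2 : tderiv ℝ F (κ.symm ∘ ℓ) 0 = (tderiv F F κ.symm (ℓ 0)).comp
        (ContinuousLinearMap.toSpanSingleton ℝ w) := by
      rw [tderiv_comp (mdifferentiableAt_chartAt_symm h0) hd.differentiableAt.mdifferentiableAt,
        tderiv_eq_fderiv, hd.fderiv]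
    have h3 := congrArg (fun T : F →L[ℝ] F => T ((modelEquiv e).symm η))
      (tderiv_chartAt_symm_comp h1s)
    have h4 : (κ.symm ∘ ℓ) 0 = 1 := by
      rw [Function.comp_apply, hℓ0, κ.left_inv h1s]
    rw [leftLogDeriv, h4, h2, hℓ0, maurerCartanLeft_one]
    simp only [ContinuousLinearMap.comp_apply, ContinuousLinearMap.toSpanSingleton_apply, one_smul]
    exact (congrArg (modelEquiv e) h3).trans (by simp)

/-- Let `γ` be a curve with logarithmic velocity `η` at 0, and let `β` be the logarithmic derivative
of `(t, x) ↦ γ(t) h(x)`. By the product rule `Ad_{h⁻¹} η = β(∂_t)` at `t = 0`, while `β(v)` is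
independent of `t` for `v` tangent to `E`. Smoothness of `β` and its curvature on the pair `∂_t, v`
give both claims. -/
lemma adjointCLM_inv_deriv [FiniteDimensional ℝ k] {h : E → K} {U : Set E} (hU : IsOpen U)
    (hh : ContMDiffOn 𝓘(ℝ, E) 𝓘(ℝ, F) ∞ h U) :
    ContDiffOn ℝ ∞ (fun x => adjointCLM e (h x)⁻¹) U ∧
      ∀ x ∈ U, ∀ v η, fderiv ℝ (fun x => adjointCLM e (h x)⁻¹) x v η =
        -⁅(leftLogDeriv e h x : E →L[ℝ] k) v, adjointCLM e (h x)⁻¹ η⁆ := by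
  have key : ∀ η : k, ContDiffOn ℝ ∞ (fun x => adjointCLM e (h x)⁻¹ η) U ∧
      ∀ x ∈ U, ∀ v, fderiv ℝ (fun x => adjointCLM e (h x)⁻¹ η) x v =
        -⁅(leftLogDeriv e h x : E →L[ℝ] k) v, adjointCLM e (h x)⁻¹ η⁆ := by
    intro η
    obtain ⟨γ, T, hT, h0T, hγ, hγη⟩ := exists_curve_leftLogDeriv e η
    have hγat : ∀ t ∈ T, ContMDiffAt 𝓘(ℝ, ℝ) 𝓘(ℝ, F) ∞ γ t := fun t ht =>
      hγ.contMDiffAt (hT.mem_nhds ht)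
    have hhat : ∀ x ∈ U, ContMDiffAt 𝓘(ℝ, E) 𝓘(ℝ, F) ∞ h x := fun x hx =>
      hh.contMDiffAt (hU.mem_nhds hx)
    have hγ' : ∀ p ∈ T ×ˢ U, ContMDiffAt 𝓘(ℝ, ℝ × E) 𝓘(ℝ, F) ∞ (γ ∘ Prod.fst) p := fun p hp =>
      (hγat p.1 hp.1).comp p (contDiff_fst.contMDiff p)
    have hh' : ∀ p ∈ T ×ˢ U, ContMDiffAt 𝓘(ℝ, ℝ × E) 𝓘(ℝ, F) ∞ (h ∘ Prod.snd) p := fun p hp =>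
      (hhat p.2 hp.2).comp p (contDiff_snd.contMDiff p)
    set H : ℝ × E → K := fun p => (γ ∘ Prod.fst) p * (h ∘ Prod.snd) p with hH
    have hflat : IsFlatOn (leftLogDeriv e H : ℝ × E → ℝ × E →L[ℝ] k) (T ×ˢ U) :=
      isFlatOn_leftLogDeriv e (hT.prod hU) fun p hp =>
        ((hγ' p hp).mul (hh' p hp)).contMDiffWithinAt
    set β : ℝ × E → ℝ × E →L[ℝ] k := leftLogDeriv e H with hβ
    have hform : ∀ t ∈ T, ∀ x ∈ U, ∀ (a : ℝ) (v : E), β (t, x) (a, v) =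
        adjointCLM e (h x)⁻¹ ((leftLogDeriv e γ t : ℝ →L[ℝ] k) a) +
          (leftLogDeriv e h x : E →L[ℝ] k) v := by
      intro t ht x hx a v
      have d1 : tderiv (ℝ × E) ℝ Prod.fst (t, x) = ContinuousLinearMap.fst ℝ ℝ E := by
        rw [tderiv_eq_fderiv]; exact hasFDerivAt_fst.fderiv
      have d2 : tderiv (ℝ × E) E Prod.snd (t, x) = ContinuousLinearMap.snd ℝ ℝ E := by
        rw [tderiv_eq_fderiv]; exact hasFDerivAt_snd.fderiv
      rw [hβ, hH, leftLogDeriv_mul e ((hγ' (t, x) ⟨ht, hx⟩).mdifferentiableAt (by simp))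
        ((hh' (t, x) ⟨ht, hx⟩).mdifferentiableAt (by simp)),
        leftLogDeriv_comp e ((hγat t ht).mdifferentiableAt (by simp))
          differentiableAt_fst.mdifferentiableAt,
        leftLogDeriv_comp e ((hhat x hx).mdifferentiableAt (by simp))
          differentiableAt_snd.mdifferentiableAt, d1, d2]
      rfl
    have hC : ∀ x ∈ U, adjointCLM e (h x)⁻¹ η = β (0, x) (1, 0) := by
      intro x hx
      rw [hform 0 h0T x hx, hγη, map_zero, add_zero]
    have hβat : ∀ x ∈ U, ContDiffAt ℝ ∞ β (0, x) := fun x hx =>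
      hflat.contDiffOn.contDiffAt ((hT.prod hU).mem_nhds ⟨h0T, hx⟩)
    refine ⟨?_, fun x hx v => ?_⟩
    · refine ContDiffOn.congr (fun x hx => ?_) hC
      have h1 : ContDiffAt ℝ ∞ (fun x : E => β (0, x)) x :=
        ContDiffAt.comp (g := β) (f := fun x : E => ((0 : ℝ), x)) x (hβat x hx) (by fun_prop)
      exact (h1.clm_apply contDiffAt_const).contDiffWithinAt
    · have hβd := ((hβat x hx).differentiableAt (by simp)).hasFDerivAt
      have e1 : fderiv ℝ (fun x => adjointCLM e (h x)⁻¹ η) x v = fderiv ℝ β (0, x) (0, v) (1, 0) := by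
        have h1 : HasFDerivAt (fun x : E => β (0, x))
            ((fderiv ℝ β (0, x)).comp (ContinuousLinearMap.inr ℝ ℝ E)) x :=
          HasFDerivAt.comp (g := β) (f := fun x : E => ((0 : ℝ), x)) x hβd
            (hasFDerivAt_prodMk_right 0 x)
        have h2 := h1.clm_apply (hasFDerivAt_const ((1 : ℝ), (0 : E)) x)
        have h3 := h2.congr_of_eventuallyEq (f₁ := fun x => adjointCLM e (h x)⁻¹ η)
          ((hU.eventually_mem hx).mono hC)
        rw [h3.fderiv]; simp
      -- Left multiplication by `γ t` does not change the logarithmic derivative in the directions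
      -- of `E`.
      have e2 : fderiv ℝ β (0, x) (1, 0) (0, v) = 0 := by
        have h1 : HasFDerivAt (fun t : ℝ => β (t, x))
            ((fderiv ℝ β (0, x)).comp (ContinuousLinearMap.inl ℝ ℝ E)) 0 :=
          HasFDerivAt.comp (g := β) (f := fun t : ℝ => (t, x)) 0 hβd
            (hasFDerivAt_prodMk_left 0 x)
        have h2 := h1.clm_apply (hasFDerivAt_const ((0 : ℝ), v) 0)
        have h3 := h2.congr_of_eventuallyEq
          (f₁ := fun _ : ℝ => (leftLogDeriv e h x : E →L[ℝ] k) v)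
          ((hT.eventually_mem h0T).mono fun t ht => by
            simp only [hform t ht x hx, map_zero, zero_add])
        have h4 := h3.unique (hasFDerivAt_const _ _)
        have h5 := congrArg (fun S : ℝ →L[ℝ] k => S 1) h4
        simpa using h5
      have hcurv := hflat.curvature (0, x) ⟨h0T, hx⟩ (1, 0) (0, v)
      rw [e2, ← e1, ← hC x hx, hform 0 h0T x hx, map_zero, map_zero, zero_add, zero_sub] at hcurv
      rw [lie_skew]
      exact (neg_add_eq_zero.1 hcurv)
  -- In finite dimension an operator-valued map is smooth as soon as all its evaluations are.
  have hsm : ContDiffOn ℝ ∞ (fun x => adjointCLM e (h x)⁻¹) U :=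
    contDiffOn_clm_apply.2 fun η => (key η).1
  refine ⟨hsm, fun x hx v η => ?_⟩
  rw [← (key η).2 x hx v]
  have hd := ((hsm.contDiffAt (hU.mem_nhds hx)).differentiableAt (by simp)).hasFDerivAt.clm_apply
    (hasFDerivAt_const η x)
  rw [hd.fderiv]; simp

end Integration

/-! ### One-forms and vector fields -/

section Forms

variable {k : Type*} [NormedAddCommGroup k] [NormedSpace ℝ k]
  {k' : Type*} [NormedAddCommGroup k'] [NormedSpace ℝ k']
  {E : Type*} [NormedAddCommGroup E] [NormedSpace ℝ E]
  {M : Type*} [TopologicalSpace M] [ChartedSpace E M]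

lemma tderiv_add {f g : M → k} {x : M} (hf : MDifferentiableAt 𝓘(ℝ, E) 𝓘(ℝ, k) f x)
    (hg : MDifferentiableAt 𝓘(ℝ, E) 𝓘(ℝ, k) g x) :
    tderiv E k (fun y => f y + g y) x = tderiv E k f x + tderiv E k g x :=
  (hf.hasMFDerivAt.add hg.hasMFDerivAt).mfderiv

lemma tderiv_clm_apply {A : M → k →L[ℝ] k'} {u : M → k} {x : M}
    (hA : MDifferentiableAt 𝓘(ℝ, E) 𝓘(ℝ, k →L[ℝ] k') A x)
    (hu : MDifferentiableAt 𝓘(ℝ, E) 𝓘(ℝ, k) u x) (v : E) :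
    tderiv E k' (fun y => A y (u y)) x v =
      A x (tderiv E k u x v) + tderiv E (k →L[ℝ] k') A x v (u x) := by
  have hev : HasFDerivAt (fun p : (k →L[ℝ] k') × k => p.1 p.2)
      (isBoundedBilinearMap_apply.deriv (A x, u x)) (A x, u x) :=
    isBoundedBilinearMap_apply.hasFDerivAt (𝕜 := ℝ) (A x, u x)
  have hp : HasMFDerivAt 𝓘(ℝ, E) 𝓘(ℝ, (k →L[ℝ] k') × k) (fun y => (A y, u y)) x
      ((tderiv E (k →L[ℝ] k') A x).prod (tderiv E k u x)) :=
    ⟨hA.continuousAt.prodMk hu.continuousAt, hA.hasMFDerivAt.2.prodMk hu.hasMFDerivAt.2⟩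
  have h := (HasMFDerivAt.comp x hev.hasMFDerivAt hp).mfderiv
  have h2 := congrArg (fun T : E →L[ℝ] k' => T v) h
  exact h2.trans rfl

variable [IsManifold 𝓘(ℝ, E) ∞ M]

lemma contMDiffOn_tderiv_chartAt (c : M) :
    ContMDiffOn 𝓘(ℝ, E).tangent 𝓘(ℝ, E) ∞
      (fun w : TangentBundle 𝓘(ℝ, E) M => tderiv E E (chartAt E c) w.1 w.2)
      (Bundle.TotalSpace.proj ⁻¹' (chartAt E c).source) := by
  have hs := (chartAt E c).open_source
  have : IsManifold 𝓘(ℝ, E) 1 M := IsManifold.of_le (n := ∞) (by norm_cast)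
  have h1 : ContMDiffOn 𝓘(ℝ, E).tangent 𝓘(ℝ, E).tangent ∞
      (tangentMapWithin 𝓘(ℝ, E) 𝓘(ℝ, E) (chartAt E c) (chartAt E c).source)
      (Bundle.TotalSpace.proj ⁻¹' (chartAt E c).source) :=
    ContMDiffOn.contMDiffOn_tangentMapWithin (n := ∞) contMDiffOn_chart (by simp) hs.uniqueMDiffOn
  refine ((contMDiff_snd_tangentBundle_modelSpace E 𝓘(ℝ, E)).comp_contMDiffOn h1).congr
    fun w hw => ?_
  have h2 := mfderivWithin_of_isOpen (I := 𝓘(ℝ, E)) (I' := 𝓘(ℝ, E)) (f := chartAt E c) hs hw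
  exact (congrArg (fun T : E →L[ℝ] E => T w.2) h2).symm

lemma contMDiffOn_tderiv_chartAt_symm (c : M) (v : E) :
    ContMDiffOn 𝓘(ℝ, E) 𝓘(ℝ, E).tangent ∞
      (fun y : E => (⟨(chartAt E c).symm y, tderiv E E (chartAt E c).symm y v⟩ :
        TangentBundle 𝓘(ℝ, E) M)) (chartAt E c).target := by
  have hs := (chartAt E c).open_target
  have : IsManifold 𝓘(ℝ, E) 1 M := IsManifold.of_le (n := ∞) (by norm_cast)
  have h1 : ContMDiffOn 𝓘(ℝ, E).tangent 𝓘(ℝ, E).tangent ∞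
      (tangentMapWithin 𝓘(ℝ, E) 𝓘(ℝ, E) (chartAt E c).symm (chartAt E c).target)
      (Bundle.TotalSpace.proj ⁻¹' (chartAt E c).target) :=
    ContMDiffOn.contMDiffOn_tangentMapWithin (n := ∞) contMDiffOn_chart_symm (by simp) hs.uniqueMDiffOn
  have h2 : ContMDiff 𝓘(ℝ, E) 𝓘(ℝ, E).tangent ∞
      (fun y : E => (⟨y, v⟩ : TangentBundle 𝓘(ℝ, E) E)) :=
    contMDiff_vectorSpace_iff_contDiff.2 contDiff_const
  refine (h1.comp h2.contMDiffOn fun y hy => hy).congr fun y hy => ?_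
  have h3 := mfderivWithin_of_isOpen (I := 𝓘(ℝ, E)) (I' := 𝓘(ℝ, E))
    (f := (chartAt E c).symm) hs hy
  have h4 := congrArg (fun T : E →L[ℝ] E => T v) h3
  exact congrArg (fun u : E => (⟨(chartAt E c).symm y, u⟩ : TangentBundle 𝓘(ℝ, E) M)) h4.symm

/-- The expression of a one-form in the chart centred at `c`, for coefficients in a vector space. -/
lemma form_eq_chart (c : M) (β : M → E →L[ℝ] k) {x : M} (hx : x ∈ (chartAt E c).source) (v : E) :
    β x v = ((β ((chartAt E c).symm (chartAt E c x))).comp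
      (tderiv E E (chartAt E c).symm (chartAt E c x))) (tderiv E E (chartAt E c) x v) := by
  have h := congrArg (fun T : E →L[ℝ] E => β x (T v)) (tderiv_chartAt_symm_comp hx)
  rw [(chartAt E c).left_inv hx]
  exact h.symm

lemma contDiffAt_chartField {c : M} {X : Π x : M, TangentSpace 𝓘(ℝ, E) x}
    (hX : ContMDiff 𝓘(ℝ, E) 𝓘(ℝ, E).tangent ∞ (fun x => (⟨x, X x⟩ : TangentBundle 𝓘(ℝ, E) M)))
    {y : E} (hy : y ∈ (chartAt E c).target) : ContDiffAt ℝ ∞ (chartField c X) y := by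
  have h1 : ContMDiffAt 𝓘(ℝ, E) 𝓘(ℝ, E).tangent ∞
      (fun y => (⟨(chartAt E c).symm y, X ((chartAt E c).symm y)⟩ : TangentBundle 𝓘(ℝ, E) M)) y :=
    (hX _).comp y (contMDiffAt_chartAt_symm hy)
  have h2 := (contMDiffOn_tderiv_chartAt c).contMDiffAt
    (x := (⟨(chartAt E c).symm y, X ((chartAt E c).symm y)⟩ : TangentBundle 𝓘(ℝ, E) M))
    (((chartAt E c).open_source.preimage (FiberBundle.continuous_proj E _)).mem_nhds
      ((chartAt E c).map_target hy))
  exact (ContMDiffAt.comp y h2 h1).contDiffAt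

end Forms

/-! ### Lie-algebra-valued one-forms: smoothness and exterior derivative. -/

section LieForms

variable {k : Type*} [NormedLieRing k] [NormedLieAlgebra k]
  {E : Type*} [NormedAddCommGroup E] [NormedSpace ℝ E]
  {M : Type*} [TopologicalSpace M] [ChartedSpace E M] [IsManifold 𝓘(ℝ, E) ∞ M]

lemma contMDiff_form {β : M → E →L[ℝ] k}
    (hβ : ∀ c, ContDiffOn ℝ ∞ (chartForm c β) (chartAt E c).target) :
    ContMDiff 𝓘(ℝ, E).tangent 𝓘(ℝ, k) ∞ (fun w : TangentBundle 𝓘(ℝ, E) M => β w.1 w.2) := by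
  intro w
  set c := w.1 with hc
  have hU : IsOpen (Bundle.TotalSpace.proj ⁻¹' (chartAt E c).source :
      Set (TangentBundle 𝓘(ℝ, E) M)) :=
    (chartAt E c).open_source.preimage (FiberBundle.continuous_proj E _)
  have hw : w ∈ (Bundle.TotalSpace.proj ⁻¹' (chartAt E c).source :
      Set (TangentBundle 𝓘(ℝ, E) M)) := mem_chart_source E c
  have h1 : ContMDiffAt 𝓘(ℝ, E).tangent 𝓘(ℝ, E) ∞
      (fun w : TangentBundle 𝓘(ℝ, E) M => chartAt E c w.1) w :=
    ContMDiffAt.comp (I' := 𝓘(ℝ, E)) w (contMDiffAt_chartAt (mem_chart_source E c))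
      (Bundle.contMDiffAt_proj (TangentSpace 𝓘(ℝ, E)))
  have h2 : ContMDiffAt 𝓘(ℝ, E).tangent 𝓘(ℝ, E →L[ℝ] k) ∞
      (fun w : TangentBundle 𝓘(ℝ, E) M => chartForm c β (chartAt E c w.1)) w :=
    ContMDiffAt.comp (I' := 𝓘(ℝ, E)) w (((hβ c).contDiffAt
      ((chartAt E c).open_target.mem_nhds (mem_chart_target E c))).contMDiffAt) h1
  refine (h2.clm_apply ((contMDiffOn_tderiv_chartAt c).contMDiffAt
    (hU.mem_nhds hw))).congr_of_eventuallyEq ?_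
  filter_upwards [hU.mem_nhds hw] with z hz
  exact form_eq_chart c β hz z.2

lemma contDiffOn_chartForm [FiniteDimensional ℝ E] {β : M → E →L[ℝ] k}
    (hβ : ContMDiff 𝓘(ℝ, E).tangent 𝓘(ℝ, k) ∞
      (fun w : TangentBundle 𝓘(ℝ, E) M => β w.1 w.2)) (c : M) :
    ContDiffOn ℝ ∞ (chartForm c β) (chartAt E c).target := by
  refine contDiffOn_clm_apply.2 fun v => ?_
  exact (hβ.comp_contMDiffOn (contMDiffOn_tderiv_chartAt_symm c v)).contDiffOn

/-- The invariant formula for the exterior derivative of a one-form, in a chart. -/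
lemma tderiv_form_sub [FiniteDimensional ℝ E] {β : M → E →L[ℝ] k}
    {c : M} (hβ : ContDiffOn ℝ ∞ (chartForm c β) (chartAt E c).target)
    {X Y : Π x : M, TangentSpace 𝓘(ℝ, E) x}
    (hX : ContMDiff 𝓘(ℝ, E) 𝓘(ℝ, E).tangent ∞ (fun x => (⟨x, X x⟩ : TangentBundle 𝓘(ℝ, E) M)))
    (hY : ContMDiff 𝓘(ℝ, E) 𝓘(ℝ, E).tangent ∞ (fun x => (⟨x, Y x⟩ : TangentBundle 𝓘(ℝ, E) M)))
    {y : E} (hy : y ∈ (chartAt E c).target) {m : M} (hm : (chartAt E c).symm y = m) :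
    tderiv E k (fun x => β x (Y x)) m (X m) - tderiv E k (fun x => β x (X x)) m (Y m) -
      β m (VectorField.mlieBracket 𝓘(ℝ, E) X Y m) =
      fderiv ℝ (chartForm c β) y (chartField c X y) (chartField c Y y) -
        fderiv ℝ (chartForm c β) y (chartField c Y y) (chartField c X y) := by
  subst hm
  set φ := chartAt E c with hφ
  set b := chartForm c β with hb
  have hms : φ.symm y ∈ φ.source := φ.map_target hy
  have hbd : HasFDerivAt b (fderiv ℝ b y) y :=
    ((hβ.contDiffAt (φ.open_target.mem_nhds hy)).differentiableAt (by simp)).hasFDerivAt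
  -- Product rule for `β(Z)` along `W` in the chart. After antisymmetrization the terms with
  -- derivatives of the vector fields cancel against `β([X, Y])`.
  have key : ∀ Z W : Π x : M, TangentSpace 𝓘(ℝ, E) x,
      ContMDiff 𝓘(ℝ, E) 𝓘(ℝ, E).tangent ∞ (fun x => (⟨x, Z x⟩ : TangentBundle 𝓘(ℝ, E) M)) →
      tderiv E k (fun x => β x (Z x)) (φ.symm y) (W (φ.symm y)) =
        fderiv ℝ b y (chartField c W y) (chartField c Z y) +
          b y (fderiv ℝ (chartField c Z) y (chartField c W y)) := by
    intro Z W hZ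
    have hZd : HasFDerivAt (chartField c Z) (fderiv ℝ (chartField c Z) y) y :=
      ((contDiffAt_chartField hZ hy).differentiableAt (by simp)).hasFDerivAt
    have h1 : (fun x => β x (Z x)) =ᶠ[𝓝 (φ.symm y)] (fun z => b z (chartField c Z z)) ∘ φ := by
      filter_upwards [φ.open_source.mem_nhds hms] with x hx
      refine (form_eq_chart c β hx (Z x)).trans ?_
      have h2 : chartField c Z (φ x) = tderiv E E φ x (Z x) := by
        change tderiv E E φ (φ.symm (φ x)) (Z (φ.symm (φ x))) = _
        rw [φ.left_inv hx]
      rw [Function.comp_apply, h2]; rfl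
    have hbZ := hbd.clm_apply hZd
    rw [tderiv_congr h1, tderiv_comp_of_eq hbZ.differentiableAt.mdifferentiableAt
      (mdifferentiableAt_chartAt hms) (φ.right_inv hy), tderiv_eq_fderiv, hbZ.fderiv]
    change _ = fderiv ℝ b y (tderiv E E φ (φ.symm y) (W (φ.symm y))) (chartField c Z y) +
          b y (fderiv ℝ (chartField c Z) y (tderiv E E φ (φ.symm y) (W (φ.symm y))))
    rw [add_comm]
    rfl
  have hbr := lieBracket_chartField hy ((hX _).mdifferentiableAt (by simp))
    ((hY _).mdifferentiableAt (by simp))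
  have h3 : β (φ.symm y) (VectorField.mlieBracket 𝓘(ℝ, E) X Y (φ.symm y)) =
      b y (fderiv ℝ (chartField c Y) y (chartField c X y) -
        fderiv ℝ (chartField c X) y (chartField c Y y)) := by
    refine (form_eq_chart c β hms _).trans ?_
    rw [φ.right_inv hy]
    exact congrArg (b y) hbr.symm
  rw [key Y X hY, key X Y hX, h3, map_sub]
  abel

/-- Every tangent vector extends to a global smooth vector field. -/
lemma exists_contMDiff_vectorField [FiniteDimensional ℝ E] [T2Space M] (m : M) (v : E) :
    ∃ X : Π x : M, TangentSpace 𝓘(ℝ, E) x,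
      ContMDiff 𝓘(ℝ, E) 𝓘(ℝ, E).tangent ∞ (fun x => (⟨x, X x⟩ : TangentBundle 𝓘(ℝ, E) M)) ∧
        X m = v := by
  obtain ⟨s, hs, hsm⟩ := FiberBundle.exists_contMDiffOn_extend (k := ∞) 𝓘(ℝ, E) E
    (V := (TangentSpace 𝓘(ℝ, E) : M → Type _)) (x₀ := m) v
  obtain ⟨u, hus, hu, hmu⟩ := mem_nhds_iff.1 hs
  -- A bump function supported where the local extension is smooth makes the product globally smooth
  -- without changing the value at `m`.
  obtain ⟨ρ, hρ, -⟩ := (SmoothBumpFunction.nhds_basis_support (I := 𝓘(ℝ, E))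
    (hu.mem_nhds hmu)).mem_iff.1 (hu.mem_nhds hmu)
  refine ⟨(ρ : M → ℝ) • FiberBundle.extend E (E := (TangentSpace 𝓘(ℝ, E) : M → Type _)) (x := m) v,
    ?_, ?_⟩
  · exact ContMDiffOn.smul_section_of_tsupport ρ.contMDiff.contMDiffOn hu hρ (hsm.mono hus)
  · change ρ m • FiberBundle.extend E (E := (TangentSpace 𝓘(ℝ, E) : M → Type _)) (x := m) v m = v
    have h := FiberBundle.extend_apply_self E (E := (TangentSpace 𝓘(ℝ, E) : M → Type _)) (x := m) v
    rw [ρ.eq_one]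
    exact (one_smul ℝ _).trans h

end LieForms

/-! ### The gauge transformation defined by a map to the group and an automorphism -/

section Gauge

variable {F : Type*} [NormedAddCommGroup F] [NormedSpace ℝ F] [FiniteDimensional ℝ F]
  {K : Type*} [TopologicalSpace K] [ChartedSpace F K] [Group K] [LieGroup 𝓘(ℝ, F) ∞ K]
  {k : Type*} [NormedLieRing k] [NormedLieAlgebra k]
  {E : Type*} [NormedAddCommGroup E] [NormedSpace ℝ E]
  {M : Type*} [TopologicalSpace M] [ChartedSpace E M]
  (e : GroupLieAlgebra 𝓘(ℝ, F) K ≃ₗ⁅ℝ⁆ k)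

lemma contMDiff_adjointCLM_inv [FiniteDimensional ℝ k] [IsManifold 𝓘(ℝ, E) ∞ M] {h : M → K}
    (hh : ContMDiff 𝓘(ℝ, E) 𝓘(ℝ, F) ∞ h) :
    ContMDiff 𝓘(ℝ, E) 𝓘(ℝ, k →L[ℝ] k) ∞ (fun x => adjointCLM e (h x)⁻¹) := by
  intro x
  have hc : ContMDiffOn 𝓘(ℝ, E) 𝓘(ℝ, F) ∞ (h ∘ (chartAt E x).symm) (chartAt E x).target :=
    hh.comp_contMDiffOn contMDiffOn_chart_symm
  have h1 := ((adjointCLM_inv_deriv e (chartAt E x).open_target hc).1.contDiffAt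
    ((chartAt E x).open_target.mem_nhds (mem_chart_target E x))).contMDiffAt
  refine (ContMDiffAt.comp x h1 (contMDiffAt_chartAt (mem_chart_source E x))).congr_of_eventuallyEq ?_
  filter_upwards [(chartAt E x).open_source.mem_nhds (mem_chart_source E x)] with z hz
  simp [(chartAt E x).left_inv hz]

lemma tderiv_adjointCLM_inv [FiniteDimensional ℝ k] [IsManifold 𝓘(ℝ, E) ∞ M] {h : M → K}
    (hh : ContMDiff 𝓘(ℝ, E) 𝓘(ℝ, F) ∞ h) (x : M) (v : E)
    (η : k) :
    tderiv E (k →L[ℝ] k) (fun x => adjointCLM e (h x)⁻¹) x v η =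
      -⁅(leftLogDeriv e h x : E →L[ℝ] k) v, adjointCLM e (h x)⁻¹ η⁆ := by
  set φ := chartAt E x with hφ
  have hx : x ∈ φ.source := mem_chart_source E x
  have hy : φ x ∈ φ.target := mem_chart_target E x
  have hc : ContMDiffOn 𝓘(ℝ, E) 𝓘(ℝ, F) ∞ (h ∘ φ.symm) φ.target :=
    hh.comp_contMDiffOn contMDiffOn_chart_symm
  obtain ⟨h1, h2⟩ := adjointCLM_inv_deriv e φ.open_target hc
  have h3 := (h1.contDiffAt (φ.open_target.mem_nhds hy)).differentiableAt (by simp)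
  have h4 : (fun x => adjointCLM e (h x)⁻¹) =ᶠ[𝓝 x]
      (fun y => adjointCLM e ((h ∘ φ.symm) y)⁻¹) ∘ φ := by
    filter_upwards [φ.open_source.mem_nhds hx] with z hz
    simp [φ.left_inv hz]
  have h5 : h =ᶠ[𝓝 x] (h ∘ φ.symm) ∘ φ := by
    filter_upwards [φ.open_source.mem_nhds hx] with z hz
    simp [φ.left_inv hz]
  rw [tderiv_congr h4, tderiv_comp h3.mdifferentiableAt (mdifferentiableAt_chartAt hx),
    tderiv_eq_fderiv, leftLogDeriv_congr e h5, leftLogDeriv_comp e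
      ((hc.contMDiffAt (φ.open_target.mem_nhds hy)).mdifferentiableAt (by simp))
      (mdifferentiableAt_chartAt hx)]
  refine (h2 _ hy _ _).trans ?_
  simp only [Function.comp_apply, φ.left_inv hx]
  rfl

/-- The automorphism `(v, ξ) ↦ (v, A ξ + b v)` of `E × k`. -/
def shear (A : k ≃ₗ[ℝ] k) (b : E →L[ℝ] k) : (E × k) ≃ₗ[ℝ] (E × k) where
  toFun p := (p.1, A p.2 + b p.1)
  invFun p := (p.1, A.symm (p.2 - b p.1))
  map_add' p q := by
    refine Prod.ext rfl ?_
    simp only [Prod.fst_add, Prod.snd_add, map_add]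
    abel
  map_smul' c p := by
    refine Prod.ext rfl ?_
    simp
  left_inv p := by simp
  right_inv p := by simp

/-- Together with `Ad_lam_mul` and `leftLogDeriv_lam` this is the cocycle identity that makes the
fibre maps multiplicative in `(f, Ψ)`. -/
lemma leftLogDeriv_inv_mul {f g : M → K} {x : M}
    (hf : MDifferentiableAt 𝓘(ℝ, E) 𝓘(ℝ, F) f x) (hg : MDifferentiableAt 𝓘(ℝ, E) 𝓘(ℝ, F) g x)
    (v : E) :
    (leftLogDeriv e (fun y => (f y * g y)⁻¹) x : E →L[ℝ] k) v =
      adjointCLM e (f x) ((leftLogDeriv e (fun y => (g y)⁻¹) x : E →L[ℝ] k) v) +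
        (leftLogDeriv e (fun y => (f y)⁻¹) x : E →L[ℝ] k) v := by
  have h1 : (fun y => (f y * g y)⁻¹) = fun y => (g y)⁻¹ * (f y)⁻¹ :=
    funext fun y => mul_inv_rev _ _
  rw [h1, leftLogDeriv_mul e hg.inv_group hf.inv_group, inv_inv]
  rfl

/-- Differentiate at the unit the identity between conjugation by the image of `g` after the
automorphism and the automorphism after conjugation by `g`. -/
lemma Ad_lam_mul (lam : lieAut k →* LieGroupAut.smoothAut 𝓘(ℝ, F) K)
    (hlam : ∀ Ψ, LieGroupAut.differential e (lam Ψ) = Ψ) (Ψ : lieAut k) (g : K) :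
    LieGroupAut.Ad e ((lam Ψ).1 g) * Ψ = Ψ * LieGroupAut.Ad e g := by
  have h : LieGroupAut.conj 𝓘(ℝ, F) ((lam Ψ).1 g) * lam Ψ = lam Ψ * LieGroupAut.conj 𝓘(ℝ, F) g := by
    refine Subtype.ext (MulEquiv.ext fun x => ?_)
    change (lam Ψ).1 g * (lam Ψ).1 x * ((lam Ψ).1 g)⁻¹ = (lam Ψ).1 (g * x * g⁻¹)
    simp
  have h2 := congrArg (LieGroupAut.differential e) h
  rw [map_mul, map_mul, hlam] at h2
  exact h2

lemma leftLogDeriv_lam [FiniteDimensional ℝ k] (lam : lieAut k →* LieGroupAut.smoothAut 𝓘(ℝ, F) K)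
    (hlam : ∀ Ψ, LieGroupAut.differential e (lam Ψ) = Ψ) (Ψ : lieAut k) {f : M → K} {x : M}
    (hf : MDifferentiableAt 𝓘(ℝ, E) 𝓘(ℝ, F) f x) (v : E) :
    (leftLogDeriv e (fun y => ((lam Ψ).1 (f y))⁻¹) x : E →L[ℝ] k) v =
      Ψ.1 ((leftLogDeriv e (fun y => (f y)⁻¹) x : E →L[ℝ] k) v) := by
  have h1 : (fun y => ((lam Ψ).1 (f y))⁻¹) = (lam Ψ).1 ∘ fun y => (f y)⁻¹ :=
    funext fun y => (map_inv _ _).symm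
  have h2 := leftLogDeriv_smoothAut e (lam Ψ) (f x)⁻¹
  rw [hlam] at h2
  rw [h1, leftLogDeriv_comp_of_lieAut e (f := fun y => (f y)⁻¹) (LieGroupAut.mdiff (lam Ψ) _) h2 hf.inv_group]
  rfl

lemma tderiv_lieAut [FiniteDimensional ℝ k] {u : M → k} {m : M} (hu : MDifferentiableAt 𝓘(ℝ, E) 𝓘(ℝ, k) u m)
    (Ψ : lieAut k) (v : E) :
    tderiv E k (fun x => Ψ.1 (u x)) m v = Ψ.1 (tderiv E k u m v) := by
  have h := tderiv_comp (g := lieAutCLM Ψ) (f := u) (x := m)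
    (lieAutCLM Ψ).differentiableAt.mdifferentiableAt hu
  rw [tderiv_eq_fderiv, ContinuousLinearMap.fderiv] at h
  exact congrArg (fun T : E →L[ℝ] k => T v) h

open TrivialAlgebroid LieGroupAut

/-- The family of automorphisms of the fibres of `TM × k` defined by `f : M → K` and `Ψ`. -/
def gaugeFamily (f : M → K) (Ψ : lieAut k) (m : M) :
    (TangentSpace 𝓘(ℝ, E) m × k) ≃ₗ[ℝ] (TangentSpace 𝓘(ℝ, E) m × k) :=
  shear (E := E) (Ad e (f m) * Ψ).1 (leftLogDeriv e (fun y => (f y)⁻¹) m)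

lemma gaugeFamily_apply (f : M → K) (Ψ : lieAut k) (m : M)
    (p : TangentSpace 𝓘(ℝ, E) m × k) :
    gaugeFamily e f Ψ m p = (p.1, adjointCLM e (f m) (Ψ.1 p.2) +
      (leftLogDeriv e (fun y => (f y)⁻¹) m : E →L[ℝ] k) p.1) := rfl

variable {e} in
/-- The homomorphism from the semidirect product to the families of fibre automorphisms. -/
def gaugeHom [FiniteDimensional ℝ k] {lam : lieAut k →* smoothAut 𝓘(ℝ, F) K}
    (hlam : ∀ Ψ, differential e (lam Ψ) = Ψ) :
    C^∞⟮𝓘(ℝ, E), M; 𝓘(ℝ, F), K⟯ ⋊[(postcomp 𝓘(ℝ, E) M).comp lam] lieAut k →*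
      (Π m : M, (TangentSpace 𝓘(ℝ, E) m × k) ≃ₗ[ℝ] (TangentSpace 𝓘(ℝ, E) m × k)) :=
  MonoidHom.mk' (fun p => gaugeFamily e p.left p.right) fun p q => by
    funext m
    refine LinearEquiv.ext fun x => Prod.ext rfl ?_
    have hd : ∀ f : C^∞⟮𝓘(ℝ, E), M; 𝓘(ℝ, F), K⟯,
      MDifferentiableAt 𝓘(ℝ, E) 𝓘(ℝ, F) f m := fun f => (f.contMDiff m).mdifferentiableAt (by simp)
    have h1 := leftLogDeriv_inv_mul e (hd p.left)
      (hd ((postcomp 𝓘(ℝ, E) M).comp lam p.right q.left)) x.1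
    have h2 := leftLogDeriv_lam e lam hlam p.right (hd q.left) x.1
    have h3 := congrArg (fun T : lieAut k => T.1 (q.right.1 x.2))
      (Ad_lam_mul e lam hlam p.right (q.left m))
    change adjointCLM e (p.left m * (lam p.right).1 (q.left m)) (p.right.1 (q.right.1 x.2)) +
        (leftLogDeriv e (fun y => (p.left y * (lam p.right).1 (q.left y))⁻¹) m : E →L[ℝ] k) x.1 =
      adjointCLM e (p.left m) (p.right.1 (adjointCLM e (q.left m) (q.right.1 x.2) +
        (leftLogDeriv e (fun y => (q.left y)⁻¹) m : E →L[ℝ] k) x.1)) +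
        (leftLogDeriv e (fun y => (p.left y)⁻¹) m : E →L[ℝ] k) x.1
    refine (congrArg₂ (· + ·) (adjointCLM_mul_apply e _ _ _) h1).trans ?_
    rw [map_add, map_add, ← add_assoc]
    refine congrArg₂ (· + ·) (congrArg₂ (· + ·) (congrArg _ h3) (congrArg _ h2)) rfl

end Gauge

/-- Algebra behind bracket preservation: `u, w` are the transformed coefficients and `p, q` the
values of the form on the two anchors. The terms `⁅p, w⁆` and `⁅q, u⁆` from differentiating `Ad_f`
cancel the mixed terms of the bracket, and `h` is flatness. -/
lemma lie_add_add_of_curvature {k : Type*} [LieRing k] {u w p q b c t s r : k}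
    (h : t - s - r = -⁅p, q⁆) :
    ⁅u, w⁆ + b - c + r = ⁅u + p, w + q⁆ + (b - ⁅p, w⁆ + t) - (c - ⁅q, u⁆ + s) := by
  rw [lie_add, add_lie, add_lie, ← lie_skew u q]
  rw [sub_eq_iff_eq_add, sub_eq_iff_eq_add] at h
  rw [h]
  abel

/-! ### Pairs `(f, Ψ)` give gauge transformations; invariant form of flatness. -/

section GaugeGroup

variable {F : Type*} [NormedAddCommGroup F] [NormedSpace ℝ F] [FiniteDimensional ℝ F]
  {K : Type*} [TopologicalSpace K] [ChartedSpace F K] [Group K] [LieGroup 𝓘(ℝ, F) ∞ K]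
  {k : Type*} [NormedLieRing k] [NormedLieAlgebra k]
  {E : Type*} [NormedAddCommGroup E] [NormedSpace ℝ E]
  {M : Type*} [TopologicalSpace M] [ChartedSpace E M] [IsManifold 𝓘(ℝ, E) ∞ M]
  (e : GroupLieAlgebra 𝓘(ℝ, F) K ≃ₗ⁅ℝ⁆ k)

lemma chartForm_chartField (β : M → E →L[ℝ] k) {c : M} (X : Π x : M, TangentSpace 𝓘(ℝ, E) x)
    {y : E} (hy : y ∈ (chartAt E c).target) :
    chartForm c β y (chartField c X y) = β ((chartAt E c).symm y) (X ((chartAt E c).symm y)) := by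
  have h := form_eq_chart c β ((chartAt E c).map_target hy) (X ((chartAt E c).symm y))
  rw [(chartAt E c).right_inv hy] at h
  exact h.symm

lemma IsFlatForm.tderiv_sub [FiniteDimensional ℝ E] {β : M → E →L[ℝ] k} (hβ : IsFlatForm β)
    {X Y : Π x : M, TangentSpace 𝓘(ℝ, E) x}
    (hX : ContMDiff 𝓘(ℝ, E) 𝓘(ℝ, E).tangent ∞ (fun x => (⟨x, X x⟩ : TangentBundle 𝓘(ℝ, E) M)))
    (hY : ContMDiff 𝓘(ℝ, E) 𝓘(ℝ, E).tangent ∞ (fun x => (⟨x, Y x⟩ : TangentBundle 𝓘(ℝ, E) M)))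
    (m : M) :
    tderiv E k (fun x => β x (Y x)) m (X m) - tderiv E k (fun x => β x (X x)) m (Y m) -
      β m (VectorField.mlieBracket 𝓘(ℝ, E) X Y m) = -⁅β m (X m), β m (Y m)⁆ := by
  have hy := mem_chart_target E m
  have hm := (chartAt E m).left_inv (mem_chart_source E m)
  rw [tderiv_form_sub (hβ m).contDiffOn hX hY hy hm]
  have h := (hβ m).curvature _ hy (chartField m X (chartAt E m m)) (chartField m Y (chartAt E m m))
  rw [chartForm_chartField β X hy, chartForm_chartField β Y hy, hm] at h
  exact eq_neg_of_add_eq_zero_left h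

/-- The curvature at a point depends only on the two tangent vectors there, so it may be tested on
global fields extending them. -/
lemma isFlatForm_of_tderiv_sub [FiniteDimensional ℝ E] [T2Space M] {β : M → E →L[ℝ] k}
    (hβ : ContMDiff 𝓘(ℝ, E).tangent 𝓘(ℝ, k) ∞
      (fun w : TangentBundle 𝓘(ℝ, E) M => β w.1 w.2))
    (h : ∀ X Y : Π x : M, TangentSpace 𝓘(ℝ, E) x,
      ContMDiff 𝓘(ℝ, E) 𝓘(ℝ, E).tangent ∞ (fun x => (⟨x, X x⟩ : TangentBundle 𝓘(ℝ, E) M)) →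
      ContMDiff 𝓘(ℝ, E) 𝓘(ℝ, E).tangent ∞ (fun x => (⟨x, Y x⟩ : TangentBundle 𝓘(ℝ, E) M)) →
      ∀ m, tderiv E k (fun x => β x (Y x)) m (X m) - tderiv E k (fun x => β x (X x)) m (Y m) -
        β m (VectorField.mlieBracket 𝓘(ℝ, E) X Y m) = -⁅β m (X m), β m (Y m)⁆) :
    IsFlatForm β := by
  refine fun c => ⟨contDiffOn_chartForm hβ c, fun y hy v w => ?_⟩
  have hfield : ∀ v : E, ∃ X : Π x : M, TangentSpace 𝓘(ℝ, E) x,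
      ContMDiff 𝓘(ℝ, E) 𝓘(ℝ, E).tangent ∞ (fun x => (⟨x, X x⟩ : TangentBundle 𝓘(ℝ, E) M)) ∧
        chartField c X y = v := by
    intro v
    obtain ⟨X, hX, hXv⟩ := exists_contMDiff_vectorField ((chartAt E c).symm y)
      (tderiv E E (chartAt E c).symm y v)
    refine ⟨X, hX, ?_⟩
    refine (congrArg (tderiv E E (chartAt E c) ((chartAt E c).symm y)) hXv).trans ?_
    exact congrArg (fun T : E →L[ℝ] E => T v) (tderiv_chartAt_comp_symm hy)
  obtain ⟨X, hX, rfl⟩ := hfield v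
  obtain ⟨Y, hY, rfl⟩ := hfield w
  rw [← tderiv_form_sub (contDiffOn_chartForm hβ c) hX hY hy rfl, h X Y hX hY,
    chartForm_chartField β X hy, chartForm_chartField β Y hy]
  exact neg_add_cancel _

open TrivialAlgebroid LieGroupAut

lemma isSmoothSection_mk {X : Π x : M, TangentSpace 𝓘(ℝ, E) x}
    (hX : ContMDiff 𝓘(ℝ, E) 𝓘(ℝ, E).tangent ∞ (fun x => (⟨x, X x⟩ : TangentBundle 𝓘(ℝ, E) M)))
    {ξ : M → k} (hξ : ContMDiff 𝓘(ℝ, E) 𝓘(ℝ, k) ∞ ξ) :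
    IsSmoothSection 𝓘(ℝ, E) (fun x => (X x, ξ x)) :=
  ContMDiff.prodMk hX hξ

lemma TrivialAlgebroid.IsSmoothSection.contMDiff_coeff {σ : Π m : M, TangentSpace 𝓘(ℝ, E) m × k}
    (hσ : IsSmoothSection 𝓘(ℝ, E) σ) : ContMDiff 𝓘(ℝ, E) 𝓘(ℝ, k) ∞ (fun x => (σ x).2) :=
  contMDiff_snd.comp (f := fun m : M => ((⟨m, (σ m).1⟩ : TangentBundle 𝓘(ℝ, E) M), (σ m).2)) hσ

lemma TrivialAlgebroid.IsSmoothSection.contMDiff_anchor {σ : Π m : M, TangentSpace 𝓘(ℝ, E) m × k}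
    (hσ : IsSmoothSection 𝓘(ℝ, E) σ) : ContMDiff 𝓘(ℝ, E) 𝓘(ℝ, E).tangent ∞
      (fun x => (⟨x, (σ x).1⟩ : TangentBundle 𝓘(ℝ, E) M)) :=
  contMDiff_fst.comp (f := fun m : M => ((⟨m, (σ m).1⟩ : TangentBundle 𝓘(ℝ, E) M), (σ m).2)) hσ

lemma contMDiff_form_apply {β : M → E →L[ℝ] k}
    (hβ : ContMDiff 𝓘(ℝ, E).tangent 𝓘(ℝ, k) ∞ (fun w : TangentBundle 𝓘(ℝ, E) M => β w.1 w.2))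
    {X : Π x : M, TangentSpace 𝓘(ℝ, E) x}
    (hX : ContMDiff 𝓘(ℝ, E) 𝓘(ℝ, E).tangent ∞ (fun x => (⟨x, X x⟩ : TangentBundle 𝓘(ℝ, E) M))) :
    ContMDiff 𝓘(ℝ, E) 𝓘(ℝ, k) ∞ (fun x => β x (X x)) :=
  ContMDiff.comp (g := fun w : TangentBundle 𝓘(ℝ, E) M => β w.1 w.2)
    (f := fun x => (⟨x, X x⟩ : TangentBundle 𝓘(ℝ, E) M)) hβ hX

lemma gaugeFamily_bracket [FiniteDimensional ℝ k] [FiniteDimensional ℝ E]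
    (f : C^∞⟮𝓘(ℝ, E), M; 𝓘(ℝ, F), K⟯) (Ψ : lieAut k)
    (σ τ : Π m : M, TangentSpace 𝓘(ℝ, E) m × k) (hσ : IsSmoothSection 𝓘(ℝ, E) σ)
    (hτ : IsSmoothSection 𝓘(ℝ, E) τ) (m : M) :
    gaugeFamily e f Ψ m (bracket 𝓘(ℝ, E) σ τ m) =
      bracket 𝓘(ℝ, E) (fun x => gaugeFamily e f Ψ x (σ x)) (fun x => gaugeFamily e f Ψ x (τ x)) m := by
  have hf : ContMDiff 𝓘(ℝ, E) 𝓘(ℝ, F) ∞ (fun y => (f y)⁻¹) := f.contMDiff.inv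
  set β : M → E →L[ℝ] k := leftLogDeriv e (fun y => (f y)⁻¹) with hβ
  have hflat : IsFlatForm β := isFlatForm_leftLogDeriv e hf
  have hβs := contMDiff_form fun c => (hflat c).contDiffOn
  set A : M → k →L[ℝ] k := fun x => adjointCLM e (f x) with hA
  -- Writing `f = (f⁻¹)⁻¹` lets the derivative formula for `Ad` apply to the map `f⁻¹`, whose
  -- logarithmic derivative is the same `β`.
  have hA' : A = fun x => adjointCLM e ((f x)⁻¹)⁻¹ := by simp [hA]
  have hAs : ContMDiff 𝓘(ℝ, E) 𝓘(ℝ, k →L[ℝ] k) ∞ A := by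
    rw [hA']; exact contMDiff_adjointCLM_inv e hf
  have hAd : ∀ v η, tderiv E (k →L[ℝ] k) A m v η = -⁅β m v, A m η⁆ := by
    intro v η
    rw [hA', tderiv_adjointCLM_inv e hf]
  have hder : ∀ ρ : Π m : M, TangentSpace 𝓘(ℝ, E) m × k, IsSmoothSection 𝓘(ℝ, E) ρ → ∀ v : E,
      tderiv E k (fun x => A x (Ψ.1 (ρ x).2) + β x (ρ x).1) m v =
        A m (Ψ.1 (tderiv E k (fun x => (ρ x).2) m v)) - ⁅β m v, A m (Ψ.1 (ρ m).2)⁆ +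
          tderiv E k (fun x => β x (ρ x).1) m v := by
    intro ρ hρ v
    have h1 := hρ.contMDiff_coeff
    have h2 : ContMDiff 𝓘(ℝ, E) 𝓘(ℝ, k) ∞ (fun x => Ψ.1 (ρ x).2) :=
      (lieAutCLM Ψ).contMDiff.comp h1
    have h3 : ContMDiff 𝓘(ℝ, E) 𝓘(ℝ, k) ∞ (fun x => β x (ρ x).1) :=
      contMDiff_form_apply hβs hρ.contMDiff_anchor
    have h5 := tderiv_clm_apply ((hAs m).mdifferentiableAt (by simp))
      ((h2 m).mdifferentiableAt (by simp)) v
    rw [tderiv_add (((hAs.clm_apply h2) m).mdifferentiableAt (by simp))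
      ((h3 m).mdifferentiableAt (by simp)), _root_.add_apply, h5, hAd,
      tderiv_lieAut ((h1 m).mdifferentiableAt (by simp)), sub_eq_add_neg]
  have hc := hflat.tderiv_sub hσ.contMDiff_anchor hτ.contMDiff_anchor m
  have hl : A m (Ψ.1 ⁅(σ m).2, (τ m).2⁆) = ⁅A m (Ψ.1 (σ m).2), A m (Ψ.1 (τ m).2)⁆ :=
    (Ad e (f m) * Ψ).2 _ _
  refine Prod.ext rfl ?_
  change A m (Ψ.1 (⁅(σ m).2, (τ m).2⁆ + tderiv E k (fun x => (τ x).2) m (σ m).1 -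
      tderiv E k (fun x => (σ x).2) m (τ m).1)) +
      β m (VectorField.mlieBracket 𝓘(ℝ, E) (fun x => (σ x).1) (fun x => (τ x).1) m) =
    ⁅A m (Ψ.1 (σ m).2) + β m (σ m).1, A m (Ψ.1 (τ m).2) + β m (τ m).1⁆ +
      tderiv E k (fun x => A x (Ψ.1 (τ x).2) + β x (τ x).1) m (σ m).1 -
      tderiv E k (fun x => A x (Ψ.1 (σ x).2) + β x (σ x).1) m (τ m).1
  have hadd : ∀ a b c : k, A m (Ψ.1 (a + b - c)) = A m (Ψ.1 a) + A m (Ψ.1 b) - A m (Ψ.1 c) :=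
    fun a b c => by simp only [map_add, map_sub]
  refine (congrArg₂ (· + ·) ((hadd _ _ _).trans (congrArg₂ (· - ·) (congrArg₂ (· + ·) hl rfl) rfl))
    rfl).trans (Eq.trans ?_ (congrArg₂ (· - ·) (congrArg₂ (· + ·) rfl (hder τ hτ _).symm)
      (hder σ hσ _).symm))
  exact lie_add_add_of_curvature hc

lemma contMDiff_totalMap_gaugeFamily [FiniteDimensional ℝ k]
    (f : C^∞⟮𝓘(ℝ, E), M; 𝓘(ℝ, F), K⟯) (Ψ : lieAut k) :
    ContMDiff (𝓘(ℝ, E).tangent.prod 𝓘(ℝ, k)) (𝓘(ℝ, E).tangent.prod 𝓘(ℝ, k)) ∞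
      (totalMap 𝓘(ℝ, E) (gaugeFamily e f Ψ)) := by
  have hf : ContMDiff 𝓘(ℝ, E) 𝓘(ℝ, F) ∞ (fun y => (f y)⁻¹) := f.contMDiff.inv
  have hβ := contMDiff_form fun c => (isFlatForm_leftLogDeriv e hf c).contDiffOn
  have hA : ContMDiff 𝓘(ℝ, E) 𝓘(ℝ, k →L[ℝ] k) ∞ (fun x => adjointCLM e (f x)) := by
    simpa using contMDiff_adjointCLM_inv e hf
  have h1 : ContMDiff (𝓘(ℝ, E).tangent.prod 𝓘(ℝ, k)) 𝓘(ℝ, E) ∞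
      (fun p : TangentBundle 𝓘(ℝ, E) M × k => p.1.1) :=
    (Bundle.contMDiff_proj (TangentSpace 𝓘(ℝ, E))).comp contMDiff_fst
  have h2 : ContMDiff (𝓘(ℝ, E).tangent.prod 𝓘(ℝ, k)) 𝓘(ℝ, k) ∞
      (fun p : TangentBundle 𝓘(ℝ, E) M × k => lieAutCLM Ψ p.2) :=
    (lieAutCLM Ψ).contMDiff.comp contMDiff_snd
  exact contMDiff_fst.prodMk (((hA.comp h1).clm_apply h2).add (hβ.comp contMDiff_fst))

variable {e} in
lemma gaugeHom_mem [FiniteDimensional ℝ k] [FiniteDimensional ℝ E]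
    {lam : lieAut k →* smoothAut 𝓘(ℝ, F) K}
    (hlam : ∀ Ψ, differential e (lam Ψ) = Ψ)
    (p : C^∞⟮𝓘(ℝ, E), M; 𝓘(ℝ, F), K⟯ ⋊[(postcomp 𝓘(ℝ, E) M).comp lam] lieAut k) :
    gaugeHom hlam p ∈ gaugeGroup 𝓘(ℝ, E) M k where
  smooth := contMDiff_totalMap_gaugeFamily e _ _
  smooth_inv := by
    -- The inverse family is the one of the inverse pair, hence smooth for the same reason.
    rw [← map_inv]
    exact contMDiff_totalMap_gaugeFamily e _ _
  anchor _ _ := rfl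
  map_bracket := gaugeFamily_bracket e _ _

end GaugeGroup

/-! ### Structure of gauge transformations, surjectivity and kernel. -/

section Surjectivity

open TrivialAlgebroid LieGroupAut

variable {k : Type*} [NormedLieRing k] [NormedLieAlgebra k]
  {E : Type*} [NormedAddCommGroup E] [NormedSpace ℝ E]
  {M : Type*} [TopologicalSpace M] [ChartedSpace E M] [IsManifold 𝓘(ℝ, E) ∞ M]
  {Φ : Π m : M, (TangentSpace 𝓘(ℝ, E) m × k) ≃ₗ[ℝ] (TangentSpace 𝓘(ℝ, E) m × k)}

lemma TrivialAlgebroid.IsGauge.snd_bracket (hΦ : IsGauge 𝓘(ℝ, E) Φ)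
    {σ τ : Π m : M, TangentSpace 𝓘(ℝ, E) m × k}
    (hσ : IsSmoothSection 𝓘(ℝ, E) σ) (hτ : IsSmoothSection 𝓘(ℝ, E) τ) (m : M) :
    (Φ m (bracket 𝓘(ℝ, E) σ τ m)).2 = ⁅(Φ m (σ m)).2, (Φ m (τ m)).2⁆ +
      tderiv E k (fun x => (Φ x (τ x)).2) m (σ m).1 -
      tderiv E k (fun x => (Φ x (σ x)).2) m (τ m).1 := by
  have h := congrArg Prod.snd (hΦ.map_bracket σ τ hσ hτ m)
  rw [← hΦ.anchor m (σ m), ← hΦ.anchor m (τ m)]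
  exact h

lemma contMDiff_zero_vectorField : ContMDiff 𝓘(ℝ, E) 𝓘(ℝ, E).tangent ∞
    (fun x : M => (⟨x, 0⟩ : TangentBundle 𝓘(ℝ, E) M)) :=
  Bundle.contMDiff_zeroSection ℝ (TangentSpace 𝓘(ℝ, E) : M → Type _)

/-- A gauge transformation that fixes the tangent vectors is given by a fixed automorphism. -/
lemma TrivialAlgebroid.IsGauge.exists_lieAut [T2Space M] [FiniteDimensional ℝ E]
    [PreconnectedSpace M] (hΦ : IsGauge 𝓘(ℝ, E) Φ)
    (h0 : ∀ (m : M) (v : TangentSpace 𝓘(ℝ, E) m), Φ m (v, 0) = (v, 0)) (m₀ : M) :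
    ∃ Ψ : lieAut k, ∀ (m : M) (x : TangentSpace 𝓘(ℝ, E) m × k), Φ m x = (x.1, Ψ.1 x.2) := by
  have hsplit : ∀ (m : M) (v : TangentSpace 𝓘(ℝ, E) m) (ξ : k),
      Φ m (v, ξ) = (v, (Φ m (0, ξ)).2) := by
    intro m v ξ
    have h1 : ((v, ξ) : TangentSpace 𝓘(ℝ, E) m × k) = (v, 0) + (0, ξ) := by simp
    refine Prod.ext (hΦ.anchor m _) ?_
    rw [h1, map_add, h0]
    simp
  have hz : ∀ ξ : k, IsSmoothSection (M := M) 𝓘(ℝ, E) (fun _ => (0, ξ)) := fun ξ =>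
    isSmoothSection_mk contMDiff_zero_vectorField contMDiff_const
  -- The bracket of a vector field with a constant section has zero `k`-part. Since tangent vectors
  -- are fixed, applying the transformation shows that the image of `ξ` has zero derivative along
  -- every vector field.
  have hconst : ∀ (ξ : k) (m : M), (Φ m (0, ξ)).2 = (Φ m₀ (0, ξ)).2 := by
    intro ξ m
    refine eq_of_tderiv_eq_zero (E := E) (F := k) (f := fun m => (Φ m (0, ξ)).2) (fun x =>
      (((hz ξ).map hΦ.smooth).contMDiff_coeff x).mdifferentiableAt (by simp)) (fun x => ?_) m m₀
    ext v
    obtain ⟨X, hX, hXv⟩ := exists_contMDiff_vectorField x v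
    have hs : IsSmoothSection 𝓘(ℝ, E) (fun x => (X x, (0 : k))) :=
      isSmoothSection_mk hX contMDiff_const
    have h := hΦ.snd_bracket hs (hz ξ) x
    have h1 : bracket 𝓘(ℝ, E) (fun x => (X x, (0 : k))) (fun _ => (0, ξ)) x =
        ((bracket 𝓘(ℝ, E) (fun x => (X x, (0 : k))) (fun _ => (0, ξ)) x).1, 0) := by
      refine Prod.ext rfl ?_
      change ⁅(0 : k), ξ⁆ + tderiv E k (fun _ : M => ξ) x (X x) -
        tderiv E k (fun _ : M => (0 : k)) x 0 = 0
      rw [zero_lie, map_zero, tderiv_const, zero_add, sub_zero]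
      rfl
    rw [h1, h0, h0] at h
    have h2 : tderiv E k (fun m => (Φ m (X m, 0)).2) x (0 : E) = 0 := map_zero _
    rw [← hXv]
    refine Eq.trans ?_ h.symm
    rw [zero_lie, zero_add]
    refine Eq.trans ?_ (congrArg (_ - ·) h2).symm
    exact (sub_zero _).symm
  let Ψ : k ≃ₗ[ℝ] k :=
    { toFun := fun ξ => (Φ m₀ (0, ξ)).2
      invFun := fun ξ => ((Φ m₀).symm (0, ξ)).2
      map_add' := fun ξ η => by
        have : ((0, ξ + η) : TangentSpace 𝓘(ℝ, E) m₀ × k) = (0, ξ) + (0, η) := by simp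
        rw [this, map_add, Prod.snd_add]
      map_smul' := fun c ξ => by
        have : ((0, c • ξ) : TangentSpace 𝓘(ℝ, E) m₀ × k) = c • (0, ξ) := by simp
        rw [this, map_smul, Prod.smul_snd]; rfl
      left_inv := fun ξ => by
        change ((Φ m₀).symm (0, (Φ m₀ (0, ξ)).2)).2 = ξ
        rw [← hsplit m₀ 0 ξ, LinearEquiv.symm_apply_apply]
      right_inv := fun ξ => by
        have h1 : ((Φ m₀).symm (0, ξ)).1 = 0 := by
          have := hΦ.anchor m₀ ((Φ m₀).symm (0, ξ))
          rw [LinearEquiv.apply_symm_apply] at this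
          exact this.symm
        have h2 : (0, ((Φ m₀).symm (0, ξ)).2) = (Φ m₀).symm (0, ξ) := Prod.ext h1.symm rfl
        change (Φ m₀ (0, ((Φ m₀).symm (0, ξ)).2)).2 = ξ
        rw [h2, LinearEquiv.apply_symm_apply] }
  have hΨ : Ψ ∈ lieAut k := by
    intro ξ η
    -- Constant sections with zero anchor bracket pointwise, with no derivative terms.
    have h := hΦ.snd_bracket (hz ξ) (hz η) m₀
    have h1 : bracket 𝓘(ℝ, E) (fun _ => (0, ξ)) (fun _ => (0, η)) m₀ =
        ((bracket 𝓘(ℝ, E) (fun _ => (0, ξ)) (fun _ => (0, η)) m₀).1, ⁅ξ, η⁆) := by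
      refine Prod.ext rfl ?_
      change ⁅ξ, η⁆ + tderiv E k (fun _ : M => η) m₀ 0 -
        tderiv E k (fun _ : M => ξ) m₀ 0 = ⁅ξ, η⁆
      rw [map_zero, map_zero, add_zero, sub_zero]
    rw [h1, hsplit] at h
    have h2 : ∀ g : M → k, tderiv E k g m₀ (0 : E) = 0 := fun g => map_zero _
    refine h.trans ?_
    refine (congrArg₂ (· - ·) (congrArg₂ (· + ·) rfl (h2 _)) (h2 _)).trans ?_
    rw [add_zero, sub_zero]
    rfl
  refine ⟨⟨Ψ, hΨ⟩, fun m x => ?_⟩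
  refine (hsplit m x.1 x.2).trans (Prod.ext rfl ?_)
  exact hconst x.2 m

/-- The `k`-component of a gauge transformation on tangent vectors. -/
def gaugeForm [FiniteDimensional ℝ E]
    (Φ : Π m : M, (TangentSpace 𝓘(ℝ, E) m × k) ≃ₗ[ℝ] (TangentSpace 𝓘(ℝ, E) m × k)) (m : M) :
    E →L[ℝ] k :=
  LinearMap.toContinuousLinearMap
    ((LinearMap.snd ℝ E k).comp ((Φ m).toLinearMap.comp (LinearMap.inl ℝ E k)))

/-- On sections with vanishing coefficient, the `k`-component of bracket preservation is the
invariant formula for flatness. -/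
lemma TrivialAlgebroid.IsGauge.isFlatForm [T2Space M] [FiniteDimensional ℝ E]
    [FiniteDimensional ℝ k] (hΦ : IsGauge 𝓘(ℝ, E) Φ) :
    IsFlatForm (gaugeForm Φ) := by
  refine isFlatForm_of_tderiv_sub ?_ fun X Y hX hY m => ?_
  · have h1 : ContMDiff 𝓘(ℝ, E).tangent (𝓘(ℝ, E).tangent.prod 𝓘(ℝ, k)) ∞
        (fun w : TangentBundle 𝓘(ℝ, E) M => (w, (0 : k))) := contMDiff_id.prodMk contMDiff_const
    have h2 : ContMDiff 𝓘(ℝ, E).tangent 𝓘(ℝ, k) ∞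
        (fun w : TangentBundle 𝓘(ℝ, E) M => (totalMap 𝓘(ℝ, E) Φ (w, 0)).2) :=
      contMDiff_snd.comp (hΦ.smooth.comp h1)
    exact h2
  · have h := hΦ.snd_bracket (isSmoothSection_mk hX (contMDiff_const (c := (0 : k))))
      (isSmoothSection_mk hY (contMDiff_const (c := (0 : k)))) m
    have h1 : bracket 𝓘(ℝ, E) (fun x => (X x, (0 : k))) (fun x => (Y x, 0)) m =
        (VectorField.mlieBracket 𝓘(ℝ, E) X Y m, 0) := by
      refine Prod.ext rfl ?_
      change ⁅(0 : k), (0 : k)⁆ + tderiv E k (fun _ : M => (0 : k)) m (X m) -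
        tderiv E k (fun _ : M => (0 : k)) m (Y m) = 0
      rw [zero_lie, tderiv_const, zero_add]
      exact sub_zero _
    rw [h1] at h
    have h2 : ∀ a b c d : k, d = a + b - c → b - c - d = -a := by
      rintro a b c d rfl; abel
    exact h2 _ _ _ _ h

variable {F : Type*} [NormedAddCommGroup F] [NormedSpace ℝ F] [FiniteDimensional ℝ F]
  {K : Type*} [TopologicalSpace K] [ChartedSpace F K] [Group K] [LieGroup 𝓘(ℝ, F) ∞ K]
  [FiniteDimensional ℝ k] [SimplyConnectedSpace M]
  {e : GroupLieAlgebra 𝓘(ℝ, F) K ≃ₗ⁅ℝ⁆ k} {lam : lieAut k →* smoothAut 𝓘(ℝ, F) K}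
  (hlam : ∀ Ψ, differential e (lam Ψ) = Ψ)

/-- Integrating the flat form of `Φ` yields `f`; dividing by the transformation of `(f, 1)` leaves
one that fixes tangent vectors, which is a constant automorphism. -/
lemma exists_gaugeHom_eq [FiniteDimensional ℝ E] [T2Space M]
    (hΦ : Φ ∈ gaugeGroup 𝓘(ℝ, E) M k) (m₀ : M) :
    ∃ p : C^∞⟮𝓘(ℝ, E), M; 𝓘(ℝ, F), K⟯ ⋊[(postcomp 𝓘(ℝ, E) M).comp lam] lieAut k,
      p.left m₀ = 1 ∧ gaugeHom hlam p = Φ := by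
  obtain ⟨h, hh, hh1, hhl⟩ := exists_leftLogDeriv_eq e (IsGauge.isFlatForm hΦ) m₀
  -- The inverse appears because the family of `f` involves the logarithmic derivative of `f⁻¹`.
  let f : C^∞⟮𝓘(ℝ, E), M; 𝓘(ℝ, F), K⟯ := ⟨fun m => (h m)⁻¹, hh.inv⟩
  have hfh : (fun y => (f y)⁻¹) = h := funext fun y => inv_inv (h y)
  set Φ₀ := gaugeHom hlam (⟨f, 1⟩ : C^∞⟮𝓘(ℝ, E), M; 𝓘(ℝ, F), K⟯
    ⋊[(postcomp 𝓘(ℝ, E) M).comp lam] lieAut k) with hΦ₀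
  have hΦ₀a : ∀ (m : M) (x : TangentSpace 𝓘(ℝ, E) m × k),
      Φ₀ m x = (x.1, adjointCLM e (f m) x.2 + gaugeForm Φ m x.1) := by
    intro m x
    refine (gaugeFamily_apply e f 1 m x).trans ?_
    rw [hfh, hhl]
    rfl
  have hδ : Φ₀⁻¹ * Φ ∈ gaugeGroup 𝓘(ℝ, E) M k :=
    mul_mem (inv_mem (gaugeHom_mem hlam _)) hΦ
  obtain ⟨Ψ, hΨ⟩ := IsGauge.exists_lieAut hδ (fun m v => by
    refine (LinearEquiv.symm_apply_eq (Φ₀ m)).2 ?_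
    refine Eq.trans (b := (v, adjointCLM e (f m) 0 + gaugeForm Φ m v))
      (Prod.ext (hΦ.anchor m _) ?_) (hΦ₀a m (v, 0)).symm
    refine Eq.trans ?_ (congrArg (· + _) (map_zero (adjointCLM e (f m))).symm)
    exact (zero_add _).symm) m₀
  refine ⟨⟨f, Ψ⟩, by simp [f, hh1], ?_⟩
  funext m
  refine LinearEquiv.ext fun x => ?_
  have h1 : Φ m x = Φ₀ m ((Φ₀⁻¹ * Φ) m x) := ((Φ₀ m).apply_symm_apply (Φ m x)).symm
  rw [h1, hΨ, hΦ₀a]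
  refine (gaugeFamily_apply e f Ψ m x).trans ?_
  rw [hfh, hhl]

lemma gaugeHom_eq_one_iff
    (p : C^∞⟮𝓘(ℝ, E), M; 𝓘(ℝ, F), K⟯ ⋊[(postcomp 𝓘(ℝ, E) M).comp lam] lieAut k) :
    gaugeHom hlam p = 1 ↔ ∃ c : K, p = ⟨ContMDiffMap.const c⁻¹, Ad e c⟩ := by
  constructor
  · intro hp
    have hp' : ∀ (m : M) (v : E) (ξ : k), adjointCLM e (p.left m) (p.right.1 ξ) +
        (leftLogDeriv e (fun y => (p.left y)⁻¹) m : E →L[ℝ] k) v = ξ := fun m v ξ =>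
      congrArg (fun T : Π m : M, (TangentSpace 𝓘(ℝ, E) m × k) ≃ₗ[ℝ] (TangentSpace 𝓘(ℝ, E) m × k) =>
        (T m (v, ξ)).2) hp
    obtain ⟨m₀⟩ : Nonempty M := inferInstance
    -- Evaluating at `ξ = 0` kills the linear part, so the logarithmic derivative vanishes and `f`
    -- is constant.
    have hc : (fun y => (p.left y)⁻¹) = fun _ => (p.left m₀)⁻¹ := by
      refine eq_of_leftLogDeriv_eq e (E := E) p.left.contMDiff.inv contMDiff_const (fun m => ?_)
        (m := m₀) rfl
      rw [leftLogDeriv_const]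
      ext v
      have := hp' m v 0
      rwa [map_zero, map_zero, zero_add] at this
    refine ⟨(p.left m₀)⁻¹, SemidirectProduct.ext (ContMDiffMap.ext fun m => ?_) ?_⟩
    · rw [inv_inv]
      exact inv_injective (congrFun hc m)
    -- Evaluating at `v = 0` gives `Ad_f Ψ = 1`.
    · rw [map_inv, eq_inv_iff_mul_eq_one, mul_eq_one_comm]
      refine Subtype.ext (LinearEquiv.ext fun ξ => ?_)
      have := hp' m₀ 0 ξ
      rw [map_zero, add_zero] at this
      exact this
  · rintro ⟨c, rfl⟩
    funext m
    refine LinearEquiv.ext fun x => Prod.ext rfl ?_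
    change adjointCLM e c⁻¹ (adjointCLM e c x.2) +
      (leftLogDeriv e (fun _ : M => (c⁻¹)⁻¹) m : E →L[ℝ] k) x.1 = x.2
    rw [leftLogDeriv_const, adjointCLM_inv_apply_self]
    exact add_zero _

end Surjectivity

end

theorem mainTheorem6
    -- `M` is a connected, simply connected smooth manifold
    {E : Type*} [NormedAddCommGroup E] [NormedSpace ℝ E] [FiniteDimensional ℝ E]
    {M : Type*} [TopologicalSpace M] [T2Space M] [SecondCountableTopology M]
    [ChartedSpace E M] [IsManifold 𝓘(ℝ, E) ∞ M] [SimplyConnectedSpace M]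
    -- `k` is a finite-dimensional real Lie algebra
    {k : Type*} [NormedLieRing k] [NormedLieAlgebra k] [FiniteDimensional ℝ k]
    -- `K` is a connected, simply connected Lie group integrating `k`
    {F : Type*} [NormedAddCommGroup F] [NormedSpace ℝ F] [FiniteDimensional ℝ F]
    {K : Type*} [TopologicalSpace K] [T2Space K] [ChartedSpace F K] [Group K]
    [LieGroup 𝓘(ℝ, F) ∞ K] [SimplyConnectedSpace K]
    (e : GroupLieAlgebra 𝓘(ℝ, F) K ≃ₗ⁅ℝ⁆ k) :
    -- `Aut(k)` acts on `K` by smooth automorphisms, in a unique way integrating its action on `k`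
    (∃! lam : lieAut k →* LieGroupAut.smoothAut 𝓘(ℝ, F) K,
      ∀ Ψ, LieGroupAut.differential e (lam Ψ) = Ψ) ∧
    ∀ lam : lieAut k →* LieGroupAut.smoothAut 𝓘(ℝ, F) K,
      (∀ Ψ, LieGroupAut.differential e (lam Ψ) = Ψ) →
      -- the actions of `C^∞(M, K)` and `Aut(k)` combine to a homomorphism to `Gau(TM × k)`
      ∃ Θ : C^∞⟮𝓘(ℝ, E), M; 𝓘(ℝ, F), K⟯
            ⋊[(LieGroupAut.postcomp 𝓘(ℝ, E) M).comp lam] lieAut k →*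
          TrivialAlgebroid.gaugeGroup 𝓘(ℝ, E) M k,
        (∀ (f : C^∞⟮𝓘(ℝ, E), M; 𝓘(ℝ, F), K⟯) (Ψ : lieAut k) (m : M)
            (v : TangentSpace 𝓘(ℝ, E) m) (ξ : k),
          (Θ ⟨f, Ψ⟩).1 m (v, ξ) =
            (v, (LieGroupAut.Ad e (f m)).1 (Ψ.1 ξ) -
              LieGroupAut.maurerCartanRight e (f m) (mfderiv 𝓘(ℝ, E) 𝓘(ℝ, F) f m v))) ∧
        Function.Surjective Θ ∧
        (∀ p, p ∈ Θ.ker ↔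
          ∃ c : K, p = ⟨ContMDiffMap.const c⁻¹, LieGroupAut.Ad e c⟩) ∧
        ∀ (m₀ : M) (γ : TrivialAlgebroid.gaugeGroup 𝓘(ℝ, E) M k),
          ∃! p : C^∞⟮𝓘(ℝ, E), M; 𝓘(ℝ, F), K⟯
              ⋊[(LieGroupAut.postcomp 𝓘(ℝ, E) M).comp lam] lieAut k,
            p.left m₀ = 1 ∧ Θ p = γ := by
  refine ⟨existsUnique_integration e, fun lam hlam =>
    ⟨(gaugeHom hlam).codRestrict _ (gaugeHom_mem hlam), fun f Ψ m v ξ => ?_, fun γ => ?_,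
      fun p => ?_, fun m₀ γ => ?_⟩⟩
  · refine (gaugeFamily_apply e f Ψ m (v, ξ)).trans (Prod.ext rfl ?_)
    have h := maurerCartanRight_mfderiv e ((f.contMDiff m).mdifferentiableAt (by simp)) v
    refine Eq.trans ?_ (congrArg (_ - ·) h).symm
    exact (sub_neg_eq_add _ _).symm
  · obtain ⟨m₀⟩ : Nonempty M := inferInstance
    obtain ⟨p, -, hp⟩ := exists_gaugeHom_eq hlam γ.2 m₀
    exact ⟨p, Subtype.ext hp⟩
  · rw [← gaugeHom_eq_one_iff hlam p, MonoidHom.mem_ker]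
    exact Subtype.ext_iff
  · obtain ⟨p, hp1, hp⟩ := exists_gaugeHom_eq hlam γ.2 m₀
    refine ⟨p, ⟨hp1, Subtype.ext hp⟩, fun q hq => ?_⟩
    have hq2 : gaugeHom hlam q = γ.1 := congrArg Subtype.val hq.2
    -- Two pairs with the same image differ by a kernel element given by some `c`. Automorphisms of
    -- `K` fix 1, so comparing values at `m₀` forces `c = 1`.
    obtain ⟨c, hc⟩ := (gaugeHom_eq_one_iff hlam (q * p⁻¹)).1 (by
      rw [map_mul, map_inv, hq2, hp, mul_inv_cancel])
    have hqp : q = ⟨ContMDiffMap.const c⁻¹, LieGroupAut.Ad e c⟩ * p := by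
      rw [← hc, inv_mul_cancel_right]
    have h1 : q.left m₀ = c⁻¹ * (lam (LieGroupAut.Ad e c)).1 (p.left m₀) := by rw [hqp]; rfl
    rw [hq.1, hp1, map_one, mul_one] at h1
    have hc1 : c = 1 := inv_eq_one.1 h1.symm
    rw [hqp, hc1, map_one, inv_one]
    exact one_mul p
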